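/- **Setting.** A *triangular mesh* $M$ is a (finite or infinite) set of nondegenerate, counterclockwise triangles in $\mathbb R^2$, each listed once, such that two different triangles intersect exactly in the convex hull of their common corners (for instance a regular equilateral grid). Let $S$ be a set of nondegenerate boundary segments such that * two different segments meet at most in common end points; * every segment lies in the region covered by $M$; * every (closed) triangle of $M$ is met by at most two segments of $S$; * if a triangle of $M$ contains a free end of a chain, i.e. a point that is an end point of only one segment $s\in S$, then it meets no other segment and does not contain the other end point of $s$ (an empty condition if all chains are closed). A *boundary vertex* is an end point of a segment of $S$. The *points inserted* on an edge $e$ of $M$ are the points $x$ of its relative interior such that $x$ is a boundary vertex or $s\cap e=\{x\}$ for some $s\in S$. The *intersection points* of $s\in S$ are the points $x$ with $s\cap e=\{x\}$ for some edge $e$ of $M$, and the vertices of $M$ lying on $s$. **SBMT retriangulation.** Let $T=ABC\in M$. Write $X_0,X_1$ for the points inserted on $AB$ (in order from $A$ to $B$), $Y_0,Y_1$ for those on $BC$ (from $B$ to $C$), $Z_0,Z_1$ for those on $CA$ (from $C$ to $A$), $(i,j,k)$ for the numbers of inserted points on $AB,BC,CA$, and $P$ for the boundary vertex in $T$, if there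 is one. The lookup table is * no boundary vertex in $T$: $(0,0,0)$: $ABC$; $(0,1,0)$: $AY_0C,\ ABY_0$; $(0,1,1)$: $Z_0Y_0C,\ Z_0AB,\ Y_0Z_0B$; $(0,2,1)$: $ABY_0,\ AY_0Y_1,\ AY_1Z_0,\ Z_0Y_1C$; $(1,1,2)$: $X_0Z_1A,\ X_0Z_0Z_1,\ X_0Y_0Z_0,\ X_0BY_0,\ Z_0Y_0C$; $(0,2,2)$: $ABZ_1,\ Z_1BY_0,\ Z_0Z_1Y_0,\ Z_0Y_0Y_1,\ Z_0Y_1C$; * $P=A$: $(0,0,0)$: $ABC$; $(0,1,0)$: $ABY_0,\ AY_0C$; $(0,2,0)$: $ABY_0,\ AY_0Y_1,\ AY_1C$; * $P$ in the relative interior of $CA$: $(0,0,1)$: $CPB,\ PAB$; $(0,1,1)$: $PY_0C,\ BY_0P,\ ABP$; $(1,1,1)$: $AX_0P,\ PY_0C,\ PX_0Y_0,\ X_0BY_0$; $(0,2,1)$: $PY_1C,\ PY_0Y_1,\ PAB,\ PBY_0$; * $P$ in the interior of $T$: $(0,0,0)$: $CAP,\ ABP,\ CPB$; $(0,1,0)$: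 $CAP,\ ABP,\ CPY_0,\ PBY_0$; $(0,1,1)$: $Z_0PC,\ PY_0C,\ Z_0AP,\ ABP,\ Y_0PB$; $(0,0,2)$: $Z_0PC,\ PZ_0Z_1,\ Z_1AP,\ BCP,\ ABP$. The corners of $T$ are first relabelled by one of the six symmetries (rotations and reflections) that brings $T$ to an entry of the table. A *symmetry-breaking convention* $g$ chooses one such symmetry for each $T\in M$. The *patch* of $T$ is the listed set of sub-triangles, oriented counterclockwise, and the retriangulation $M_g$ is the union of all patches. **Theorem 3.5 (Exact embedding of boundary segments).** Assume that each segment of $S$ meets only finitely many triangles of $M$. Then every triangle of $M$ can be brought to an entry of the table, so that conventions $g$ exist, and for every convention $g$: 1. $M_g$ is again a triangular mesh in the above sense (no gaps, overlaps or hanging vertices), and the patch of every $T\in M$ covers exactly $T$; 2. every $s\in S$ is a contiguous, watertight chain of edges of $M_g$: there are points $c_0,\dots,c_n$, strictly monotone along $s$ from one end point to the other, such that consecutive points are joined by an edge of $M_g$; every triangle $R\in M_g$ meets the edge $c_kc_{k+1}$ exactly in the convex hull of those of its two end points that are corners of $R$; and $\{c_0,\dots,c_n\}$ consists exactly of the two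 end points of $s$ and the intersection points of $s$ with $M$. -/

import Mathlib

namespace SBMT

/-! ### Planar triangles and triangular meshes -/

/-- The Euclidean plane. -/
abbrev Plane := EuclideanSpace ℝ (Fin 2)

/-- A triangle with labelled corners `A = T 0`, `B = T 1`, `C = T 2`. -/
abbrev Triangle := Fin 3 → Plane

/-- Twice the signed area of the triangle `a b c`; positive iff it is counterclockwise. -/
def orient (a b c : Plane) : ℝ :=
  (b 0 - a 0) * (c 1 - a 1) - (b 1 - a 1) * (c 0 - a 0)

/-- The closed region bounded by a triangle. -/
def hull (T : Triangle) : Set Plane := convexHull ℝ (Set.range T)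

/-- The closed edges: `edge T 0 = AB`, `edge T 1 = BC`, `edge T 2 = CA`. -/
def edge (T : Triangle) (i : Fin 3) : Set Plane := segment ℝ (T i) (T (i + 1))

/-- The same edges without their two end points. -/
def openEdge (T : Triangle) (i : Fin 3) : Set Plane := openSegment ℝ (T i) (T (i + 1))

/-- A conforming triangular mesh (possibly infinite): the triangles are nondegenerate and
counterclockwise, each is listed once, and two different ones meet exactly in the face spanned
by their common corners (nothing, one corner, or one whole edge). In particular there are no
overlaps, no cracks inside the covered region along a shared edge, and no T-junctions. -/
structure IsMesh (M : Set Triangle) : Prop where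
  ccw : ∀ T ∈ M, 0 < orient (T 0) (T 1) (T 2)
  distinct : ∀ T ∈ M, ∀ T' ∈ M, T ≠ T' → Set.range T ≠ Set.range T'
  conforming : ∀ T ∈ M, ∀ T' ∈ M, T ≠ T' →
    hull T ∩ hull T' = convexHull ℝ (Set.range T ∩ Set.range T')

/-- `x y` is an edge of some triangle of `M`. -/
def IsMeshEdge (M : Set Triangle) (x y : Plane) : Prop :=
  ∃ T ∈ M, ∃ i j : Fin 3, i ≠ j ∧ T i = x ∧ T j = y

/-! ### Boundary segments -/

/-- A boundary segment, given by its two end points. -/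
abbrev Seg := Plane × Plane

/-- The points of a boundary segment. -/
def carrier (s : Seg) : Set Plane := segment ℝ s.1 s.2

/-- `x` is an end point of `s`. -/
def IsEnd (s : Seg) (x : Plane) : Prop := x = s.1 ∨ x = s.2

/-- The segment meets the closed triangle; touching a corner or an edge counts. -/
def Meets (s : Seg) (T : Triangle) : Prop := (carrier s ∩ hull T).Nonempty

/-- The vertices of the boundary network: all end points of its segments. -/
def boundaryVertices (S : Set Seg) : Set Plane := {x | ∃ s ∈ S, IsEnd s x}

/-- Input data of the method: a planar straight line graph `S` in the region covered by the
mesh `M`, at most two segments of which meet any given triangle. Closed and open chains are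
both allowed. -/
structure Admissible (M : Set Triangle) (S : Set Seg) : Prop where
  nondegenerate : ∀ s ∈ S, s.1 ≠ s.2
  /-- different segments meet at most in common end points -/
  planar : ∀ s ∈ S, ∀ s' ∈ S, s ≠ s' → ∀ x ∈ carrier s ∩ carrier s', IsEnd s x ∧ IsEnd s' x
  covered : ∀ s ∈ S, carrier s ⊆ ⋃ T ∈ M, hull T
  two_segments : ∀ T ∈ M, {s ∈ S | Meets s T}.encard ≤ 2
  /-- A triangle containing a free end `x` of an open chain (an end point of one segment `s`
  only) meets no other segment and does not contain the other end of `s`. For closed chains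
  there is no free end, and nothing is required. -/
  free_end : ∀ T ∈ M, ∀ s ∈ S, ∀ x ∈ hull T, IsEnd s x → (∀ s' ∈ S, IsEnd s' x → s' = s) →
    (∀ s' ∈ S, Meets s' T → s' = s) ∧ (∀ y ∈ hull T, IsEnd s y → y = x)

/-- The intersection points of `s` with the mesh `M`: the points where `s` meets a mesh edge in
exactly one point, and the mesh vertices on `s`. (Where `s` overlaps an edge, the ends of the
overlap are mesh vertices or end points of `s`.) -/
def intersectionPoints (M : Set Triangle) (s : Seg) : Set Plane :=
  {x | ∃ T ∈ M, ∃ i, carrier s ∩ edge T i = {x}} ∪ {x ∈ carrier s | ∃ T ∈ M, ∃ i, T i = x}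

/-! ### Classification of the local configuration in a triangle -/

/-- The points inserted on the open edge `i` of `T`: the single crossings of that edge by
segments, and the boundary vertices on it. Coinciding incidences are one point, and the set
depends on the edge only, so that two adjacent triangles read the same record. -/
def marks (S : Set Seg) (T : Triangle) (i : Fin 3) : Set Plane :=
  {x ∈ openEdge T i | x ∈ boundaryVertices S ∨ ∃ s ∈ S, carrier s ∩ edge T i = {x}}

/-- Position of the boundary vertex in a triangle. -/
inductive Location where
  | absent
  | corner (i : Fin 3)
  | onEdge (i : Fin 3)
  | inside

open Classical in
/-- Where `T` contains a boundary vertex, if it contains one. -/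
noncomputable def location (S : Set Seg) (T : Triangle) : Location :=
  if h : ∃ i, T i ∈ boundaryVertices S then .corner h.choose
  else if h : ∃ i, (openEdge T i ∩ boundaryVertices S).Nonempty then .onEdge h.choose
  else if (interior (hull T) ∩ boundaryVertices S).Nonempty then .inside
  else .absent

/-- Symbolic key of a configuration: the position of the boundary vertex and the numbers of
points inserted on `AB`, `BC`, `CA`. -/
structure Key where
  loc : Location
  ab : ℕ
  bc : ℕ
  ca : ℕ

/-- The key of the labelled triangle `T`. -/
noncomputable def key (S : Set Seg) (T : Triangle) : Key :=
  ⟨location S T, (marks S T 0).ncard, (marks S T 1).ncard, (marks S T 2).ncard⟩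

/-! ### The lookup table -/

/-- Vertex labels of the templates: the corners, the points inserted on an edge (`ab 0`, `ab 1`
are counted from `A` to `B`, `bc 0`, `bc 1` from `B` to `C`, `ca 0`, `ca 1` from `C` to `A`), and
the boundary vertex `P`. -/
inductive Label where
  | A | B | C
  | ab (j : ℕ) | bc (j : ℕ) | ca (j : ℕ)
  | P

open Label in
/-- The lookup table: for each canonical key the list of the sub-triangles. The remaining keys
are brought to a canonical one by a symmetry of the triangle. -/
def template : Key → Option (List (Label × Label × Label))
  -- no boundary vertex in the triangle: no segment, or one or two segments passing through
  | ⟨.absent, 0, 0, 0⟩ => some [(A, B, C)]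
  | ⟨.absent, 0, 1, 0⟩ => some [(A, bc 0, C), (A, B, bc 0)]
  | ⟨.absent, 0, 1, 1⟩ => some [(ca 0, bc 0, C), (ca 0, A, B), (bc 0, ca 0, B)]
  | ⟨.absent, 0, 2, 1⟩ =>
      some [(A, B, bc 0), (A, bc 0, bc 1), (A, bc 1, ca 0), (ca 0, bc 1, C)]
  | ⟨.absent, 1, 1, 2⟩ =>
      some [(ab 0, ca 1, A), (ab 0, ca 0, ca 1), (ab 0, bc 0, ca 0), (ab 0, B, bc 0),
        (ca 0, bc 0, C)]
  | ⟨.absent, 0, 2, 2⟩ =>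
      some [(A, B, ca 1), (ca 1, B, bc 0), (ca 0, ca 1, bc 0), (ca 0, bc 0, bc 1),
        (ca 0, bc 1, C)]
  -- the boundary vertex is the corner `A`
  | ⟨.corner 0, 0, 0, 0⟩ => some [(A, B, C)]
  | ⟨.corner 0, 0, 1, 0⟩ => some [(A, B, bc 0), (A, bc 0, C)]
  | ⟨.corner 0, 0, 2, 0⟩ => some [(A, B, bc 0), (A, bc 0, bc 1), (A, bc 1, C)]
  -- the boundary vertex is on the open edge `CA` (and is the point inserted there)
  | ⟨.onEdge 2, 0, 0, 1⟩ => some [(C, P, B), (P, A, B)]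
  | ⟨.onEdge 2, 0, 1, 1⟩ => some [(P, bc 0, C), (B, bc 0, P), (A, B, P)]
  | ⟨.onEdge 2, 1, 1, 1⟩ =>
      some [(A, ab 0, P), (P, bc 0, C), (P, ab 0, bc 0), (ab 0, B, bc 0)]
  | ⟨.onEdge 2, 0, 2, 1⟩ =>
      some [(P, bc 1, C), (P, bc 0, bc 1), (P, A, B), (P, B, bc 0)]
  -- the boundary vertex is in the interior
  | ⟨.inside, 0, 0, 0⟩ => some [(C, A, P), (A, B, P), (C, P, B)]
  | ⟨.inside, 0, 1, 0⟩ => some [(C, A, P), (A, B, P), (C, P, bc 0), (P, B, bc 0)]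
  | ⟨.inside, 0, 1, 1⟩ =>
      some [(ca 0, P, C), (P, bc 0, C), (ca 0, A, P), (A, B, P), (bc 0, P, B)]
  | ⟨.inside, 0, 0, 2⟩ =>
      some [(ca 0, P, C), (P, ca 0, ca 1), (ca 1, A, P), (B, C, P), (A, B, P)]
  | _ => none

/-! ### Instantiation of the templates -/

/-- The point inserted on edge `i` of `T` that has exactly `j` inserted points between the first
corner of the edge and itself. -/
noncomputable def nthMark (S : Set Seg) (T : Triangle) (i : Fin 3) (j : ℕ) : Plane :=
  Classical.epsilon fun x =>
    x ∈ marks S T i ∧ (marks S T i ∩ openSegment ℝ (T i) x).ncard = j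

/-- The geometric point denoted by a label in the labelled triangle `T`. -/
noncomputable def place (S : Set Seg) (T : Triangle) : Label → Plane
  | .A => T 0
  | .B => T 1
  | .C => T 2
  | .ab j => nthMark S T 0 j
  | .bc j => nthMark S T 1 j
  | .ca j => nthMark S T 2 j
  | .P => Classical.epsilon fun x => x ∈ hull T ∧ x ∈ boundaryVertices S

/-- The triangle `a b c`, listed counterclockwise. -/
noncomputable def ccwTriangle (a b c : Plane) : Triangle :=
  open Classical in if 0 < orient a b c then ![a, b, c] else ![a, c, b]

/-- The sub-triangles replacing `T`, when the symmetry `g` (one of the six rotations and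
reflections, acting on the corner labels) is used to reach a canonical key. -/
noncomputable def patch (S : Set Seg) (T : Triangle) (g : Equiv.Perm (Fin 3)) : Set Triangle :=
  {R | ∃ F, template (key S (T ∘ g)) = some F ∧ ∃ f ∈ F,
    R = ccwTriangle (place S (T ∘ g) f.1) (place S (T ∘ g) f.2.1) (place S (T ∘ g) f.2.2)}

/-- A symmetry-breaking convention: it assigns to each triangle of the mesh a symmetry that
brings its key to one listed in the lookup table. (Only for configurations that are themselves
symmetric is there a choice.) -/
def IsConvention (M : Set Triangle) (S : Set Seg) (g : Triangle → Equiv.Perm (Fin 3)) : Prop :=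
  ∀ T ∈ M, (template (key S (T ∘ g T))).isSome

/-- The output: every triangle of the mesh is replaced by its patch. -/
noncomputable def retriangulate (M : Set Triangle) (S : Set Seg)
    (g : Triangle → Equiv.Perm (Fin 3)) : Set Triangle :=
  ⋃ T ∈ M, patch S T (g T)

/-! ### Embedded segments -/

/-- `s` is a contiguous and watertight chain of edges of the mesh `N`, whose nodes are exactly the
points of `V`. -/
def IsEmbeddedChain (N : Set Triangle) (s : Seg) (V : Set Plane) : Prop :=
  ∃ (n : ℕ) (c : Fin (n + 1) → Plane) (t : Fin (n + 1) → ℝ),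
    -- the nodes run monotonically along `s` from one end to the other
    StrictMono t ∧ (∀ k, c k = AffineMap.lineMap s.1 s.2 (t k)) ∧
    c 0 = s.1 ∧ c (Fin.last n) = s.2 ∧
    Set.range c = V ∧
    -- consecutive nodes are joined by edges of `N`
    (∀ k : Fin n, IsMeshEdge N (c k.castSucc) (c k.succ)) ∧
    -- a triangle of `N` meets such an edge in nothing, in an end of it which is a corner of the
    -- triangle, or in the whole edge, which is then an edge of the triangle
    (∀ k : Fin n, ∀ T ∈ N, hull T ∩ segment ℝ (c k.castSucc) (c k.succ) =
      convexHull ℝ (Set.range T ∩ {c k.castSucc, c k.succ}))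

end SBMT

namespace SBMT

open Set

/-! ### Arithmetic of corner labels -/

/-! The problem is local. In one triangle `T` the hypotheses leave at most one boundary vertex,
every segment meeting `T` ends there if it exists (`LocalAdmissible.isEnd`,
`LocalAdmissible.boundaryVertex_unique`), and each edge carries at most two inserted points. A
segment leaves `T` at its own end or at a single crossing with an edge. Hence its part in `T` is a
segment between two nodes (corners, inserted points, boundary vertex), possibly equal, and it
contains no further node (`LocalAdmissible.exists_trace`).

What remains inside `T` depends only on the order of the nodes. They receive ranks in `Fin 10`: 0,
3, 6 are the corners `A`, `B`, `C`; 1, 2 lie on `AB`, 4, 5 on `BC`, 7, 8 on `CA`; 9 is an interior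
point. Three boundary ranks in cyclic order and not on one side have the same orientation for all
positions of the points, and so do rank 9 and two ranks of one side: the determinant of their
barycentric coordinates expands into positive terms (`det3_pos`, `IsFrame.orient_pos`). Separation
of sub-triangles by lines through two nodes, coverage by repeated cutting, and the crossing of
traces thus become Boolean statements on ranks. Finitely many of them suffice, decided in
`templateCheck_all`, `coverCheck_all` and `chordCheck_all`. The outcome is `isPatch_patch`: a patch
is a conforming triangulation of `T` whose vertices are exactly the nodes, and any two nodes on one
segment are joined by an edge.

For the gluing, the inserted points depend only on the edge as a set, so adjacent triangles have the
same nodes on a common edge (`IsMesh.node_mem`) and their patches conform (`conforms_of_patches`).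
The end points and intersection points of `s` are exactly the nodes on `s` (`mem_chain_iff`).
Between two consecutive ones `s` stays in one triangle, whose patch joins them by an edge
(`isEmbeddedChain`). -/

theorem corner_cases (i j : Fin 3) : j = i ∨ j = i + 1 ∨ j = i + 2 := by revert i j; decide
theorem add_one_add_two (i : Fin 3) : i + 1 + 2 = i := by revert i; decide
theorem add_two_add_one (i : Fin 3) : i + 2 + 1 = i := by revert i; decide
theorem add_two_add_two (i : Fin 3) : i + 2 + 2 = i + 1 := by revert i; decide
theorem ne_add_one (i : Fin 3) : i ≠ i + 1 := by revert i; decide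
theorem ne_add_two (i : Fin 3) : i ≠ i + 2 := by revert i; decide
theorem add_one_ne_add_two (i : Fin 3) : i + 1 ≠ i + 2 := by revert i; decide

/-! ### Barycentric coordinates -/

/-- The signed doubled area of a labelled triangle. -/
noncomputable def area (T : Triangle) : ℝ := orient (T 0) (T 1) (T 2)

/-- The barycentric coordinate of `x` at the corner `i` of `T`. -/
noncomputable def bary (T : Triangle) (i : Fin 3) (x : Plane) : ℝ :=
  orient (T (i + 1)) (T (i + 2)) x / area T

theorem orient_rotate (a b c : Plane) : orient a b c = orient b c a := by
  simp only [orient]; ring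

theorem orient_swap (a b c : Plane) : orient a c b = -orient a b c := by
  simp only [orient]; ring

theorem orient_swap_left (a b c : Plane) : orient b a c = -orient a b c := by
  simp only [orient]; ring

theorem orient_comb (a b x y : Plane) (s t : ℝ) (h : s + t = 1) :
    orient a b (s • x + t • y) = s * orient a b x + t * orient a b y := by
  obtain rfl : s = 1 - t := by linarith
  simp only [orient, PiLp.add_apply, PiLp.smul_apply, smul_eq_mul]; ring

theorem bary_comb (T : Triangle) (i : Fin 3) (x y : Plane) (s t : ℝ) (h : s + t = 1) :
    bary T i (s • x + t • y) = s * bary T i x + t * bary T i y := by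
  simp only [bary, orient_comb _ _ _ _ _ _ h]; ring

theorem bary_lineMap (T : Triangle) (i : Fin 3) (x y : Plane) (t : ℝ) :
    bary T i (AffineMap.lineMap x y t) = (1 - t) * bary T i x + t * bary T i y := by
  rw [AffineMap.lineMap_apply_module, bary_comb _ _ _ _ _ _ (by ring)]

theorem area_ne_iff_rotate (T : Triangle) (i : Fin 3) :
    orient (T i) (T (i + 1)) (T (i + 2)) = area T := by
  fin_cases i <;> simp [area, orient] <;> ring

theorem bary_self {T : Triangle} (hT : area T ≠ 0) (i : Fin 3) : bary T i (T i) = 1 := by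
  rw [bary, ← orient_rotate, area_ne_iff_rotate, div_self hT]

theorem bary_succ (T : Triangle) (i : Fin 3) : bary T i (T (i + 1)) = 0 := by
  have : orient (T (i + 1)) (T (i + 2)) (T (i + 1)) = 0 := by simp only [orient]; ring
  rw [bary, this, zero_div]

theorem bary_succ_succ (T : Triangle) (i : Fin 3) : bary T i (T (i + 2)) = 0 := by
  have : orient (T (i + 1)) (T (i + 2)) (T (i + 2)) = 0 := by simp only [orient]; ring
  rw [bary, this, zero_div]

theorem bary_ne (T : Triangle) {i j : Fin 3} (h : j ≠ i) : bary T i (T j) = 0 := by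
  have : j = i + 1 ∨ j = i + 2 := by revert i j; decide
  rcases this with rfl | rfl
  exacts [bary_succ T i, bary_succ_succ T i]

theorem bary_sum {T : Triangle} (hT : area T ≠ 0) (x : Plane) :
    bary T 0 x + bary T 1 x + bary T 2 x = 1 := by
  simp only [bary, ← add_div]
  rw [div_eq_one_iff_eq hT]
  simp [area, orient]; ring

theorem bary_decomp {T : Triangle} (hT : area T ≠ 0) (x : Plane) :
    x = bary T 0 x • T 0 + bary T 1 x • T 1 + bary T 2 x • T 2 := by
  ext k
  simp only [PiLp.add_apply, PiLp.smul_apply, smul_eq_mul, bary]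
  field_simp
  simp only [area, orient, zero_add, Fin.reduceAdd]
  fin_cases k <;> simp <;> ring

theorem eq_of_bary_eq {T : Triangle} (hT : area T ≠ 0) {x y : Plane}
    (h : ∀ i, bary T i x = bary T i y) : x = y := by
  rw [bary_decomp hT x, bary_decomp hT y, h, h, h]

/-- Multiplicativity of the determinant. It reduces the orientation of any three points to the sign
of a polynomial in their coordinates, up to the sign of `area T`. -/
theorem orient_eq_det {T : Triangle} (hT : area T ≠ 0) (p q r : Plane) :
    orient p q r = area T *
      (bary T 0 p * (bary T 1 q * bary T 2 r - bary T 2 q * bary T 1 r) -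
       bary T 1 p * (bary T 0 q * bary T 2 r - bary T 2 q * bary T 0 r) +
       bary T 2 p * (bary T 0 q * bary T 1 r - bary T 1 q * bary T 0 r)) := by
  have hp : bary T 0 p = 1 - bary T 1 p - bary T 2 p := by linarith [bary_sum hT p]
  have hq : bary T 0 q = 1 - bary T 1 q - bary T 2 q := by linarith [bary_sum hT q]
  have hr : bary T 0 r = 1 - bary T 1 r - bary T 2 r := by linarith [bary_sum hT r]
  conv_lhs => rw [bary_decomp hT p, bary_decomp hT q, bary_decomp hT r]
  rw [hp, hq, hr]
  simp only [orient, area, PiLp.add_apply, PiLp.smul_apply, smul_eq_mul]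
  ring

/-! ### The closed triangle, its edges and its faces -/

theorem corner_mem_hull (T : Triangle) (i : Fin 3) : T i ∈ hull T :=
  subset_convexHull ℝ _ (mem_range_self i)

theorem convex_hull (T : Triangle) : Convex ℝ (hull T) := convex_convexHull ℝ _

theorem convex_bary_nonneg (T : Triangle) (i : Fin 3) : Convex ℝ {x | 0 ≤ bary T i x} := by
  intro x hx y hy s t hs ht hst
  simp only [mem_ofPred_eq] at *
  rw [bary_comb _ _ _ _ _ _ hst]
  positivity

theorem mem_hull_iff {T : Triangle} (hT : area T ≠ 0) {x : Plane} :
    x ∈ hull T ↔ ∀ i, 0 ≤ bary T i x := by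
  constructor
  · intro hx i
    refine convexHull_min (t := {x | 0 ≤ bary T i x}) ?_ (convex_bary_nonneg T i) hx
    rintro _ ⟨j, rfl⟩
    rcases eq_or_ne j i with rfl | h
    · simp [bary_self hT]
    · simp [bary_ne T h]
  · intro h
    have hsum := bary_sum hT x
    have := (convex_hull T).sum_mem (t := Finset.univ) (w := fun i => bary T i x) (z := T)
      (fun i _ => h i) (by simpa [Fin.sum_univ_three] using hsum)
      (fun i _ => corner_mem_hull T i)
    rw [Fin.sum_univ_three, ← bary_decomp hT x] at this
    exact this

theorem edge_subset_hull (T : Triangle) (i : Fin 3) : edge T i ⊆ hull T :=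
  (convex_hull T).segment_subset (corner_mem_hull T i) (corner_mem_hull T (i + 1))

theorem openEdge_subset_edge (T : Triangle) (i : Fin 3) : openEdge T i ⊆ edge T i :=
  openSegment_subset_segment ℝ _ _

theorem bary_succ_decomp {T : Triangle} (hT : area T ≠ 0) (i : Fin 3) (x : Plane) :
    x = bary T i x • T i + bary T (i + 1) x • T (i + 1) + bary T (i + 2) x • T (i + 2) := by
  conv_lhs => rw [bary_decomp hT x]
  fin_cases i <;> simp <;> abel

theorem bary_succ_sum {T : Triangle} (hT : area T ≠ 0) (i : Fin 3) (x : Plane) :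
    bary T i x + bary T (i + 1) x + bary T (i + 2) x = 1 := by
  rw [← bary_sum hT x]
  fin_cases i <;> simp <;> ring

theorem forall_fin_three_iff {q : Fin 3 → Prop} (i : Fin 3) :
    (∀ j, q j) ↔ q i ∧ q (i + 1) ∧ q (i + 2) := by
  refine ⟨fun h => ⟨h _, h _, h _⟩, fun ⟨h0, h1, h2⟩ j => ?_⟩
  rcases corner_cases i j with rfl | rfl | rfl <;> assumption

theorem bary_edge_point {T : Triangle} (hT : area T ≠ 0) (i : Fin 3) {s t : ℝ} (h : s + t = 1) :
    bary T i (s • T i + t • T (i + 1)) = s ∧ bary T (i + 1) (s • T i + t • T (i + 1)) = t ∧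
      bary T (i + 2) (s • T i + t • T (i + 1)) = 0 := by
  simp only [bary_comb _ _ _ _ _ _ h, bary_self hT, bary_succ, bary_ne T (ne_add_one i),
    bary_ne T (ne_add_two i), bary_ne T (add_one_ne_add_two i)]
  simp

theorem mem_edge_iff {T : Triangle} (hT : area T ≠ 0) {i : Fin 3} {x : Plane} :
    x ∈ edge T i ↔ x ∈ hull T ∧ bary T (i + 2) x = 0 := by
  constructor
  · intro h
    refine ⟨edge_subset_hull T i h, ?_⟩
    obtain ⟨s, t, hs, ht, hst, rfl⟩ := h
    exact (bary_edge_point hT i hst).2.2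
  · rintro ⟨h, h0⟩
    rw [mem_hull_iff hT] at h
    have hs := bary_succ_sum hT i x
    have hd := bary_succ_decomp hT i x
    rw [h0, zero_smul, add_zero] at hd
    exact ⟨_, _, h i, h (i + 1), by linarith, hd.symm⟩

theorem mem_openEdge_iff {T : Triangle} (hT : area T ≠ 0) {i : Fin 3} {x : Plane} :
    x ∈ openEdge T i ↔ bary T (i + 2) x = 0 ∧ 0 < bary T i x ∧ 0 < bary T (i + 1) x := by
  constructor
  · rintro ⟨s, t, hs, ht, hst, rfl⟩
    obtain ⟨h1, h2, h3⟩ := bary_edge_point hT i hst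
    rw [h1, h2, h3]; exact ⟨rfl, hs, ht⟩
  · rintro ⟨h0, h1, h2⟩
    have hs := bary_succ_sum hT i x
    have hd := bary_succ_decomp hT i x
    rw [h0, zero_smul, add_zero] at hd
    exact ⟨_, _, h1, h2, by linarith, hd.symm⟩

theorem edge_cases {T : Triangle} {i : Fin 3} {x : Plane} (h : x ∈ edge T i) :
    x = T i ∨ x = T (i + 1) ∨ x ∈ openEdge T i := by
  rw [edge, ← insert_endpoints_openSegment] at h
  simpa [openEdge] using h

theorem continuous_orient (a b : Plane) : Continuous (orient a b) := by
  unfold orient; fun_prop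

theorem continuous_bary (T : Triangle) (i : Fin 3) : Continuous (bary T i) :=
  (continuous_orient _ _).div_const _

theorem mem_interior_hull {T : Triangle} (hT : area T ≠ 0) {x : Plane}
    (h : ∀ i, 0 < bary T i x) : x ∈ interior (hull T) := by
  have ho : IsOpen {x | ∀ i, 0 < bary T i x} := by
    simp only [ofPred_forall]
    exact isOpen_iInter_of_finite fun i => isOpen_lt continuous_const (continuous_bary T i)
  refine interior_maximal (fun y hy => ?_) ho h
  exact (mem_hull_iff hT).2 fun i => (hy i).le

/-- A point of the triangle is a corner, on an open edge, or has positive coordinates. -/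
theorem hull_cases {T : Triangle} (hT : area T ≠ 0) {x : Plane} (h : x ∈ hull T) :
    (∃ i, x = T i) ∨ (∃ i, x ∈ openEdge T i) ∨ ∀ i, 0 < bary T i x := by
  by_cases hp : ∀ i, 0 < bary T i x
  · exact .inr (.inr hp)
  push Not at hp
  obtain ⟨i, hi⟩ := hp
  have h0 : bary T i x = 0 := le_antisymm hi ((mem_hull_iff hT).1 h i)
  rw [← add_one_add_two i] at h0
  rcases edge_cases ((mem_edge_iff hT).2 ⟨h, h0⟩) with h | h | h
  exacts [.inl ⟨_, h⟩, .inl ⟨_, h⟩, .inr (.inl ⟨_, h⟩)]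

theorem corner_injective {T : Triangle} (hT : area T ≠ 0) : Function.Injective T := by
  intro i j h
  by_contra hij
  have := bary_ne T hij
  rw [h, bary_self hT] at this
  exact one_ne_zero this

theorem corner_notMem_openEdge {T : Triangle} (hT : area T ≠ 0) (i j : Fin 3) :
    T i ∉ openEdge T j := by
  rw [mem_openEdge_iff hT]
  rintro ⟨h0, h1, h2⟩
  rcases corner_cases j i with rfl | rfl | rfl
  · rw [bary_ne T (ne_add_one i)] at h2; exact h2.false
  · rw [bary_ne T (ne_add_one j).symm] at h1; exact h1.false
  · rw [bary_ne T (ne_add_two j).symm] at h1; exact h1.false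

theorem openEdge_disjoint {T : Triangle} (hT : area T ≠ 0) {i j : Fin 3} {x : Plane}
    (hi : x ∈ openEdge T i) (hj : x ∈ openEdge T j) : i = j := by
  rw [mem_openEdge_iff hT] at hi hj
  have := corner_cases i j
  rcases this with rfl | rfl | rfl
  · rfl
  · have := hj.1; rw [add_one_add_two] at this; linarith [hi.2.1]
  · have := hj.1; rw [add_two_add_two] at this; linarith [hi.2.2]

/-- An open segment inside the triangle through a point of an edge lies on that edge. -/
theorem edge_extreme {T : Triangle} (hT : area T ≠ 0) {i : Fin 3} {p q x : Plane}
    (hp : p ∈ hull T) (hq : q ∈ hull T) (hx : x ∈ openSegment ℝ p q) (hxe : x ∈ edge T i) :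
    p ∈ edge T i ∧ q ∈ edge T i := by
  rw [mem_edge_iff hT] at hxe ⊢
  rw [mem_edge_iff hT]
  obtain ⟨s, t, hs, ht, hst, rfl⟩ := hx
  have h := hxe.2
  rw [bary_comb _ _ _ _ _ _ hst] at h
  have hp0 := (mem_hull_iff hT).1 hp (i + 2)
  have hq0 := (mem_hull_iff hT).1 hq (i + 2)
  have h1 : 0 ≤ s * bary T (i + 2) p := by positivity
  have h2 : 0 ≤ t * bary T (i + 2) q := by positivity
  have h1' : s * bary T (i + 2) p = 0 := by linarith
  have h2' : t * bary T (i + 2) q = 0 := by linarith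
  exact ⟨⟨hp, by simpa [hs.ne'] using h1'⟩, ⟨hq, by simpa [ht.ne'] using h2'⟩⟩

/-- A corner is the only common point of the two edges through it, so `edge_extreme` for both edges
pins down `p` and `q`. -/
theorem corner_extreme {T : Triangle} (hT : area T ≠ 0) {i : Fin 3} {p q : Plane}
    (hp : p ∈ hull T) (hq : q ∈ hull T) (hx : T i ∈ openSegment ℝ p q) : p = T i ∧ q = T i := by
  have h1 : T i ∈ edge T i := left_mem_segment ℝ _ _
  have h2 : T i ∈ edge T (i + 2) := by rw [edge, add_two_add_one]; exact right_mem_segment ℝ _ _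
  obtain ⟨a, b⟩ := edge_extreme hT hp hq hx h1
  obtain ⟨c, d⟩ := edge_extreme hT hp hq hx h2
  rw [mem_edge_iff hT] at a b c d
  rw [add_two_add_two] at c d
  have key : ∀ y, bary T (i + 2) y = 0 → bary T (i + 1) y = 0 → y = T i := by
    intro y h2 h1
    have hs := bary_succ_sum hT i y
    have hd := bary_succ_decomp hT i y
    rw [h1, h2] at hs hd
    simp at hs hd
    rw [hs, one_smul] at hd
    exact hd
  exact ⟨key p a.2 c.2, key q b.2 d.2⟩

/-! ### Ranks: the combinatorial model of a triangle with its nodes -/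

/-- The index of a rank on side `e`, counted from its first corner; it is at most `3` exactly
for the ranks on that side. -/
def sideIdx (e : Fin 3) (r : Fin 10) : ℕ := (r.val + 9 - 3 * e.val) % 9

/-- Whether rank `r` is on the closed side `e`. -/
def onSide (e : Fin 3) (r : Fin 10) : Bool := r.val != 9 && Nat.ble (sideIdx e r) 3

/-- Whether rank `r` is on side `e` strictly between the ranks `i` and `j` of that side. -/
def between (e : Fin 3) (i r j : Fin 10) : Bool :=
  onSide e r && (Nat.blt (sideIdx e i) (sideIdx e r) && Nat.blt (sideIdx e r) (sideIdx e j) ||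
    Nat.blt (sideIdx e j) (sideIdx e r) && Nat.blt (sideIdx e r) (sideIdx e i))

def increasing (i j k : Fin 10) : Bool := Nat.blt i.val j.val && Nat.blt j.val k.val

def anySide (f : Fin 3 → Bool) : Bool := f 0 || f 1 || f 2

/-- Whether the ranks `j`, `k` and the interior point are in counterclockwise position in every frame
because `j`, `k` are on a common side. -/
def innerPositive (j k : Fin 10) : Bool :=
  anySide fun e => onSide e j && onSide e k && Nat.blt (sideIdx e j) (sideIdx e k)

/-- Whether the points of ranks `i`, `j`, `k` are in counterclockwise position in every frame. -/
def positive (i j k : Fin 10) : Bool :=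
  if i.val == 9 then innerPositive j k else
  if j.val == 9 then innerPositive k i else
  if k.val == 9 then innerPositive i j else
  -- The boundary of a triangle is convex: points in cyclic order are counterclockwise unless
  -- collinear, which happens only on a common side.
  (increasing i j k || increasing j k i || increasing k i j) &&
    !(anySide fun e => onSide e i && onSide e j && onSide e k)

def ranks : List (Fin 10) := [0, 1, 2, 3, 4, 5, 6, 7, 8, 9]

/-- Whether rank `r` is a node, for `n e` marks on side `e` and a boundary vertex of rank `p`. -/
def used (n : Fin 3 → ℕ) (p : Option (Fin 10)) (r : Fin 10) : Bool :=
  if r.val == 9 then p == some 9 else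
  Nat.ble (r.val % 3) (n (Fin.ofNat 3 (r.val / 3)))

/-- Whether rank `r` is a mark that is not the boundary vertex. -/
def plain (n : Fin 3 → ℕ) (p : Option (Fin 10)) (r : Fin 10) : Bool :=
  r.val != 9 && r.val % 3 != 0 && used n p r && p != some r

/-- Whether the nodes of ranks `i`, `j` can be the end points of the trace of a segment. -/
def validChord (n : Fin 3 → ℕ) (p : Option (Fin 10)) (i j : Fin 10) : Bool :=
  i != j && used n p i && used n p j &&
  -- Every segment that meets the triangle ends at its boundary vertex.
  (match p with
    | none => true
    | some q => q == i || q == j) &&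
  -- A trace along a side overlaps the edge, so neither end is a single crossing of it. No node lies
  -- strictly inside a trace.
  !(anySide fun e => onSide e i && onSide e j &&
    (plain n p i || plain n p j || ranks.any fun r => used n p r && between e i r j))

/-- Whether the open segments `i j` and `k l` cross in every frame, with `k` to the left of `i j`. -/
def crossing (i j k l : Fin 10) : Bool :=
  positive i j k && positive j i l && positive k l j && positive l k i

/-- Whether the traces `i j` and `k l` of two segments can occur together; a trace with equal ends
stands for a segment with at most one node. -/
def compatible (p : Option (Fin 10)) (i j k l : Fin 10) : Bool :=
  i == j || k == l ||
  match p with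
  -- Two segments meet only in common end points. Without a boundary vertex their traces are
  -- disjoint; with one they share that vertex and cannot share a second node.
  | none => i != k && i != l && j != k && j != l && !crossing i j k l && !crossing i j l k
  | some _ => !(i == k && j == l) && !(i == l && j == k)

/-- Whether every mark that is not the boundary vertex is an end of one of two traces. -/
def covers (n : Fin 3 → ℕ) (p : Option (Fin 10)) (i j k l : Fin 10) : Bool :=
  ranks.all fun r => !(plain n p r) || i != j && (r == i || r == j) || k != l && (r == k || r == l)

/-- The location of a boundary vertex of rank `p`. -/
def locationOf : Option (Fin 10) → Location
  | none => .absent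
  | some q => if q.val == 9 then .inside else
      if q.val % 3 == 0 then .corner (Fin.ofNat 3 (q.val / 3)) else .onEdge (Fin.ofNat 3 (q.val / 3))

/-- The rank of the point with a given label. -/
def labelRank (p : Option (Fin 10)) : Label → Fin 10
  | .A => 0
  | .B => 3
  | .C => 6
  | .ab j => if j = 0 then 1 else 2
  | .bc j => if j = 0 then 4 else 5
  | .ca j => if j = 0 then 7 else 8
  | .P => p.getD 9

/-- A triangle, given by the ranks of its corners. -/
abbrev RankTriple := Fin 10 × Fin 10 × Fin 10

/-- The entry of the lookup table, in terms of ranks. -/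
def rankTemplate (n : Fin 3 → ℕ) (p : Option (Fin 10)) : Option (List RankTriple) :=
  (template ⟨locationOf p, n 0, n 1, n 2⟩).map
    (List.map fun f => (labelRank p f.1, labelRank p f.2.1, labelRank p f.2.2))

def RankTriple.has (t : RankTriple) (i : Fin 10) : Bool := i == t.1 || i == t.2.1 || i == t.2.2

/-- The side of the original triangle that is side `e` after relabelling by `g`. -/
def edgeImage (g : Equiv.Perm (Fin 3)) (e : Fin 3) : Fin 3 := g (e + 2) + 1

/-- The location of the boundary vertex after relabelling by `g`. -/
def permLocation (g : Equiv.Perm (Fin 3)) : Location → Location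
  | .absent => .absent
  | .corner i => .corner (g⁻¹ i)
  | .onEdge i => .onEdge (g⁻¹ (i + 2) + 1)
  | .inside => .inside

def symmetries : List (Equiv.Perm (Fin 3)) :=
  [1, finRotate 3, finRotate 3 * finRotate 3, Equiv.swap 0 1, Equiv.swap 1 2, Equiv.swap 0 2]

/-- Whether some relabelling has an entry in the lookup table. -/
def canonicalizable (n : Fin 3 → ℕ) (p : Option (Fin 10)) : Bool :=
  symmetries.any fun g => (template ⟨permLocation g (locationOf p), n (edgeImage g 0),
    n (edgeImage g 1), n (edgeImage g 2)⟩).isSome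

/-- Whether some relabelling has an entry in the table and, if the given labelling has one, the chord
`i j` is an edge of it. -/
def chordGood (n : Fin 3 → ℕ) (p : Option (Fin 10)) (i j : Fin 10) : Bool :=
  canonicalizable n p && (i == j || match rankTemplate n p with
    | none => true
    | some F => F.any fun t => t.has i && t.has j)

/-- The possible traces up to orientation, with `(0, 0)` for a trace with at most one node. -/
def chordList (n : Fin 3 → ℕ) (p : Option (Fin 10)) : List (Fin 10 × Fin 10) :=
  (0, 0) :: (ranks.product ranks).filter fun c => Nat.blt c.1.val c.2.val && validChord n p c.1 c.2

/-- All compatible pairs of traces that account for the marks are good. -/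
def chordCheck (n : Fin 3 → ℕ) (p : Option (Fin 10)) : Bool :=
  (chordList n p).all fun c => (chordList n p).all fun d =>
    !(compatible p c.1 c.2 d.1 d.2 && covers n p c.1 c.2 d.1 d.2) || chordGood n p c.1 c.2

/-- Whether the line through ranks `x` and `y` separates `s` on its left from `t` on its right. -/
def separates (x y : Fin 10) (s t : RankTriple) : Bool :=
  ([s.1, s.2.1, s.2.2].all fun v => v == x || v == y || positive x y v) &&
  ([t.1, t.2.1, t.2.2].all fun v => v == x || v == y || positive y x v)

def separated (s t : RankTriple) : Bool :=
  ranks.any fun x => ranks.any fun y => separates x y s t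

def pairwiseSep : List RankTriple → Bool
  | [] => true
  | s :: l => (l.all fun t => separated s t) && pairwiseSep l

/-- Whether a label stands for a node. -/
def labelUsed (n : Fin 3 → ℕ) (p : Option (Fin 10)) : Label → Bool
  | .ab j => Nat.blt j (n 0)
  | .bc j => Nat.blt j (n 1)
  | .ca j => Nat.blt j (n 2)
  | .P => p.isSome
  | _ => true

/-- Points denoted by labels are picked with `Classical.epsilon`; this check ensures that the table
never asks for one that does not exist. -/
def labelsCheck (n : Fin 3 → ℕ) (p : Option (Fin 10)) : Bool :=
  match template ⟨locationOf p, n 0, n 1, n 2⟩ with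
  | none => true
  | some F => F.all fun f => labelUsed n p f.1 && labelUsed n p f.2.1 && labelUsed n p f.2.2

/-- The triangles of the table are counterclockwise, pairwise separated, and their corners are exactly
the nodes. -/
def templateCheck (n : Fin 3 → ℕ) (p : Option (Fin 10)) : Bool :=
  match rankTemplate n p with
  | none => true
  | some F => F.all (fun t => positive t.1 t.2.1 t.2.2 && used n p t.1 && used n p t.2.1 && used n p t.2.2)
      && pairwiseSep F && (ranks.all fun r => !used n p r || F.any fun t => t.has r)

def RankTriple.same (s t : RankTriple) : Bool :=
  t.has s.1 && t.has s.2.1 && t.has s.2.2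

def anyBetween (i r j : Fin 10) : Bool :=
  anySide fun e => onSide e i && onSide e j && between e i r j

/-- Whether the triangle `t` is a union of triangles in `F`, after at most `m` splittings of a side. -/
def coverable (F : List RankTriple) : ℕ → RankTriple → Bool
  | 0, t => F.any fun f => t.same f
  | m + 1, t => (F.any fun f => t.same f) || ranks.any fun d =>
      (anyBetween t.2.1 d t.2.2 &&
        coverable F m (t.1, t.2.1, d) && coverable F m (t.1, d, t.2.2)) ||
      (anyBetween t.2.2 d t.1 &&
        coverable F m (t.2.1, t.2.2, d) && coverable F m (t.2.1, d, t.1)) ||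
      (anyBetween t.1 d t.2.1 &&
        coverable F m (t.2.2, t.1, d) && coverable F m (t.2.2, d, t.2.1))

/-- Needed for the entries with inserted points on all three sides: there no edge joins a corner to
the opposite side, so no first cut from a corner is possible. -/
def medialSplit : List RankTriple := [(0, 1, 7), (1, 3, 4), (4, 6, 7), (1, 4, 7)]

/-- For the entries with an interior vertex; afterwards only the outer sides have to be cut. -/
def innerSplit : List RankTriple := [(9, 0, 3), (9, 3, 6), (9, 6, 0)]

/-- The triangles of the table cover the whole triangle. -/
def coverCheck (n : Fin 3 → ℕ) (p : Option (Fin 10)) : Bool :=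
  match rankTemplate n p with
  | none => true
  | some F => coverable F 4 (0, 3, 6) || (medialSplit.all (coverable F 1)) ||
      innerSplit.all (coverable F 2)

def consistent (n : Fin 3 → ℕ) (p : Option (Fin 10)) : Bool :=
  match p with
    | none => true
    | some q => used n p q

def counts : List (Fin 3 → ℕ) :=
  [0,1,2].flatMap fun a => [0,1,2].flatMap fun b => [0,1,2].map fun c => ![a, b, c]

def vertexRanks : List (Option (Fin 10)) := none :: ranks.map some

def allCheck (f : (Fin 3 → ℕ) → Option (Fin 10) → Bool) : Bool :=
  counts.all fun n => vertexRanks.all fun p => !consistent n p || f n p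

/-! ### Finite verification of the lookup table -/

theorem templateCheck_all : allCheck templateCheck = true := by decide +kernel

theorem coverCheck_all : allCheck coverCheck = true := by decide +kernel

theorem labelsCheck_all : allCheck labelsCheck = true := by decide +kernel

/-- The combinatorial core. Every choice of at most two compatible traces that explains all inserted
points leads to a table entry up to symmetry, and the traces are edges of the entry. Ordered pairs
are enumerated, so testing the first trace of a pair is enough. -/
theorem chordCheck_all : allCheck chordCheck = true := by decide +kernel

/-- Used for the injectivity of frames: if two of the points coincided, a triple of nonzero area
would be degenerate. -/
theorem exists_positive_of_ne : ∀ i j : Fin 10, i ≠ j →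
    ∃ k, positive i j k = true ∨ positive j i k = true := by decide +kernel

/-! ### Orientation of ranks in an arbitrary frame -/

def det3 (x y z : Fin 3 → ℝ) : ℝ :=
  x 0 * (y 1 * z 2 - y 2 * z 1) - x 1 * (y 0 * z 2 - y 2 * z 0) + x 2 * (y 0 * z 1 - y 1 * z 0)

/-- Row `r` holds the barycentric coordinates of rank `r`, with side `e` cut in the proportions `a e
: b e : c e`. With gap lengths as parameters, the order of the points on a side is just positivity,
and the determinants needed have no negative term after expansion. -/
def weights (a b c : Fin 3 → ℝ) (x : Fin 3 → ℝ) : Fin 10 → Fin 3 → ℝ :=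
  ![![1, 0, 0], ![b 0 + c 0, a 0, 0], ![c 0, a 0 + b 0, 0],
    ![0, 1, 0], ![0, b 1 + c 1, a 1], ![0, c 1, a 1 + b 1],
    ![0, 0, 1], ![a 2, 0, b 2 + c 2], ![a 2 + b 2, 0, c 2], x]

-- A case check in which each determinant expands to a sum of products of positive numbers. Taking
-- `i` minimal removes the cyclic repetitions, which `det3_rotate` restores.
set_option maxHeartbeats 1600000 in
theorem det3_pos_of_increasing (a b c x : Fin 3 → ℝ) (ha : ∀ i, 0 < a i) (hb : ∀ i, 0 < b i)
    (hc : ∀ i, 0 < c i) (hx : ∀ i, 0 < x i) :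
    ∀ i j k, i ≤ j → i ≤ k → positive i j k = true →
      0 < det3 (weights a b c x i) (weights a b c x j) (weights a b c x k) := by
  obtain ⟨a0, a1, a2⟩ := (forall_fin_three_iff 0).1 ha
  obtain ⟨b0, b1, b2⟩ := (forall_fin_three_iff 0).1 hb
  obtain ⟨c0, c1, c2⟩ := (forall_fin_three_iff 0).1 hc
  obtain ⟨x0, x1, x2⟩ := (forall_fin_three_iff 0).1 hx
  simp only [zero_add] at *
  intro i j k hij hik h
  fin_cases i <;> fin_cases j <;> first | (exfalso; revert hij; decide) | skip
  all_goals fin_cases k <;> first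
    | (exfalso; revert hik h; decide)
    | (dsimp [det3, weights]; ring_nf; done)
    | (dsimp [det3, weights]; ring_nf; positivity)
theorem positive_rotate (i j k : Fin 10) : positive i j k = positive j k i := by
  revert i j k; decide +kernel

theorem det3_rotate (x y z : Fin 3 → ℝ) : det3 x y z = det3 y z x := by
  simp only [det3]; ring

theorem det3_pos (a b c x : Fin 3 → ℝ) (ha : ∀ i, 0 < a i) (hb : ∀ i, 0 < b i)
    (hc : ∀ i, 0 < c i) (hx : ∀ i, 0 < x i) (i j k : Fin 10) (h : positive i j k = true) :
    0 < det3 (weights a b c x i) (weights a b c x j) (weights a b c x k) := by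
  have key := det3_pos_of_increasing a b c x ha hb hc hx
  by_cases h1 : i ≤ j ∧ i ≤ k
  · exact key i j k h1.1 h1.2 h
  by_cases h2 : j ≤ k ∧ j ≤ i
  · rw [det3_rotate]
    exact key j k i h2.1 h2.2 (by rwa [← positive_rotate])
  · rw [← det3_rotate]
    exact key k i j (by lia) (by lia) (by rwa [positive_rotate])

/-- The points `pos 0, …, pos 8` run along the boundary of `T`, each side carrying two points
between its corners `pos 0`, `pos 3`, `pos 6`, and `pos 9` is in the interior. -/
structure IsFrame (T : Triangle) (pos : Fin 10 → Plane) : Prop where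
  area_ne : area T ≠ 0
  exists_weights : ∃ a b c x : Fin 3 → ℝ, (∀ i, 0 < a i) ∧ (∀ i, 0 < b i) ∧ (∀ i, 0 < c i) ∧
    (∀ i, 0 < x i) ∧ (∀ i, a i + b i + c i = 1) ∧ ∀ r i, bary T i (pos r) = weights a b c x r i

namespace IsFrame

variable {T : Triangle} {pos : Fin 10 → Plane}

/-- The factor `area T` makes the statement valid for clockwise `T` too, as needed after a
relabelling by a reflection. -/
theorem orient_pos (h : IsFrame T pos) {i j k : Fin 10} (hp : positive i j k = true) :
    0 < orient (pos i) (pos j) (pos k) * area T := by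
  obtain ⟨a, b, c, x, ha, hb, hc, hx, -, hw⟩ := h.exists_weights
  have hd := det3_pos a b c x ha hb hc hx i j k hp
  rw [orient_eq_det h.area_ne]
  simp only [hw]
  have : 0 < area T * area T := mul_self_pos.2 h.area_ne
  have := mul_pos this hd
  simp only [det3] at this
  linarith

theorem injective (h : IsFrame T pos) : Function.Injective pos := by
  intro i j hij
  by_contra hne
  obtain ⟨k, hk | hk⟩ := exists_positive_of_ne i j hne
  all_goals
    have := h.orient_pos hk
    rw [hij] at this
    simp [orient] at this

theorem pos_corner (h : IsFrame T pos) (e : Fin 3) : pos (![0, 3, 6] e) = T e := by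
  obtain ⟨a, b, c, x, ha, hb, hc, hx, -, hw⟩ := h.exists_weights
  refine eq_of_bary_eq h.area_ne fun i => ?_
  rw [hw]
  rcases eq_or_ne e i with rfl | hi
  · rw [bary_self h.area_ne]; fin_cases e <;> rfl
  · rw [bary_ne T hi]; fin_cases e <;> fin_cases i <;> first | rfl | exact absurd rfl hi

theorem bary_nonneg (h : IsFrame T pos) (r : Fin 10) (i : Fin 3) : 0 ≤ bary T i (pos r) := by
  obtain ⟨a, b, c, x, ha, hb, hc, hx, -, hw⟩ := h.exists_weights
  rw [hw]
  fin_cases r <;> fin_cases i <;> first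
    | exact le_rfl | exact zero_le_one | exact (ha _).le | exact (hc _).le | exact (hx _).le
    | exact (add_pos (hb _) (hc _)).le | exact (add_pos (ha _) (hb _)).le

theorem mem_hull (h : IsFrame T pos) (r : Fin 10) : pos r ∈ hull T :=
  (mem_hull_iff h.area_ne).2 (h.bary_nonneg r)

theorem mem_edge (h : IsFrame T pos) {e : Fin 3} {r : Fin 10} (hr : onSide e r = true) :
    pos r ∈ edge T e := by
  rw [mem_edge_iff h.area_ne]
  refine ⟨h.mem_hull r, ?_⟩
  obtain ⟨a, b, c, x, ha, hb, hc, hx, -, hw⟩ := h.exists_weights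
  rw [hw]
  fin_cases e <;> fin_cases r <;> first | rfl | (exfalso; revert hr; decide)

theorem bary_lt (h : IsFrame T pos) {e : Fin 3} {i j : Fin 10} (hi : onSide e i = true)
    (hj : onSide e j = true) (hij : sideIdx e i < sideIdx e j) :
    bary T (e + 1) (pos i) < bary T (e + 1) (pos j) := by
  obtain ⟨a, b, c, x, ha, hb, hc, hx, hs, hw⟩ := h.exists_weights
  rw [hw, hw]
  have := ha e; have := hb e; have := hc e; have := hs e
  fin_cases e
  all_goals
    fin_cases i <;> first | (exfalso; revert hi; decide) | skip
  all_goals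
    fin_cases j <;> first | (exfalso; revert hj hij; decide) | skip
  all_goals
    simp [weights] at *
    try linarith

end IsFrame

/-- On edge `e` the coordinate at the corner `e + 1` is an affine parameter, so betweenness is an
inequality of coordinates. -/
theorem mem_segment_of_bary_le {T : Triangle} (hT : area T ≠ 0) {e : Fin 3} {p q x : Plane}
    (hp : p ∈ edge T e) (hq : q ∈ edge T e) (hx : x ∈ edge T e)
    (h1 : bary T (e + 1) p ≤ bary T (e + 1) x) (h2 : bary T (e + 1) x ≤ bary T (e + 1) q) :
    x ∈ segment ℝ p q := by
  have hp0 := ((mem_edge_iff hT).1 hp).2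
  have hq0 := ((mem_edge_iff hT).1 hq).2
  have hx0 := ((mem_edge_iff hT).1 hx).2
  have sp := bary_succ_sum hT e p
  have sq := bary_succ_sum hT e q
  have sx := bary_succ_sum hT e x
  rcases (h1.trans h2).eq_or_lt with h | h
  · have : x = p := by
      refine eq_of_bary_eq hT ((forall_fin_three_iff e).2 ⟨?_, ?_, ?_⟩) <;> linarith
    rw [this]; exact left_mem_segment ℝ _ _
  · have hd : 0 < bary T (e + 1) q - bary T (e + 1) p := by linarith
    refine ⟨(bary T (e + 1) q - bary T (e + 1) x) / (bary T (e + 1) q - bary T (e + 1) p),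
      (bary T (e + 1) x - bary T (e + 1) p) / (bary T (e + 1) q - bary T (e + 1) p),
      div_nonneg (by linarith) hd.le, div_nonneg (by linarith) hd.le, ?_, ?_⟩
    · field_simp; ring
    · refine eq_of_bary_eq hT ((forall_fin_three_iff e).2 ?_)
      have e1 : bary T e p = 1 - bary T (e + 1) p := by linarith
      have e2 : bary T e q = 1 - bary T (e + 1) q := by linarith
      have e3 : bary T e x = 1 - bary T (e + 1) x := by linarith
      have hs : (bary T (e + 1) q - bary T (e + 1) x) / (bary T (e + 1) q - bary T (e + 1) p) +
        (bary T (e + 1) x - bary T (e + 1) p) / (bary T (e + 1) q - bary T (e + 1) p) = 1 := by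
        field_simp; ring
      simp only [bary_comb _ _ _ _ _ _ hs, e1, e2, e3, hp0, hq0, hx0]
      refine ⟨?_, ?_, ?_⟩ <;> field_simp <;> ring

theorem IsFrame.mem_segment {T : Triangle} {pos : Fin 10 → Plane} (h : IsFrame T pos)
    {e : Fin 3} {i r j : Fin 10} (hi : onSide e i = true) (hj : onSide e j = true)
    (hr : between e i r j = true) : pos r ∈ segment ℝ (pos i) (pos j) := by
  simp only [between, Bool.and_eq_true, Bool.or_eq_true, Nat.blt_eq] at hr
  obtain ⟨hr, ⟨h1, h2⟩ | ⟨h1, h2⟩⟩ := hr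
  · exact mem_segment_of_bary_le h.area_ne (h.mem_edge hi) (h.mem_edge hj) (h.mem_edge hr)
      (h.bary_lt hi hr h1).le (h.bary_lt hr hj h2).le
  · rw [segment_symm]
    exact mem_segment_of_bary_le h.area_ne (h.mem_edge hj) (h.mem_edge hi) (h.mem_edge hr)
      (h.bary_lt hj hr h1).le (h.bary_lt hr hi h2).le

/-! ### Faces and separation -/

/-- The points of a convex hull on which a supporting affine functional vanishes are spanned by
the generators on which it vanishes. -/
theorem mem_convexHull_zero {V : Set Plane} {f : Plane → ℝ}
    (hf : ∀ x y : Plane, ∀ s t : ℝ, s + t = 1 → f (s • x + t • y) = s * f x + t * f y)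
    (h0 : ∀ v ∈ V, 0 ≤ f v) {z : Plane} (hz : z ∈ convexHull ℝ V) (hfz : f z ≤ 0) :
    z ∈ convexHull ℝ {v ∈ V | f v = 0} := by
  set W := convexHull ℝ {v ∈ V | f v = 0}
  have hW : ∀ w ∈ W, f w = 0 := by
    intro w hw
    have hc : Convex ℝ {x | f x = 0} := by
      intro x hx y hy s t _ _ hst
      simp only [mem_ofPred_eq] at *
      rw [hf _ _ _ _ hst, hx, hy]; ring
    exact convexHull_min (fun v hv => hv.2) hc hw
  -- A proper combination involving a point with `0 < f` again has `0 < f`, and `W` itself is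
  -- convex.
  have hc : Convex ℝ {x | 0 < f x ∨ x ∈ W} := by
    intro x hx y hy s t hs ht hst
    simp only [mem_ofPred_eq] at *
    rcases hs.eq_or_lt with rfl | hs'
    · obtain rfl : t = 1 := by linarith
      simpa using hy
    rcases ht.eq_or_lt with rfl | ht'
    · obtain rfl : s = 1 := by linarith
      simpa using hx
    rw [hf _ _ _ _ hst]
    rcases hx with hx | hx <;> rcases hy with hy | hy
    · left; positivity
    · left; rw [hW y hy]; simp; positivity
    · left; rw [hW x hx]; simp; positivity
    · right; exact convex_convexHull ℝ _ hx hy hs ht hst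
  have : z ∈ {x | 0 < f x ∨ x ∈ W} := by
    refine convexHull_min (fun v hv => ?_) hc hz
    rcases (h0 v hv).eq_or_lt with h | h
    · exact .inr (subset_convexHull ℝ _ ⟨hv, h.symm⟩)
    · exact .inl h
  rcases this with h | h
  · exact absurd hfz (not_le.2 h)
  · exact h

/-- If neither set contains the other, they are different singletons and their hulls are disjoint.
-/
theorem convexHull_inter_of_subset_pair {V W : Set Plane} {x y z : Plane} (hV : V ⊆ {x, y})
    (hW : W ⊆ {x, y}) (hzV : z ∈ convexHull ℝ V) (hzW : z ∈ convexHull ℝ W) :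
    z ∈ convexHull ℝ (V ∩ W) := by
  by_cases h1 : V ⊆ W
  · rwa [inter_eq_left.2 h1]
  by_cases h2 : W ⊆ V
  · rwa [inter_eq_right.2 h2]
  obtain ⟨v, hv, hvW⟩ := not_subset.1 h1
  obtain ⟨w, hw, hwV⟩ := not_subset.1 h2
  have hV1 : V ⊆ {v} := by
    intro u hu
    rcases hV hu with rfl | rfl <;> rcases hV hv with rfl | rfl <;> rcases hW hw with rfl | rfl <;>
      simp_all
  have hW1 : W ⊆ {w} := by
    intro u hu
    rcases hW hu with rfl | rfl <;> rcases hV hv with rfl | rfl <;> rcases hW hw with rfl | rfl <;>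
      simp_all
  have a := convexHull_mono hV1 hzV
  have b := convexHull_mono hW1 hzW
  rw [convexHull_singleton, mem_singleton_iff] at a b
  rw [← a, b] at hvW
  exact absurd hw hvW

/-- A common point must lie on the separating line, hence in the face of each hull spanned by
generators on that line. These are among `x` and `y`. The factor `σ` absorbs the orientation of the
frame. -/
theorem mem_convexHull_inter_of_separated {V W : Set Plane} {x y z : Plane} {σ : ℝ}
    (hV : ∀ v ∈ V, v = x ∨ v = y ∨ 0 < orient x y v * σ)
    (hW : ∀ v ∈ W, v = x ∨ v = y ∨ 0 < orient y x v * σ)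
    (hzV : z ∈ convexHull ℝ V) (hzW : z ∈ convexHull ℝ W) : z ∈ convexHull ℝ (V ∩ W) := by
  have hx : orient x y x = 0 := by simp only [orient]; ring
  have hy : orient x y y = 0 := by simp only [orient]; ring
  have hf : ∀ p q : Plane, ∀ s t : ℝ, s + t = 1 →
      orient x y (s • p + t • q) * σ = s * (orient x y p * σ) + t * (orient x y q * σ) := by
    intro p q s t h
    rw [orient_comb _ _ _ _ _ _ h]; ring
  have hg : ∀ p q : Plane, ∀ s t : ℝ, s + t = 1 →
      -(orient x y (s • p + t • q) * σ) =
        s * -(orient x y p * σ) + t * -(orient x y q * σ) := by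
    intro p q s t h
    rw [hf _ _ _ _ h]; ring
  have hV0 : ∀ v ∈ V, 0 ≤ orient x y v * σ := by
    intro v hv
    rcases hV v hv with rfl | rfl | h
    · rw [hx, zero_mul]
    · rw [hy, zero_mul]
    · exact h.le
  have hW0 : ∀ v ∈ W, 0 ≤ -(orient x y v * σ) := by
    intro v hv
    rcases hW v hv with rfl | rfl | h
    · rw [hx, zero_mul, neg_zero]
    · rw [hy, zero_mul, neg_zero]
    · rw [orient_swap_left] at h; linarith
  have mono : ∀ {A : Set Plane} {f : Plane → ℝ}, (∀ v ∈ A, 0 ≤ f v) → z ∈ convexHull ℝ A →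
      (∀ p q : Plane, ∀ s t : ℝ, s + t = 1 → f (s • p + t • q) = s * f p + t * f q) →
      0 ≤ f z := by
    intro A f hA hz hf
    refine convexHull_min (t := {v | 0 ≤ f v}) hA ?_ hz
    intro p hp q hq s t hs ht hst
    simp only [mem_ofPred_eq] at *
    rw [hf _ _ _ _ hst]; positivity
  have h1 := mono hV0 hzV hf
  have h2 := mono hW0 hzW hg
  have a := mem_convexHull_zero hf hV0 hzV (by linarith)
  have b := mem_convexHull_zero hg hW0 hzW (by linarith)
  refine convexHull_mono ?_ (convexHull_inter_of_subset_pair (x := x) (y := y) ?_ ?_ a b)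
  · exact fun v hv => ⟨hv.1.1, hv.2.1⟩
  · rintro v ⟨hv, h0⟩
    rcases hV v hv with h | h | h
    · exact .inl h
    · exact .inr h
    · exact absurd h0 h.ne'
  · rintro v ⟨hv, h0⟩
    rcases hW v hv with h | h | h
    · exact .inl h
    · exact .inr h
    · rw [orient_swap_left] at h; exfalso; linarith

/-- Two triangles with different corners meet exactly in the face of their common corners. -/
def Conforms (R R' : Triangle) : Prop :=
  range R ≠ range R' ∧ hull R ∩ hull R' = convexHull ℝ (range R ∩ range R')

theorem Conforms.symm {R R' : Triangle} (h : Conforms R R') : Conforms R' R :=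
  ⟨h.1.symm, by rw [inter_comm, h.2, inter_comm]⟩

theorem conforms_of_subset {R R' : Triangle} (hne : range R ≠ range R')
    (h : hull R ∩ hull R' ⊆ convexHull ℝ (range R ∩ range R')) : Conforms R R' :=
  ⟨hne, h.antisymm (subset_inter (convexHull_mono inter_subset_left)
    (convexHull_mono inter_subset_right))⟩

theorem conforms_of_separated {R R' : Triangle} {x y : Plane} {σ : ℝ} (hR : area R ≠ 0)
    (hV : ∀ v ∈ range R, v = x ∨ v = y ∨ 0 < orient x y v * σ)
    (hW : ∀ v ∈ range R', v = x ∨ v = y ∨ 0 < orient y x v * σ) : Conforms R R' := by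
  refine conforms_of_subset (fun he => hR ?_) fun z hz =>
    mem_convexHull_inter_of_separated hV hW hz.1 hz.2
  -- Equal corner sets would lie on both sides of the line, leaving only `x` and `y` as corners and
  -- making `R` degenerate.
  have h : ∀ i, R i = x ∨ R i = y := by
    intro i
    have a := hV (R i) (mem_range_self i)
    have b := hW (R i) (he ▸ mem_range_self i)
    rcases a with a | a | a
    · exact .inl a
    · exact .inr a
    rcases b with b | b | b
    · exact .inl b
    · exact .inr b
    rw [orient_swap_left] at b
    exfalso; linarith
  rcases h 0 with h0 | h0 <;> rcases h 1 with h1 | h1 <;> rcases h 2 with h2 | h2 <;>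
    simp only [area, orient, h0, h1, h2] <;> ring

/-! ### Coverings of a triangle -/

theorem segment_subset_union {b c d : Plane} (hd : d ∈ segment ℝ b c) :
    segment ℝ b c ⊆ segment ℝ b d ∪ segment ℝ d c := by
  rw [segment_eq_image_lineMap] at hd ⊢
  obtain ⟨t, ht, rfl⟩ := hd
  rintro _ ⟨s, hs, rfl⟩
  rcases le_total s t with h | h
  · left
    have := image_segment ℝ (AffineMap.lineMap b c : ℝ →ᵃ[ℝ] Plane) 0 t
    rw [AffineMap.lineMap_apply_zero] at this
    rw [← this, segment_eq_Icc ht.1]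
    exact mem_image_of_mem _ ⟨hs.1, h⟩
  · right
    have := image_segment ℝ (AffineMap.lineMap b c : ℝ →ᵃ[ℝ] Plane) t 1
    rw [AffineMap.lineMap_apply_one] at this
    rw [← this, segment_eq_Icc ht.2]
    exact mem_image_of_mem _ ⟨h, hs.2⟩

theorem mem_convexHull_triple {a b c x : Plane} :
    x ∈ convexHull ℝ {a, b, c} ↔ ∃ y ∈ segment ℝ b c, x ∈ segment ℝ a y := by
  rw [convexHull_insert ⟨b, by simp⟩, convexHull_pair, mem_convexJoin]
  simp

theorem convexHull_split {a b c d x : Plane} (hd : d ∈ segment ℝ b c)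
    (hx : x ∈ convexHull ℝ {a, b, c}) :
    x ∈ convexHull ℝ {a, b, d} ∨ x ∈ convexHull ℝ {a, d, c} := by
  simp only [mem_convexHull_triple] at *
  obtain ⟨y, hy, hxy⟩ := hx
  rcases segment_subset_union hd hy with h | h
  · exact .inl ⟨y, h, hxy⟩
  · exact .inr ⟨y, h, hxy⟩

theorem convexHull_subset_of_mem {V W : Set Plane} (h : ∀ v ∈ V, v ∈ convexHull ℝ W) :
    convexHull ℝ V ⊆ convexHull ℝ W :=
  convexHull_min h (convex_convexHull ℝ W)

/-- The line from `a` through `p` reaches `b c` at `q`. Cutting along `a q` and then cutting both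
halves at `p` gives pieces contained in the three claimed triangles. -/
theorem convexHull_inner_split {a b c p x : Plane} (hp : p ∈ convexHull ℝ {a, b, c})
    (hx : x ∈ convexHull ℝ {a, b, c}) :
    x ∈ convexHull ℝ {p, a, b} ∨ x ∈ convexHull ℝ {p, b, c} ∨ x ∈ convexHull ℝ {p, c, a} := by
  obtain ⟨q, hq, hpq⟩ := mem_convexHull_triple.1 hp
  have key : ∀ {u v w : Plane}, q ∈ segment ℝ v w → p ∈ segment ℝ u q →
      x ∈ convexHull ℝ {u, v, q} → x ∈ convexHull ℝ {p, u, v} ∨ x ∈ convexHull ℝ {p, v, w} := by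
    intro u v w hq hp hx
    have hx' : x ∈ convexHull ℝ {v, u, q} := by
      have : ({v, u, q} : Set Plane) = {u, v, q} := by ext; simp; tauto
      rwa [this]
    rcases convexHull_split hp hx' with h | h
    · left
      rwa [show ({p, u, v} : Set Plane) = {v, u, p} by ext; simp; tauto]
    · right
      refine convexHull_subset_of_mem ?_ h
      rintro z (rfl | rfl | rfl)
      · exact subset_convexHull ℝ _ (by simp)
      · exact subset_convexHull ℝ _ (by simp)
      · exact segment_subset_convexHull (by simp) (by simp) hq
  rcases convexHull_split hq hx with h | h
  · rcases key hq hpq h with h | h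
    exacts [.inl h, .inr (.inl h)]
  · have h' : x ∈ convexHull ℝ {a, c, q} := by
      rwa [show ({a, c, q} : Set Plane) = {a, q, c} by ext; simp; tauto]
    rcases key (by rwa [segment_symm]) hpq h' with h | h
    · rw [show ({p, a, c} : Set Plane) = {p, c, a} by ext; simp; tauto] at h
      exact .inr (.inr h)
    · rw [show ({p, c, b} : Set Plane) = {p, b, c} by ext; simp; tauto] at h
      exact .inr (.inl h)

/-- The segments `u v` and `b w` meet at a point `o`. Cutting along `b w`, then at `u` and `v`,
leaves the triangles `u b w` and `v b w` besides two of the claimed ones; cut at `o`, these fall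
into `u b v` and `u v w`. -/
theorem convexHull_medial_split {a b c u v w x : Plane} (hu : u ∈ segment ℝ a b)
    (hv : v ∈ segment ℝ b c) (hw : w ∈ segment ℝ c a) (hx : x ∈ convexHull ℝ {a, b, c}) :
    x ∈ convexHull ℝ {a, u, w} ∨ x ∈ convexHull ℝ {u, b, v} ∨ x ∈ convexHull ℝ {v, c, w} ∨
      x ∈ convexHull ℝ {u, v, w} := by
  have hcross := not_disjoint_segment_convexHull_triple (𝕜 := ℝ) (p := b) (q := b) (u := u)
    (v := v) (x := a) (y := c) (z := w) (by rwa [segment_symm]) hu (by rwa [segment_symm])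
  obtain ⟨o, hou, how⟩ := not_disjoint_iff.1 hcross
  have how : o ∈ segment ℝ b w := by
    rwa [show ({b, b, w} : Set Plane) = {b, w} by ext; simp, convexHull_pair] at how
  have hso : ∀ {W : Set Plane}, u ∈ W → v ∈ W → o ∈ convexHull ℝ W := fun h1 h2 =>
    segment_subset_convexHull h1 h2 hou
  have hs : ∀ {W : Set Plane} {z : Plane}, z ∈ W → z ∈ convexHull ℝ W := fun h =>
    subset_convexHull ℝ _ h
  have quad : ∀ {z : Plane}, z = u ∨ z = v → x ∈ convexHull ℝ {z, b, w} →
      x ∈ convexHull ℝ {u, b, v} ∨ x ∈ convexHull ℝ {u, v, w} := by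
    intro z hz hx
    rcases convexHull_split how hx with h | h
    · left
      refine convexHull_subset_of_mem ?_ h
      rintro y (rfl | rfl | rfl)
      · exact hs (by rcases hz with rfl | rfl <;> simp)
      · exact hs (by simp)
      · exact hso (by simp) (by simp)
    · right
      refine convexHull_subset_of_mem ?_ h
      rintro y (rfl | rfl | rfl)
      · exact hs (by rcases hz with rfl | rfl <;> simp)
      · exact hso (by simp) (by simp)
      · exact hs (by simp)
  rw [show ({a, b, c} : Set Plane) = {b, c, a} by ext; simp; tauto] at hx
  rcases convexHull_split hw hx with h | h
  · rw [show ({b, c, w} : Set Plane) = {w, b, c} by ext; simp; tauto] at h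
    rcases convexHull_split hv h with h | h
    · rw [show ({w, b, v} : Set Plane) = {v, b, w} by ext; simp; tauto] at h
      rcases quad (.inr rfl) h with h | h <;> tauto
    · rw [show ({w, v, c} : Set Plane) = {v, c, w} by ext; simp; tauto] at h
      tauto
  · rw [show ({b, w, a} : Set Plane) = {w, a, b} by ext; simp; tauto] at h
    rcases convexHull_split hu h with h | h
    · rw [show ({w, a, u} : Set Plane) = {a, u, w} by ext; simp; tauto] at h
      tauto
    · rw [show ({w, u, b} : Set Plane) = {u, b, w} by ext; simp; tauto] at h
      rcases quad (.inl rfl) h with h | h <;> tauto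

/-! ### Patches described by ranks -/

theorem allCheck_apply {f : (Fin 3 → ℕ) → Option (Fin 10) → Bool} (h : allCheck f = true)
    {n : Fin 3 → ℕ} (hn : ∀ i, n i ≤ 2) {p : Option (Fin 10)} (hp : consistent n p = true) :
    f n p = true := by
  have hn' : n ∈ counts := by
    have : n = ![n 0, n 1, n 2] := by
      ext i; fin_cases i <;> rfl
    rw [this]
    have h0 := hn 0; have h1 := hn 1; have h2 := hn 2
    simp only [counts, List.mem_flatMap, List.mem_map]
    have key : ∀ k, k ≤ 2 → k ∈ [0, 1, 2] := by
      intro k hk; interval_cases k <;> simp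
    exact ⟨_, key _ h0, _, key _ h1, _, key _ h2, rfl⟩
  have hp' : p ∈ vertexRanks := by
    clear hp; revert p; decide
  rw [allCheck, List.all_eq_true] at h
  have := List.all_eq_true.1 (h n hn') p hp'
  simpa [hp] using this

theorem mem_ranks (r : Fin 10) : r ∈ ranks := by revert r; decide

theorem range_ccwTriangle (a b c : Plane) : range (ccwTriangle a b c) = {a, b, c} := by
  have h : ∀ x y z : Plane, range ![x, y, z] = {x, y, z} := by
    intro x y z
    ext w
    simp [eq_comm]
    tauto
  rw [ccwTriangle]
  split_ifs
  · exact h a b c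
  · rw [h]; ext; simp; tauto

theorem area_ccwTriangle_pos {a b c : Plane} (h : orient a b c ≠ 0) :
    0 < area (ccwTriangle a b c) := by
  rw [ccwTriangle]
  split_ifs with h'
  · simpa [area] using h'
  · have : orient a c b = -orient a b c := orient_swap a b c
    have h2 := lt_of_le_of_ne (not_lt.1 h') h
    simp only [area, Matrix.cons_val]
    linarith

noncomputable def rankTriangle (pos : Fin 10 → Plane) (t : RankTriple) : Triangle :=
  ccwTriangle (pos t.1) (pos t.2.1) (pos t.2.2)

theorem range_rankTriangle (pos : Fin 10 → Plane) (t : RankTriple) :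
    range (rankTriangle pos t) = {pos t.1, pos t.2.1, pos t.2.2} := range_ccwTriangle _ _ _

theorem hull_rankTriangle (pos : Fin 10 → Plane) (t : RankTriple) :
    hull (rankTriangle pos t) = convexHull ℝ {pos t.1, pos t.2.1, pos t.2.2} := by
  rw [hull, range_rankTriangle]

theorem RankTriple.mem_range (pos : Fin 10 → Plane) {t : RankTriple} {r : Fin 10}
    (h : t.has r = true) : pos r ∈ range (rankTriangle pos t) := by
  rw [range_rankTriangle]
  simp only [RankTriple.has, Bool.or_eq_true, beq_iff_eq] at h
  rcases h with (h | h) | h <;> simp [h]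

/-- A conforming triangulation `N` of the triangle `T` with the set of vertices `V`. -/
structure IsPatch (T : Triangle) (V : Set Plane) (N : Set Triangle) : Prop where
  area_pos : ∀ R ∈ N, 0 < area R
  corners : ∀ R ∈ N, range R ⊆ V
  conforms : ∀ R ∈ N, ∀ R' ∈ N, R ≠ R' → Conforms R R'
  cover : ⋃ R ∈ N, hull R = hull T
  vertices : ∀ v ∈ V, ∃ R ∈ N, v ∈ range R

namespace IsFrame

variable {T : Triangle} {pos : Fin 10 → Plane}

theorem area_rankTriangle_pos (h : IsFrame T pos) {t : RankTriple}
    (ht : positive t.1 t.2.1 t.2.2 = true) : 0 < area (rankTriangle pos t) :=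
  area_ccwTriangle_pos fun h0 => by simpa [h0] using h.orient_pos ht

theorem conforms_of_separated (h : IsFrame T pos) {s t : RankTriple}
    (hs : positive s.1 s.2.1 s.2.2 = true) (hst : separated s t = true) :
    Conforms (rankTriangle pos s) (rankTriangle pos t) := by
  simp only [separated, List.any_eq_true] at hst
  obtain ⟨x, -, y, -, hxy⟩ := hst
  simp only [separates, Bool.and_eq_true, List.all_cons, List.all_nil, Bool.or_eq_true,
    beq_iff_eq, and_true] at hxy
  obtain ⟨⟨s1, s2, s3⟩, t1, t2, t3⟩ := hxy
  have key : ∀ {v : Fin 10}, (v = x ∨ v = y) ∨ positive x y v = true →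
      pos v = pos x ∨ pos v = pos y ∨ 0 < orient (pos x) (pos y) (pos v) * area T := by
    intro v hv
    rcases hv with (hv | hv) | hv
    exacts [.inl (congrArg pos hv), .inr (.inl (congrArg pos hv)), .inr (.inr (h.orient_pos hv))]
  have key' : ∀ {v : Fin 10}, (v = x ∨ v = y) ∨ positive y x v = true →
      pos v = pos x ∨ pos v = pos y ∨ 0 < orient (pos y) (pos x) (pos v) * area T := by
    intro v hv
    rcases hv with (hv | hv) | hv
    exacts [.inl (congrArg pos hv), .inr (.inl (congrArg pos hv)), .inr (.inr (h.orient_pos hv))]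
  refine SBMT.conforms_of_separated (x := pos x) (y := pos y) (σ := area T)
    (h.area_rankTriangle_pos hs).ne' ?_ ?_
  · rw [range_rankTriangle]
    intro v hv
    rcases hv with hv | hv | hv <;> rw [hv]
    exacts [key s1, key s2, key s3]
  · rw [range_rankTriangle]
    intro v hv
    rcases hv with hv | hv | hv <;> rw [hv]
    exacts [key' t1, key' t2, key' t3]

theorem conforms_of_pairwiseSep (h : IsFrame T pos) {F : List RankTriple}
    (hF : ∀ t ∈ F, positive t.1 t.2.1 t.2.2 = true) (hs : pairwiseSep F = true) :
    ∀ s ∈ F, ∀ t ∈ F, rankTriangle pos s ≠ rankTriangle pos t →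
      Conforms (rankTriangle pos s) (rankTriangle pos t) := by
  induction F with
  | nil => simp
  | cons a l ih =>
    simp only [pairwiseSep, Bool.and_eq_true, List.all_eq_true] at hs
    have ha : ∀ t ∈ l, Conforms (rankTriangle pos a) (rankTriangle pos t) := fun t ht =>
      h.conforms_of_separated (hF a (by simp)) (hs.1 t ht)
    intro s hs' t ht hne
    rcases List.mem_cons.1 hs' with h1 | hs' <;> rcases List.mem_cons.1 ht with h2 | ht
    · rw [h1, h2] at hne
      exact absurd rfl hne
    · rw [h1]
      exact ha t ht
    · rw [h2]
      exact (ha s hs').symm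
    · exact ih (fun t ht => hF t (by simp [ht])) hs.2 s hs' t ht hne

theorem mem_segment_of_anyBetween (h : IsFrame T pos) {i r j : Fin 10}
    (hr : anyBetween i r j = true) : pos r ∈ segment ℝ (pos i) (pos j) := by
  simp only [anyBetween, anySide, Bool.or_eq_true, Bool.and_eq_true] at hr
  rcases hr with (⟨⟨hi, hj⟩, hr⟩ | ⟨⟨hi, hj⟩, hr⟩) | ⟨⟨hi, hj⟩, hr⟩ <;> exact h.mem_segment hi hj hr

theorem hull_subset_of_same {s t : RankTriple} (hst : s.same t = true) :
    hull (rankTriangle pos s) ⊆ hull (rankTriangle pos t) := by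
  simp only [RankTriple.same, Bool.and_eq_true] at hst
  refine convexHull_subset_of_mem fun v hv => subset_convexHull ℝ _ ?_
  rw [range_rankTriangle] at hv
  rcases hv with rfl | rfl | rfl
  · exact t.mem_range pos hst.1.1
  · exact t.mem_range pos hst.1.2
  · exact t.mem_range pos hst.2

theorem exists_mem_of_coverable (h : IsFrame T pos) {F : List RankTriple} {x : Plane} (m : ℕ) :
    ∀ t : RankTriple, coverable F m t = true → x ∈ hull (rankTriangle pos t) →
      ∃ f ∈ F, x ∈ hull (rankTriangle pos f) := by
  have base : ∀ t : RankTriple, (F.any fun f => t.same f) = true →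
      x ∈ hull (rankTriangle pos t) → ∃ f ∈ F, x ∈ hull (rankTriangle pos f) := by
    intro t ht hx
    obtain ⟨f, hf, hft⟩ := List.any_eq_true.1 ht
    exact ⟨f, hf, hull_subset_of_same hft hx⟩
  induction m with
  | zero => exact base
  | succ m ih =>
    intro t ht hx
    simp only [coverable, Bool.or_eq_true] at ht
    rcases ht with ht | ht
    · exact base t ht hx
    obtain ⟨d, -, hd⟩ := List.any_eq_true.1 ht
    obtain ⟨a, b, c⟩ := t
    simp only [Bool.or_eq_true, Bool.and_eq_true] at hd
    rw [hull_rankTriangle] at hx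
    simp only at hx
    have key : ∀ {a b c : Fin 10}, anyBetween b d c = true → coverable F m (a, b, d) = true →
        coverable F m (a, d, c) = true → x ∈ convexHull ℝ {pos a, pos b, pos c} →
        ∃ f ∈ F, x ∈ hull (rankTriangle pos f) := by
      intro a b c hd h1 h2 hx
      rcases convexHull_split (h.mem_segment_of_anyBetween hd) hx with hx | hx
      · exact ih (a, b, d) h1 (by rwa [hull_rankTriangle])
      · exact ih (a, d, c) h2 (by rwa [hull_rankTriangle])
    rcases hd with (⟨⟨hd, h1⟩, h2⟩ | ⟨⟨hd, h1⟩, h2⟩) | ⟨⟨hd, h1⟩, h2⟩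
    · exact key hd h1 h2 hx
    · refine key hd h1 h2 ?_
      rwa [show ({pos b, pos c, pos a} : Set Plane) = {pos a, pos b, pos c} by ext; simp; tauto]
    · refine key hd h1 h2 ?_
      rwa [show ({pos c, pos a, pos b} : Set Plane) = {pos a, pos b, pos c} by ext; simp; tauto]

theorem hull_eq_convexHull (h : IsFrame T pos) :
    hull T = convexHull ℝ {pos 0, pos 3, pos 6} := by
  have h0 := h.pos_corner 0; have h1 := h.pos_corner 1; have h2 := h.pos_corner 2
  simp only [Matrix.cons_val] at h0 h1 h2
  rw [hull, h0, h1, h2]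
  congr 1
  ext w
  simp [Fin.exists_fin_succ, eq_comm]

theorem exists_mem_of_coverCheck (h : IsFrame T pos) {n : Fin 3 → ℕ} {p : Option (Fin 10)}
    {F : List RankTriple} (hF : rankTemplate n p = some F) (hc : coverCheck n p = true)
    {x : Plane} (hx : x ∈ hull T) : ∃ f ∈ F, x ∈ hull (rankTriangle pos f) := by
  simp only [coverCheck, hF, Bool.or_eq_true, medialSplit, innerSplit, List.all_cons,
    List.all_nil, Bool.and_true, Bool.and_eq_true] at hc
  have hp : pos 9 ∈ hull T := h.mem_hull 9
  rw [h.hull_eq_convexHull] at hx hp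
  rcases hc with (hc | ⟨h1, h2, h3, h4⟩) | ⟨h1, h2, h3⟩
  · exact h.exists_mem_of_coverable _ _ hc (by rwa [hull_rankTriangle])
  · rcases convexHull_medial_split (h.mem_segment_of_anyBetween (i := 0) (r := 1) (j := 3) rfl)
      (h.mem_segment_of_anyBetween (i := 3) (r := 4) (j := 6) rfl)
      (h.mem_segment_of_anyBetween (i := 6) (r := 7) (j := 0) rfl) hx with hx | hx | hx | hx
    · exact h.exists_mem_of_coverable _ _ h1 (by rwa [hull_rankTriangle])
    · exact h.exists_mem_of_coverable _ _ h2 (by rwa [hull_rankTriangle])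
    · exact h.exists_mem_of_coverable _ _ h3 (by rwa [hull_rankTriangle])
    · exact h.exists_mem_of_coverable _ _ h4 (by rwa [hull_rankTriangle])
  · rcases convexHull_inner_split hp hx with hx | hx | hx
    · exact h.exists_mem_of_coverable _ _ h1 (by rwa [hull_rankTriangle])
    · exact h.exists_mem_of_coverable _ _ h2 (by rwa [hull_rankTriangle])
    · exact h.exists_mem_of_coverable _ _ h3 (by rwa [hull_rankTriangle])

theorem isPatch (h : IsFrame T pos) {n : Fin 3 → ℕ} (hn : ∀ i, n i ≤ 2) {p : Option (Fin 10)}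
    (hp : consistent n p = true) {F : List RankTriple} (hF : rankTemplate n p = some F) :
    IsPatch T (pos '' {r | used n p r = true}) (rankTriangle pos '' {t | t ∈ F}) := by
  have hc := allCheck_apply coverCheck_all hn hp
  have ht := allCheck_apply templateCheck_all hn hp
  simp only [templateCheck, hF, Bool.and_eq_true, List.all_eq_true] at ht
  obtain ⟨⟨ht, hs⟩, hv⟩ := ht
  refine ⟨?_, ?_, ?_, ?_, ?_⟩
  · rintro _ ⟨t, htF, rfl⟩
    exact h.area_rankTriangle_pos (ht t htF).1.1.1
  · rintro _ ⟨t, htF, rfl⟩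
    rw [range_rankTriangle]
    obtain ⟨⟨⟨-, h1⟩, h2⟩, h3⟩ := ht t htF
    rintro v (rfl | rfl | rfl)
    exacts [⟨_, h1, rfl⟩, ⟨_, h2, rfl⟩, ⟨_, h3, rfl⟩]
  · rintro _ ⟨s, hsF, rfl⟩ _ ⟨t, htF, rfl⟩ hne
    exact h.conforms_of_pairwiseSep (fun t htF => (ht t htF).1.1.1) hs s hsF t htF hne
  · apply Subset.antisymm
    · refine iUnion₂_subset ?_
      rintro _ ⟨t, -, rfl⟩
      rw [hull_rankTriangle]
      refine convexHull_min ?_ (convex_hull T)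
      rintro v (rfl | rfl | rfl) <;> exact h.mem_hull _
    · intro x hx
      obtain ⟨f, hf, hxf⟩ := h.exists_mem_of_coverCheck hF hc hx
      exact mem_biUnion (mem_image_of_mem _ hf) hxf
  · rintro _ ⟨r, hr, rfl⟩
    have := hv r (mem_ranks r)
    rw [hr] at this
    simp only [Bool.not_true, Bool.false_or, List.any_eq_true] at this
    obtain ⟨t, htF, htr⟩ := this
    exact ⟨_, ⟨t, htF, rfl⟩, t.mem_range pos htr⟩

end IsFrame

/-! ### The configuration of segments at one triangle -/

/-- The conditions that `S` satisfies at a labelled triangle `T` of either orientation. -/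
structure LocalAdmissible (S : Set Seg) (T : Triangle) : Prop where
  area_ne : area T ≠ 0
  nondegenerate : ∀ s ∈ S, s.1 ≠ s.2
  planar : ∀ s ∈ S, ∀ s' ∈ S, s ≠ s' → ∀ x ∈ carrier s ∩ carrier s', IsEnd s x ∧ IsEnd s' x
  two_segments : {s ∈ S | Meets s T}.encard ≤ 2
  free_end : ∀ s ∈ S, ∀ x ∈ hull T, IsEnd s x → (∀ s' ∈ S, IsEnd s' x → s' = s) →
    (∀ s' ∈ S, Meets s' T → s' = s) ∧ (∀ y ∈ hull T, IsEnd s y → y = x)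

/-- The vertices of the patch of `T`. -/
def nodes (S : Set Seg) (T : Triangle) : Set Plane :=
  range T ∪ (⋃ i, marks S T i) ∪ (boundaryVertices S ∩ hull T)

theorem IsEnd.mem_carrier {s : Seg} {x : Plane} (h : IsEnd s x) : x ∈ carrier s := by
  rcases h with rfl | rfl
  exacts [left_mem_segment ℝ _ _, right_mem_segment ℝ _ _]

theorem carrier_eq_segment {s : Seg} {x y : Plane} (hx : IsEnd s x) (hy : IsEnd s y)
    (hxy : x ≠ y) : carrier s = segment ℝ x y := by
  rcases hx with rfl | rfl <;> rcases hy with rfl | rfl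
  · exact absurd rfl hxy
  · rfl
  · exact segment_symm ℝ _ _
  · exact absurd rfl hxy

theorem eq_of_encard_le_two {α : Type*} {X : Set α} (h : X.encard ≤ 2) {a b c : α} (ha : a ∈ X)
    (hb : b ∈ X) (hc : c ∈ X) : a = b ∨ a = c ∨ b = c := by
  by_contra! hne
  have h3 : ({a, b, c} : Set α).encard = 3 := encard_eq_three.2 ⟨a, b, c, hne.1, hne.2.1, hne.2.2, rfl⟩
  have : ({a, b, c} : Set α).encard ≤ X.encard :=
    encard_le_encard (by rintro x (rfl | rfl | rfl) <;> assumption)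
  rw [h3] at this
  exact absurd (this.trans h) (by decide)

theorem encard_le_two_of_forall {α : Type*} {X : Set α}
    (h : ∀ a ∈ X, ∀ b ∈ X, ∀ c ∈ X, a = b ∨ a = c ∨ b = c) : X.encard ≤ 2 := by
  by_contra! hlt
  obtain ⟨Y, hYX, hY⟩ := exists_subset_encard_eq (Order.add_one_le_of_lt hlt)
  obtain ⟨a, b, c, hab, hac, hbc, rfl⟩ := encard_eq_three.1 (hY.trans (by norm_num))
  rcases h a (hYX (by simp)) b (hYX (by simp)) c (hYX (by simp)) with h | h | h
  exacts [hab h, hac h, hbc h]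

/-- An end point of a segment is not inside a nondegenerate part of the segment. -/
theorem eq_of_end_mem_openSegment {s : Seg} (hs : s.1 ≠ s.2) {p q v : Plane}
    (hp : p ∈ carrier s) (hq : q ∈ carrier s) (hv : IsEnd s v) (hpq : v ∈ openSegment ℝ p q) :
    v = p := by
  have key : ∀ {a b : Plane}, a ≠ b → p ∈ segment ℝ a b → q ∈ segment ℝ a b →
      a ∈ openSegment ℝ p q → a = p := by
    intro a b hab hp hq h
    rw [segment_eq_image_lineMap] at hp hq
    obtain ⟨t, ht, rfl⟩ := hp
    obtain ⟨u, hu, rfl⟩ := hq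
    rw [← image_openSegment] at h
    obtain ⟨w, ⟨α, β, hα, hβ, hαβ, rfl⟩, hwa⟩ := h
    have h0 : (AffineMap.lineMap a b : ℝ →ᵃ[ℝ] Plane) (0 : ℝ) = a := by simp
    have hw := AffineMap.lineMap_injective ℝ hab (hwa.trans h0.symm)
    simp only [smul_eq_mul] at hw
    have h1 : 0 ≤ α * t := mul_nonneg hα.le ht.1
    have h2 : 0 ≤ β * u := mul_nonneg hβ.le hu.1
    have h3 : α * t = 0 := by linarith
    have : t = 0 := by simpa [hα.ne'] using h3
    rw [this, h0]
  rcases hv with rfl | rfl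
  · exact key hs hp hq hpq
  · exact key hs.symm (by rwa [segment_symm]) (by rwa [segment_symm]) hpq

namespace LocalAdmissible

variable {S : Set Seg} {T : Triangle}

/-- A boundary vertex in `T` is an end point of every segment that meets `T`. -/
theorem isEnd (h : LocalAdmissible S T) {x : Plane} (hx : x ∈ boundaryVertices S)
    (hxT : x ∈ hull T) {s : Seg} (hs : s ∈ S) (hm : Meets s T) : IsEnd s x := by
  by_contra hne
  obtain ⟨s₀, hs₀, he₀⟩ := hx
  by_cases hf : ∀ s' ∈ S, IsEnd s' x → s' = s₀
  · rw [(h.free_end s₀ hs₀ x hxT he₀ hf).1 s hs hm] at hne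
    exact hne he₀
  -- Now two segments end at `x`, and as both meet `T`, no third one does.
  · push Not at hf
    obtain ⟨s₁, hs₁, he₁, hne₁⟩ := hf
    rcases eq_of_encard_le_two h.two_segments (a := s₀) (b := s₁) (c := s)
      ⟨hs₀, x, he₀.mem_carrier, hxT⟩ ⟨hs₁, x, he₁.mem_carrier, hxT⟩ ⟨hs, hm⟩ with h | h | h
    · exact hne₁ h.symm
    · exact hne (h ▸ he₀)
    · exact hne (h ▸ he₁)

/-- If `x` is a free end, the hypothesis on free ends excludes `y`. Otherwise two different segments
end at `x`, hence both also at `y`, and they would overlap along the whole of `x y`. -/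
theorem boundaryVertex_unique (h : LocalAdmissible S T) {x y : Plane}
    (hx : x ∈ boundaryVertices S) (hxT : x ∈ hull T) (hy : y ∈ boundaryVertices S)
    (hyT : y ∈ hull T) : x = y := by
  by_contra hxy
  obtain ⟨s, hs, he⟩ := id hx
  have hey := h.isEnd hy hyT hs ⟨x, he.mem_carrier, hxT⟩
  by_cases hf : ∀ s' ∈ S, IsEnd s' x → s' = s
  · exact hxy ((h.free_end s hs x hxT he hf).2 y hyT hey).symm
  · push Not at hf
    obtain ⟨s', hs', he', hne⟩ := hf
    have hey' := h.isEnd hy hyT hs' ⟨x, he'.mem_carrier, hxT⟩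
    have hm : midpoint ℝ x y ∈ segment ℝ x y := midpoint_mem_segment x y
    have := (h.planar s hs s' hs' hne.symm (midpoint ℝ x y)
      ⟨by rwa [carrier_eq_segment he hey hxy], by rwa [carrier_eq_segment he' hey' hxy]⟩).1
    have hne1 : midpoint ℝ x y ≠ x := by simpa using hxy
    have hne2 : midpoint ℝ x y ≠ y := by simpa using hxy
    have hends : ∀ z, IsEnd s z → z = x ∨ z = y := by
      rintro z (rfl | rfl) <;> rcases he with rfl | rfl <;> rcases hey with rfl | rfl <;> tauto
    rcases hends _ this with h | h
    exacts [hne1 h, hne2 h]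

theorem exists_segment_of_mark {i : Fin 3} {x : Plane}
    (hx : x ∈ marks S T i) (hb : x ∉ boundaryVertices S) :
    ∃ s ∈ S, carrier s ∩ edge T i = {x} := hx.2.resolve_left hb

theorem mark_mem_hull {i : Fin 3} {x : Plane} (hx : x ∈ marks S T i) : x ∈ hull T :=
  edge_subset_hull T i (openEdge_subset_edge T i hx.1)

/-- An edge with a boundary vertex on it has no other inserted point. -/
theorem mark_eq_boundaryVertex (h : LocalAdmissible S T) {i : Fin 3} {x y : Plane}
    (hx : x ∈ marks S T i) (hxb : x ∈ boundaryVertices S) (hy : y ∈ marks S T i) : y = x := by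
  by_cases hb : y ∈ boundaryVertices S
  · exact h.boundaryVertex_unique hb (mark_mem_hull hy) hxb (mark_mem_hull hx)
  · obtain ⟨s, hs, he⟩ := exists_segment_of_mark hy hb
    have hys : y ∈ carrier s ∩ edge T i := by rw [he]; rfl
    have := h.isEnd hxb (mark_mem_hull hx) hs ⟨y, hys.1, mark_mem_hull hy⟩
    have hxs : x ∈ carrier s ∩ edge T i := ⟨this.mem_carrier, openEdge_subset_edge T i hx.1⟩
    rw [he] at hxs
    exact hxs.symm

/-- Away from boundary vertices, different marks on an edge are single crossings by different
segments, and only two segments are available. -/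
theorem encard_marks_le (h : LocalAdmissible S T) (i : Fin 3) : (marks S T i).encard ≤ 2 := by
  refine encard_le_two_of_forall fun a ha b hb c hc => ?_
  by_cases hab : a ∈ boundaryVertices S
  · exact .inl (h.mark_eq_boundaryVertex ha hab hb).symm
  by_cases hbb : b ∈ boundaryVertices S
  · exact .inl (h.mark_eq_boundaryVertex hb hbb ha)
  by_cases hcb : c ∈ boundaryVertices S
  · exact .inr (.inl (h.mark_eq_boundaryVertex hc hcb ha))
  have key : ∀ x ∈ marks S T i, x ∉ boundaryVertices S →
      ∃ s ∈ {s ∈ S | Meets s T}, carrier s ∩ edge T i = {x} := by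
    intro x hx hxb
    obtain ⟨s, hs, he⟩ := exists_segment_of_mark hx hxb
    have hxs : x ∈ carrier s ∩ edge T i := by rw [he]; rfl
    exact ⟨s, ⟨hs, x, hxs.1, mark_mem_hull hx⟩, he⟩
  obtain ⟨s, hs, hsa⟩ := key a ha hab
  obtain ⟨s', hs', hsb⟩ := key b hb hbb
  obtain ⟨s'', hs'', hsc⟩ := key c hc hcb
  rcases eq_of_encard_le_two h.two_segments hs hs' hs'' with rfl | rfl | rfl
  · exact .inl (singleton_injective (hsa.symm.trans hsb))
  · exact .inr (.inl (singleton_injective (hsa.symm.trans hsc)))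
  · exact .inr (.inr (singleton_injective (hsb.symm.trans hsc)))

theorem finite_marks (h : LocalAdmissible S T) (i : Fin 3) : (marks S T i).Finite :=
  finite_of_encard_le_coe (k := 2) (h.encard_marks_le i)

theorem ncard_marks_le (h : LocalAdmissible S T) (i : Fin 3) : (marks S T i).ncard ≤ 2 := by
  have := h.encard_marks_le i
  rw [← (h.finite_marks i).cast_ncard_eq] at this
  exact_mod_cast this

end LocalAdmissible

/-! ### The part of a segment inside a triangle -/

/-- A segment that can be continued without leaving the triangle is continued inside it. -/
theorem exists_later_mem_hull {T : Triangle} (hT : area T ≠ 0) {a b : Plane} {t : ℝ}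
    (ht : t < 1) (h : ∀ i, 0 < bary T i (AffineMap.lineMap a b t) ∨
      bary T i (AffineMap.lineMap a b t) = 0 ∧ bary T i a ≤ bary T i b) :
    ∃ u, t < u ∧ u ≤ 1 ∧ AffineMap.lineMap a b u ∈ hull T := by
  -- Coordinates are affine along the segment: a positive one stays positive for a while, a
  -- vanishing nondecreasing one stays nonnegative.
  have hev : ∀ i, ∀ᶠ u in nhdsWithin t (Ioi t), 0 ≤ bary T i (AffineMap.lineMap a b u) := by
    intro i
    rcases h i with h | ⟨h, hle⟩
    · have hc : Continuous fun u : ℝ => bary T i (AffineMap.lineMap a b u) := by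
        simp only [bary_lineMap]; fun_prop
      have := (hc.tendsto t).eventually (lt_mem_nhds h)
      exact (this.filter_mono nhdsWithin_le_nhds).mono fun u hu => hu.le
    · filter_upwards [self_mem_nhdsWithin] with u hu
      rw [bary_lineMap] at h ⊢
      have : 0 ≤ (u - t) * (bary T i b - bary T i a) :=
        mul_nonneg (by linarith [mem_Ioi.1 hu]) (by linarith)
      linarith
  have h1 : ∀ᶠ u in nhdsWithin t (Ioi t), u ≤ 1 :=
    ((eventually_lt_nhds ht).filter_mono nhdsWithin_le_nhds).mono fun u hu => hu.le
  obtain ⟨u, hu, hu1, hut⟩ :=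
    ((Filter.eventually_all.2 hev).and (h1.and self_mem_nhdsWithin)).exists
  exact ⟨u, hut, hu1, (mem_hull_iff hT).2 hu⟩

/-- A segment leaves a triangle at its end or at the single point it has on some edge. -/
theorem exit_point {T : Triangle} (hT : area T ≠ 0) {a b : Plane} {t : ℝ} (ht0 : 0 ≤ t)
    (ht1 : t ≤ 1) (hp : AffineMap.lineMap a b t ∈ hull T)
    (hlast : ∀ u, t < u → u ≤ 1 → AffineMap.lineMap a b u ∉ hull T) :
    AffineMap.lineMap a b t = b ∨
      ∃ i, segment ℝ a b ∩ edge T i = {AffineMap.lineMap a b t} := by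
  rcases ht1.eq_or_lt with rfl | ht
  · left; simp
  right
  by_contra hno
  obtain ⟨u, hu, hu1, hmem⟩ := exists_later_mem_hull hT ht (a := a) (b := b) (by
    intro i
    by_contra! hi
    have h0 : bary T i (AffineMap.lineMap a b t) = 0 :=
      le_antisymm hi.1 ((mem_hull_iff hT).1 hp i)
    have hlt := hi.2 h0
    -- Coordinate `i` vanishes at `t` and strictly decreases, so it vanishes nowhere else on the
    -- line. Edge `i + 1` is the one opposite to the corner `i`.
    refine hno ⟨i + 1, ?_⟩
    ext y
    rw [mem_singleton_iff, mem_inter_iff, mem_edge_iff hT, add_one_add_two]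
    constructor
    · rintro ⟨hy, -, hy0⟩
      rw [segment_eq_image_lineMap] at hy
      obtain ⟨w, -, rfl⟩ := hy
      rw [bary_lineMap] at hy0 h0
      have : (w - t) * (bary T i b - bary T i a) = 0 := by linarith
      rcases mul_eq_zero.1 this with h | h
      · rw [sub_eq_zero.1 h]
      · linarith
    · rintro rfl
      refine ⟨?_, hp, h0⟩
      rw [segment_eq_image_lineMap]
      exact ⟨t, ⟨ht0, ht1⟩, rfl⟩)
  exact hlast u hu hu1 hmem

/-- The parameters of points in the triangle form a nonempty compact convex subset of the unit
interval. -/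
theorem exists_trace_parameters {T : Triangle} {a b : Plane}
    (hne : (segment ℝ a b ∩ hull T).Nonempty) :
    ∃ t u : ℝ, 0 ≤ t ∧ t ≤ u ∧ u ≤ 1 ∧
      ∀ w, w ∈ Icc (0 : ℝ) 1 → (AffineMap.lineMap a b w ∈ hull T ↔ w ∈ Icc t u) := by
  set K : Set ℝ := Icc 0 1 ∩ (AffineMap.lineMap a b : ℝ →ᵃ[ℝ] Plane) ⁻¹' hull T
  have hcl : IsClosed (hull T) := (finite_range T).isClosed_convexHull ℝ
  have hcont : Continuous (AffineMap.lineMap a b : ℝ →ᵃ[ℝ] Plane) :=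
    AffineMap.lineMap_continuous
  have hK : IsCompact K := isCompact_Icc.inter_right (hcl.preimage hcont)
  have hKne : K.Nonempty := by
    obtain ⟨x, hx, hxT⟩ := hne
    rw [segment_eq_image_lineMap] at hx
    obtain ⟨w, hw, rfl⟩ := hx
    exact ⟨w, hw, hxT⟩
  have hKc : Convex ℝ K := (convex_Icc 0 1).inter ((convex_hull T).affine_preimage _)
  obtain ⟨t, ht, htl⟩ := hK.exists_isLeast hKne
  obtain ⟨u, hu, hul⟩ := hK.exists_isGreatest hKne
  refine ⟨t, u, ht.1.1, htl hu, hu.1.2, fun w hw => ⟨fun h => ⟨htl ⟨hw, h⟩, hul ⟨hw, h⟩⟩, ?_⟩⟩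
  intro h
  exact (hKc.ordConnected.out ht hu h).2

namespace LocalAdmissible

variable {S : Set Seg} {T : Triangle}

/-- A segment meets `T` in a segment between two nodes, and contains no further node. -/
theorem exists_trace (h : LocalAdmissible S T) {s : Seg} (hs : s ∈ S) (hm : Meets s T) :
    ∃ p ∈ nodes S T, ∃ q ∈ nodes S T, carrier s ∩ hull T = segment ℝ p q ∧
      (∀ v ∈ nodes S T, v ∈ carrier s → v = p ∨ v = q) ∧
      (p = q → ∀ i, p ∈ openEdge T i → p ∈ boundaryVertices S) := by
  have hT := h.area_ne
  obtain ⟨t, u, ht0, htu, hu1, hK⟩ := exists_trace_parameters hm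
  have ht1 : t ≤ 1 := htu.trans hu1
  have hu0 : 0 ≤ u := ht0.trans htu
  have hpT := (hK t ⟨ht0, ht1⟩).2 ⟨le_rfl, htu⟩
  have hqT := (hK u ⟨hu0, hu1⟩).2 ⟨htu, le_rfl⟩
  have hflip : ∀ w : ℝ, (AffineMap.lineMap s.1 s.2 w : Plane) =
      AffineMap.lineMap s.2 s.1 (1 - w) := fun w => (AffineMap.lineMap_apply_one_sub _ _ _).symm
  have hnode : ∀ {x : Plane}, x ∈ hull T →
      (IsEnd s x ∨ ∃ i, carrier s ∩ edge T i = {x}) → x ∈ nodes S T := by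
    rintro x hx (he | ⟨i, hi⟩)
    · exact .inr ⟨⟨s, hs, he⟩, hx⟩
    · left
      have hxi : x ∈ carrier s ∩ edge T i := by rw [hi]; rfl
      rcases edge_cases hxi.2 with rfl | rfl | ho
      · exact .inl (mem_range_self _)
      · exact .inl (mem_range_self _)
      · exact .inr (mem_iUnion.2 ⟨i, ho, .inr ⟨s, hs, hi⟩⟩)
  have hq : IsEnd s (AffineMap.lineMap s.1 s.2 u) ∨
      ∃ i, carrier s ∩ edge T i = {AffineMap.lineMap s.1 s.2 u} := by
    refine (exit_point hT hu0 hu1 hqT fun w hw hw1 hwT => ?_).imp .inr id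
    exact absurd ((hK w ⟨by linarith, hw1⟩).1 hwT).2 (not_le.2 hw)
  -- The point of entry is the point of exit of the reversed segment.
  have hp : IsEnd s (AffineMap.lineMap s.1 s.2 t) ∨
      ∃ i, carrier s ∩ edge T i = {AffineMap.lineMap s.1 s.2 t} := by
    rw [carrier, segment_symm, hflip t]
    rw [hflip] at hpT
    refine (exit_point hT (by linarith) (by linarith) hpT fun w hw hw1 hwT => ?_).imp .inl id
    have := (hK (1 - w) ⟨by linarith, by linarith⟩).1 (by rw [hflip]; simpa using hwT)
    linarith [this.1]
  have htrace : carrier s ∩ hull T =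
      segment ℝ (AffineMap.lineMap s.1 s.2 t) (AffineMap.lineMap s.1 s.2 u) := by
    rw [← image_segment, segment_eq_Icc htu]
    ext x
    rw [carrier, segment_eq_image_lineMap]
    constructor
    · rintro ⟨⟨w, hw, rfl⟩, hx⟩
      exact ⟨w, (hK w hw).1 hx, rfl⟩
    · rintro ⟨w, hw, rfl⟩
      have hw' : w ∈ Icc (0 : ℝ) 1 := ⟨ht0.trans hw.1, hw.2.trans hu1⟩
      exact ⟨⟨w, hw', rfl⟩, (hK w hw').2 hw⟩
  have hpc : AffineMap.lineMap s.1 s.2 t ∈ carrier s :=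
    (htrace.symm.subset (left_mem_segment ℝ _ _)).1
  have hqc : AffineMap.lineMap s.1 s.2 u ∈ carrier s :=
    (htrace.symm.subset (right_mem_segment ℝ _ _)).1
  refine ⟨_, hnode hpT hp, _, hnode hqT hq, htrace, ?_, ?_⟩
  · intro v hv hvs
    have hvT : v ∈ hull T := by
      rcases hv with (⟨i, rfl⟩ | hv) | hv
      · exact corner_mem_hull T i
      · obtain ⟨i, hi⟩ := mem_iUnion.1 hv
        exact mark_mem_hull hi
      · exact hv.2
    have hvseg := htrace.subset ⟨hvs, hvT⟩
    rw [← insert_endpoints_openSegment] at hvseg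
    rcases hvseg with hv' | hv' | hvo
    · exact .inl hv'
    · exact .inr hv'
    -- No node is strictly inside the trace. Corners are extreme, and a boundary vertex is an end of
    -- `s`. Any other mark would put the whole trace on its edge, contradicting a single crossing by
    -- `s`, or would be a common point with another segment and so a boundary vertex.
    left
    have hbv : v ∈ boundaryVertices S → v = AffineMap.lineMap s.1 s.2 t := fun hb =>
      eq_of_end_mem_openSegment (h.nondegenerate s hs) hpc hqc (h.isEnd hb hvT hs ⟨v, hvs, hvT⟩)
        hvo
    rcases hv with (⟨i, rfl⟩ | hv) | hv
    · exact (corner_extreme hT hpT hqT hvo).1.symm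
    · obtain ⟨i, hi⟩ := mem_iUnion.1 hv
      by_cases hb : v ∈ boundaryVertices S
      · exact hbv hb
      obtain ⟨s', hs', he'⟩ := exists_segment_of_mark hi hb
      have hpe := (edge_extreme hT hpT hqT hvo (openEdge_subset_edge T i hi.1)).1
      by_cases hss : s' = s
      · subst hss
        exact (he'.subset ⟨hpc, hpe⟩).symm
      · have hv' : v ∈ carrier s' ∩ edge T i := by rw [he']; rfl
        exact absurd ⟨s, hs, (h.planar s' hs' s hs hss v ⟨hv'.1, hvs⟩).2⟩ hb
    · exact hbv hv.1
  · intro hpq i hi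
    by_contra hb
    have hend : ¬ IsEnd s (AffineMap.lineMap s.1 s.2 t) := fun he => hb ⟨s, hs, he⟩
    have htu' : t = u := by
      exact AffineMap.lineMap_injective ℝ (h.nondegenerate s hs) hpq
    subst htu'
    have ht0' : 0 < t := by
      rcases ht0.eq_or_lt with rfl | h'
      · exact absurd (.inl (by simp)) hend
      · exact h'
    have ht1' : t < 1 := by
      rcases ht1.eq_or_lt with rfl | h'
      · exact absurd (.inr (by simp)) hend
      · exact h'
    have hbary := (mem_openEdge_iff hT).1 hi
    -- From an inner point of `s` on an open edge, `s` continues inside `T` in the direction in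
    -- which the coordinate vanishing on that edge does not decrease. So the trace is not one point.
    rcases le_total (bary T (i + 2) s.1) (bary T (i + 2) s.2) with hle | hle
    · obtain ⟨w, hw, hw1, hwT⟩ := exists_later_mem_hull hT ht1' (a := s.1) (b := s.2)
        ((forall_fin_three_iff i).2 ⟨.inl hbary.2.1, .inl hbary.2.2, .inr ⟨hbary.1, hle⟩⟩)
      linarith [((hK w ⟨by linarith, hw1⟩).1 hwT).2]
    · rw [hflip] at hbary
      obtain ⟨w, hw, hw1, hwT⟩ := exists_later_mem_hull hT (t := 1 - t) (by linarith)
        (a := s.2) (b := s.1)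
        ((forall_fin_three_iff i).2 ⟨.inl hbary.2.1, .inl hbary.2.2, .inr ⟨hbary.1, hle⟩⟩)
      have := (hK (1 - w) ⟨by linarith, by linarith⟩).1 (by rw [hflip]; simpa using hwT)
      linarith [this.1]

end LocalAdmissible

/-! ### Ordered marks on the sides and the frame they define -/

/-- The side of the triangle that carries the marks `3 e + 1`, `3 e + 2`. -/
def rankSide (r : Fin 10) : Fin 3 := Fin.ofNat 3 (r.val / 3)

theorem openEdge_eq_image (T : Triangle) (e : Fin 3) :
    openEdge T e = (fun u : ℝ => AffineMap.lineMap (T e) (T (e + 1)) u) '' Ioo 0 1 :=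
  openSegment_eq_image_lineMap ℝ _ _

theorem lineMap_mem_openSegment_iff {a b : Plane} (hab : a ≠ b) {u w : ℝ} (hu : 0 < u) :
    AffineMap.lineMap a b w ∈ openSegment ℝ a (AffineMap.lineMap a b u) ↔ 0 < w ∧ w < u := by
  have := image_openSegment ℝ (AffineMap.lineMap a b : ℝ →ᵃ[ℝ] Plane) 0 u
  rw [AffineMap.lineMap_apply_zero, openSegment_eq_Ioo hu] at this
  rw [← this]
  exact (AffineMap.lineMap_injective ℝ hab).mem_set_image

theorem nthMark_eq {S : Set Seg} {T : Triangle} {e : Fin 3} {j : ℕ} {x : Plane}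
    (hx : x ∈ marks S T e ∧ (marks S T e ∩ openSegment ℝ (T e) x).ncard = j)
    (huniq : ∀ y, y ∈ marks S T e → (marks S T e ∩ openSegment ℝ (T e) y).ncard = j → y = x) :
    nthMark S T e j = x := by
  have := Classical.epsilon_spec (p := fun x =>
    x ∈ marks S T e ∧ (marks S T e ∩ openSegment ℝ (T e) x).ncard = j) ⟨x, hx⟩
  exact huniq _ this.1 this.2

/-- Two points on an edge that list the inserted points in order. -/
theorem exists_side_points {S : Set Seg} {T : Triangle} (h : LocalAdmissible S T) (e : Fin 3) :
    ∃ u v : ℝ, 0 < u ∧ u < v ∧ v < 1 ∧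
      (∀ x, x ∈ marks S T e ↔
        x = AffineMap.lineMap (T e) (T (e + 1)) u ∧ 1 ≤ (marks S T e).ncard ∨
        x = AffineMap.lineMap (T e) (T (e + 1)) v ∧ 2 ≤ (marks S T e).ncard) ∧
      (1 ≤ (marks S T e).ncard → nthMark S T e 0 = AffineMap.lineMap (T e) (T (e + 1)) u) ∧
      (2 ≤ (marks S T e).ncard → nthMark S T e 1 = AffineMap.lineMap (T e) (T (e + 1)) v) := by
  have hab : T e ≠ T (e + 1) := (corner_injective h.area_ne).ne (ne_add_one e)
  have hfin := h.finite_marks e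
  have hle := h.ncard_marks_le e
  have hpar : ∀ x ∈ marks S T e, ∃ u : ℝ, 0 < u ∧ u < 1 ∧
      x = AffineMap.lineMap (T e) (T (e + 1)) u := by
    intro x hx
    have := hx.1
    rw [openEdge_eq_image] at this
    obtain ⟨u, hu, rfl⟩ := this
    exact ⟨u, hu.1, hu.2, rfl⟩
  have hcases : (marks S T e).ncard = 0 ∨ (marks S T e).ncard = 1 ∨ (marks S T e).ncard = 2 := by
    omega
  rcases hcases with h0 | h1 | h2
  -- A frame needs two points on each side; unused ranks are placed arbitrarily.
  · refine ⟨1 / 3, 1 / 2, by norm_num, by norm_num, by norm_num, fun x => ?_, by omega, by omega⟩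
    rw [(ncard_eq_zero hfin).1 h0]
    simp
  · obtain ⟨x, hx⟩ := ncard_eq_one.1 h1
    obtain ⟨u, hu0, hu1, rfl⟩ := hpar x (by simp [hx])
    -- The second point is a dummy between the mark and the end of the side.
    refine ⟨u, (u + 1) / 2, hu0, by linarith, by linarith, fun y => ?_, fun _ => ?_, by omega⟩
    · rw [h1, hx]; simp
    · refine nthMark_eq ⟨by simp [hx], ?_⟩ fun y hy _ => by simpa [hx] using hy
      rw [hx, ncard_eq_zero (toFinite _), singleton_inter_eq_empty,
        lineMap_mem_openSegment_iff hab hu0]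
      simp
  · have key : ∃ u v : ℝ, 0 < u ∧ u < v ∧ v < 1 ∧ marks S T e =
        {AffineMap.lineMap (T e) (T (e + 1)) u, AffineMap.lineMap (T e) (T (e + 1)) v} := by
      obtain ⟨x, y, hxy, hX⟩ := ncard_eq_two.1 h2
      obtain ⟨u, hu0, hu1, rfl⟩ := hpar x (by simp [hX])
      obtain ⟨v, hv0, hv1, rfl⟩ := hpar y (by simp [hX])
      rcases lt_trichotomy u v with huv | rfl | huv
      · exact ⟨u, v, hu0, huv, hv1, hX⟩
      · exact absurd rfl hxy
      · exact ⟨v, u, hv0, huv, hu1, by rw [hX, pair_comm]⟩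
    obtain ⟨u, v, hu, huv, hv, hX⟩ := key
    have hv0 := hu.trans huv
    have hu_card : (marks S T e ∩
        openSegment ℝ (T e) (AffineMap.lineMap (T e) (T (e + 1)) u)).ncard = 0 := by
      rw [ncard_eq_zero (hfin.inter_of_left _), hX, eq_empty_iff_forall_notMem]
      rintro y ⟨rfl | rfl, hy⟩ <;> rw [lineMap_mem_openSegment_iff hab hu] at hy <;>
        linarith [hy.2]
    have hv_card : (marks S T e ∩
        openSegment ℝ (T e) (AffineMap.lineMap (T e) (T (e + 1)) v)).ncard = 1 := by
      rw [ncard_eq_one]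
      refine ⟨AffineMap.lineMap (T e) (T (e + 1)) u, ?_⟩
      ext y
      rw [hX, mem_singleton_iff]
      constructor
      · rintro ⟨rfl | rfl, hy⟩
        · rfl
        · rw [lineMap_mem_openSegment_iff hab hv0] at hy
          linarith [hy.2]
      · rintro rfl
        exact ⟨by simp, (lineMap_mem_openSegment_iff hab hv0).2 ⟨hu, huv⟩⟩
    refine ⟨u, v, hu, huv, hv, fun x => ?_, fun _ => ?_, fun _ => ?_⟩
    · rw [h2, hX]; simp
    · refine nthMark_eq ⟨by simp [hX], hu_card⟩ fun y hy hy' => ?_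
      rw [hX] at hy
      rcases hy with rfl | rfl
      · rfl
      · omega
    · refine nthMark_eq ⟨by simp [hX], hv_card⟩ fun y hy hy' => ?_
      rw [hX] at hy
      rcases hy with rfl | rfl
      · omega
      · rfl

noncomputable def framePoints (T : Triangle) (u v : Fin 3 → ℝ) (P : Plane) : Fin 10 → Plane :=
  ![T 0, AffineMap.lineMap (T 0) (T 1) (u 0), AffineMap.lineMap (T 0) (T 1) (v 0),
    T 1, AffineMap.lineMap (T 1) (T 2) (u 1), AffineMap.lineMap (T 1) (T 2) (v 1),
    T 2, AffineMap.lineMap (T 2) (T 0) (u 2), AffineMap.lineMap (T 2) (T 0) (v 2), P]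

theorem isFrame_framePoints {T : Triangle} (hT : area T ≠ 0) {u v : Fin 3 → ℝ} {P : Plane}
    (hu : ∀ e, 0 < u e) (huv : ∀ e, u e < v e) (hv : ∀ e, v e < 1) (hP : ∀ i, 0 < bary T i P) :
    IsFrame T (framePoints T u v P) := by
  refine ⟨hT, u, fun e => v e - u e, fun e => 1 - v e, fun i => bary T i P, hu,
    fun e => sub_pos.2 (huv e), fun e => sub_pos.2 (hv e), hP, fun e => by ring, ?_⟩
  have hc : ∀ e i, bary T i (T e) = if e = i then 1 else 0 := by
    intro e i
    split_ifs with h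
    · rw [h, bary_self hT]
    · exact bary_ne T h
  intro r i
  fin_cases r <;> fin_cases i <;>
    simp [framePoints, weights, bary_lineMap, hc]

/-! ### The key of a triangle in terms of ranks -/

namespace LocalAdmissible

variable {S : Set Seg} {T : Triangle}

/-- The definition of `location` involves a choice of index; uniqueness of the boundary vertex makes
the answer determined. -/
theorem location_corner (h : LocalAdmissible S T) {i : Fin 3} (hi : T i ∈ boundaryVertices S) :
    location S T = .corner i := by
  have hex : ∃ i, T i ∈ boundaryVertices S := ⟨i, hi⟩
  rw [location, dif_pos hex]
  congr 1
  exact corner_injective h.area_ne (h.boundaryVertex_unique hex.choose_spec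
    (corner_mem_hull T _) hi (corner_mem_hull T i))

theorem location_onEdge (h : LocalAdmissible S T) {i : Fin 3} {x : Plane} (hx : x ∈ openEdge T i)
    (hb : x ∈ boundaryVertices S) : location S T = .onEdge i := by
  have hsub : ∀ i, openEdge T i ⊆ hull T := fun i =>
    (openEdge_subset_edge T i).trans (edge_subset_hull T i)
  have hno : ¬ ∃ i, T i ∈ boundaryVertices S := by
    rintro ⟨j, hj⟩
    have := h.boundaryVertex_unique hj (corner_mem_hull T j) hb (hsub i hx)
    exact corner_notMem_openEdge h.area_ne j i (this ▸ hx)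
  have hex : ∃ i, (openEdge T i ∩ boundaryVertices S).Nonempty := ⟨i, x, hx, hb⟩
  rw [location, dif_neg hno, dif_pos hex]
  congr 1
  obtain ⟨y, hy, hyb⟩ := hex.choose_spec
  have := h.boundaryVertex_unique hyb (hsub _ hy) hb (hsub i hx)
  exact openEdge_disjoint h.area_ne (this ▸ hy) hx

theorem location_inside (h : LocalAdmissible S T) {x : Plane} (hx : ∀ i, 0 < bary T i x)
    (hb : x ∈ boundaryVertices S) : location S T = .inside := by
  have hxT : x ∈ hull T := (mem_hull_iff h.area_ne).2 fun i => (hx i).le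
  have hno : ¬ ∃ i, T i ∈ boundaryVertices S := by
    rintro ⟨j, hj⟩
    have := h.boundaryVertex_unique hj (corner_mem_hull T j) hb hxT
    have h0 := hx (j + 1)
    rw [← this, bary_ne T (ne_add_one j)] at h0
    exact h0.false
  have hno' : ¬ ∃ i, (openEdge T i ∩ boundaryVertices S).Nonempty := by
    rintro ⟨i, y, hy, hyb⟩
    have := h.boundaryVertex_unique hyb (edge_subset_hull T i (openEdge_subset_edge T i hy)) hb hxT
    have h0 := hx (i + 2)
    rw [← this, ((mem_openEdge_iff h.area_ne).1 hy).1] at h0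
    exact h0.false
  rw [location, dif_neg hno, dif_neg hno', if_pos ⟨x, mem_interior_hull h.area_ne hx, hb⟩]

end LocalAdmissible

theorem location_absent {S : Set Seg} {T : Triangle} (h : ∀ x ∈ hull T, x ∉ boundaryVertices S) :
    location S T = .absent := by
  rw [location, dif_neg, dif_neg, if_neg]
  · rintro ⟨x, hx, hb⟩
    exact h x (interior_subset hx) hb
  · rintro ⟨i, x, hx, hb⟩
    exact h x (edge_subset_hull T i (openEdge_subset_edge T i hx)) hb
  · rintro ⟨i, hi⟩
    exact h _ (corner_mem_hull T i) hi

noncomputable def markCount (S : Set Seg) (T : Triangle) (i : Fin 3) : ℕ := (marks S T i).ncard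

/-- The frame `pos` and the rank `p` of the boundary vertex describe the nodes in `T`. -/
structure Describes (S : Set Seg) (T : Triangle) (pos : Fin 10 → Plane) (p : Option (Fin 10)) :
    Prop where
  frame : IsFrame T pos
  isConsistent : consistent (markCount S T) p = true
  location_eq : location S T = locationOf p
  mem_marks_iff : ∀ e x, x ∈ marks S T e ↔ ∃ r : Fin 10, r.val ≠ 9 ∧ r.val % 3 ≠ 0 ∧
    rankSide r = e ∧ r.val % 3 ≤ markCount S T e ∧ x = pos r
  boundary_iff : ∀ x, (x ∈ boundaryVertices S ∧ x ∈ hull T) ↔ ∃ q, p = some q ∧ x = pos q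
  nthMark_zero : ∀ e, 1 ≤ markCount S T e → nthMark S T e 0 = pos (![1, 4, 7] e)
  nthMark_one : ∀ e, 2 ≤ markCount S T e → nthMark S T e 1 = pos (![2, 5, 8] e)

theorem exists_describes {S : Set Seg} {T : Triangle} (h : LocalAdmissible S T) :
    ∃ pos p, Describes S T pos p := by
  have hT := h.area_ne
  choose u v hu huv hv hmarks hn0 hn1 using exists_side_points h
  have core : ∀ (P : Plane) (p : Option (Fin 10)), (∀ i, 0 < bary T i P) →
      consistent (markCount S T) p = true → location S T = locationOf p →
      (∀ x, (x ∈ boundaryVertices S ∧ x ∈ hull T) ↔ ∃ q, p = some q ∧ x = framePoints T u v P q) →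
      ∃ pos p, Describes S T pos p := by
    intro P p hP hc hl hb
    refine ⟨framePoints T u v P, p, isFrame_framePoints hT hu huv hv hP, hc, hl, ?_, hb, ?_, ?_⟩
    · intro e x
      rw [hmarks e x]
      constructor
      · rintro (⟨rfl, hle⟩ | ⟨rfl, hle⟩)
        · refine ⟨![1, 4, 7] e, ?_, ?_, ?_, ?_, ?_⟩
          · fin_cases e <;> decide
          · fin_cases e <;> decide
          · fin_cases e <;> decide
          · refine le_trans (le_of_eq ?_) hle
            fin_cases e <;> rfl
          · fin_cases e <;> rfl
        · refine ⟨![2, 5, 8] e, ?_, ?_, ?_, ?_, ?_⟩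
          · fin_cases e <;> decide
          · fin_cases e <;> decide
          · fin_cases e <;> decide
          · refine le_trans (le_of_eq ?_) hle
            fin_cases e <;> rfl
          · fin_cases e <;> rfl
      · rintro ⟨r, h9, h3, rfl, hle, rfl⟩
        have : r = ![1, 4, 7] (rankSide r) ∧ r.val % 3 = 1 ∨
            r = ![2, 5, 8] (rankSide r) ∧ r.val % 3 = 2 := by
          clear hle; revert r; decide
        rcases this with ⟨hr, h1⟩ | ⟨hr, h2⟩
        · left
          refine ⟨?_, h1 ▸ hle⟩
          generalize rankSide r = e at hr
          rw [hr]; fin_cases e <;> rfl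
        · right
          refine ⟨?_, h2 ▸ hle⟩
          generalize rankSide r = e at hr
          rw [hr]; fin_cases e <;> rfl
    · intro e he
      rw [hn0 e he]; fin_cases e <;> rfl
    · intro e he
      rw [hn1 e he]; fin_cases e <;> rfl
  -- The centroid occupies rank 9 whenever no boundary vertex lies in the interior.
  have hcen : ∀ i, 0 < bary T i
      ((2 / 3 : ℝ) • ((1 / 2 : ℝ) • T 0 + (1 / 2 : ℝ) • T 1) + (1 / 3 : ℝ) • T 2) := by
    have hc : ∀ e i, bary T i (T e) = if e = i then 1 else 0 := by
      intro e i
      split_ifs with h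
      · rw [h, bary_self hT]
      · exact bary_ne T h
    intro i
    rw [bary_comb _ _ _ _ _ _ (by norm_num), bary_comb _ _ _ _ _ _ (by norm_num)]
    fin_cases i <;> simp [hc]
  by_cases hex : ∃ x ∈ boundaryVertices S, x ∈ hull T
  · obtain ⟨x, hb, hx⟩ := hex
    have hiff : ∀ (P : Plane) (q : Fin 10), x = framePoints T u v P q →
        ∀ y, (y ∈ boundaryVertices S ∧ y ∈ hull T) ↔
          ∃ r, some q = some r ∧ y = framePoints T u v P r := by
      intro P q hq y
      constructor
      · rintro ⟨hy, hyT⟩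
        exact ⟨q, rfl, (h.boundaryVertex_unique hy hyT hb hx).trans hq⟩
      · rintro ⟨r, hr, rfl⟩
        rw [← Option.some.inj hr, ← hq]
        exact ⟨hb, hx⟩
    rcases hull_cases hT hx with ⟨i, rfl⟩ | ⟨i, hi⟩ | hpos
    · refine core _ (some (![0, 3, 6] i)) hcen ?_ ?_ (hiff _ _ ?_)
      · fin_cases i <;> rfl
      · rw [h.location_corner hb]; fin_cases i <;> rfl
      · fin_cases i <;> rfl
    · have hm : x ∈ marks S T i := ⟨hi, .inl hb⟩
      rcases (hmarks i x).1 hm with ⟨hxu, hle⟩ | ⟨hxv, hle⟩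
      · refine core _ (some (![1, 4, 7] i)) hcen ?_ ?_ (hiff _ _ ?_)
        · fin_cases i <;> exact Nat.ble_eq_true_of_le hle
        · rw [h.location_onEdge hi hb]; fin_cases i <;> rfl
        · rw [hxu]; fin_cases i <;> rfl
      · refine core _ (some (![2, 5, 8] i)) hcen ?_ ?_ (hiff _ _ ?_)
        · fin_cases i <;> exact Nat.ble_eq_true_of_le hle
        · rw [h.location_onEdge hi hb]; fin_cases i <;> rfl
        · rw [hxv]; fin_cases i <;> rfl
    · exact core x (some 9) hpos rfl (h.location_inside hpos hb) (hiff _ _ rfl)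
  · push Not at hex
    refine core _ none hcen rfl (location_absent fun x hx hb => hex x hb hx) fun x => ?_
    simp only [reduceCtorEq, false_and, exists_false, iff_false]
    exact fun hx => hex x hx.1 hx.2

namespace Describes

variable {S : Set Seg} {T : Triangle} {pos : Fin 10 → Plane} {p : Option (Fin 10)}

theorem nodes_eq (hd : Describes S T pos p) :
    nodes S T = pos '' {r | used (markCount S T) p r = true} := by
  ext x
  constructor
  · rintro ((⟨i, rfl⟩ | hx) | hx)
    · refine ⟨![0, 3, 6] i, ?_, hd.frame.pos_corner i⟩
      fin_cases i <;> rfl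
    · obtain ⟨e, he⟩ := mem_iUnion.1 hx
      obtain ⟨r, h9, -, rfl, hle, rfl⟩ := (hd.mem_marks_iff e x).1 he
      refine ⟨r, ?_, rfl⟩
      rw [mem_ofPred_eq, used, if_neg (by simpa using h9)]
      exact Nat.ble_eq_true_of_le hle
    · obtain ⟨q, rfl, rfl⟩ := (hd.boundary_iff x).1 hx
      exact ⟨q, hd.isConsistent, rfl⟩
  · rintro ⟨r, hr, rfl⟩
    rw [mem_ofPred_eq, used] at hr
    split_ifs at hr with h9
    · have h9 : r = 9 := Fin.ext (by simpa using h9)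
      exact .inr ((hd.boundary_iff _).2 ⟨9, by simpa using hr, by rw [h9]⟩)
    · left
      by_cases h3 : r.val % 3 = 0
      · left
        have : r = ![0, 3, 6] (rankSide r) := by
          clear hr; revert r; decide
        rw [this, hd.frame.pos_corner]
        exact mem_range_self _
      · right
        exact mem_iUnion.2 ⟨rankSide r, (hd.mem_marks_iff _ _).2
          ⟨r, by simpa using h9, h3, rfl, Nat.le_of_ble_eq_true hr, rfl⟩⟩

theorem mem_marks_of_plain (hd : Describes S T pos p) {r : Fin 10}
    (hr : plain (markCount S T) p r = true) :
    pos r ∈ marks S T (rankSide r) ∧ pos r ∉ boundaryVertices S := by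
  simp only [plain, Bool.and_eq_true, bne_iff_ne, used] at hr
  obtain ⟨⟨⟨h9, h3⟩, hu⟩, hp⟩ := hr
  rw [if_neg (by simpa using h9)] at hu
  refine ⟨(hd.mem_marks_iff _ _).2 ⟨r, h9, h3, rfl, Nat.le_of_ble_eq_true hu, rfl⟩, fun hb => ?_⟩
  obtain ⟨q, hq, hrq⟩ := (hd.boundary_iff _).1 ⟨hb, hd.frame.mem_hull r⟩
  rw [hd.frame.injective hrq] at hp
  exact hp hq

theorem place_eq (hd : Describes S T pos p) {l : Label}
    (hl : labelUsed (markCount S T) p l = true) (hn : ∀ i, markCount S T i ≤ 2)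
    (hu : ∀ x y, x ∈ boundaryVertices S → x ∈ hull T → y ∈ boundaryVertices S → y ∈ hull T →
      x = y) : place S T l = pos (labelRank p l) := by
  have mark : ∀ e j, Nat.blt j (markCount S T e) = true →
      nthMark S T e j = pos (if j = 0 then ![1, 4, 7] e else ![2, 5, 8] e) := by
    intro e j hj
    rw [Nat.blt_eq] at hj
    have := hn e
    obtain rfl | rfl : j = 0 ∨ j = 1 := by omega
    · rw [hd.nthMark_zero e hj, if_pos rfl]
    · rw [hd.nthMark_one e hj, if_neg one_ne_zero]
  cases l with
  | A => exact (hd.frame.pos_corner 0).symm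
  | B => exact (hd.frame.pos_corner 1).symm
  | C => exact (hd.frame.pos_corner 2).symm
  | ab j => exact mark 0 j hl
  | bc j => exact mark 1 j hl
  | ca j => exact mark 2 j hl
  | P =>
    obtain ⟨q, rfl⟩ := Option.isSome_iff_exists.1 hl
    have hq := (hd.boundary_iff (pos q)).2 ⟨q, rfl, rfl⟩
    have := Classical.epsilon_spec (p := fun x => x ∈ hull T ∧ x ∈ boundaryVertices S)
      ⟨pos q, hq.2, hq.1⟩
    exact hu _ _ this.2 this.1 hq.1 hq.2

end Describes

/-! ### Chords of a triangle -/

/-- The crossing point divides each segment in the ratio of the areas cut off by the other. Both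
sums of areas are equal, being those of the two decompositions of the quadrilateral along its
diagonals. -/
theorem exists_mem_segment_inter {p q p' q' : Plane} {σ : ℝ} (h1 : 0 < orient p q p' * σ)
    (h2 : 0 < orient q p q' * σ) (h3 : 0 < orient p' q' q * σ) (h4 : 0 < orient q' p' p * σ) :
    ∃ o, o ∈ segment ℝ p q ∧ o ∈ segment ℝ p' q' := by
  set d := orient p q p' * σ + orient q p q' * σ with hd
  have hd0 : 0 < d := by positivity
  have hd' : orient p' q' q * σ + orient q' p' p * σ = d := by
    rw [hd]; simp only [orient]; ring
  refine ⟨(orient p q p' * σ / d) • q' + (orient q p q' * σ / d) • p',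
    ⟨orient p' q' q * σ / d, orient q' p' p * σ / d, by positivity, by positivity, ?_, ?_⟩,
    ⟨orient q p q' * σ / d, orient p q p' * σ / d, by positivity, by positivity, ?_, ?_⟩⟩
  · rw [← add_div, hd', div_self hd0.ne']
  · ext k
    simp only [PiLp.add_apply, PiLp.smul_apply, smul_eq_mul]
    field_simp
    simp only [orient]
    fin_cases k <;> simp <;> left <;> ring
  · rw [← add_div, add_comm, ← hd, div_self hd0.ne']
  · exact add_comm _ _

theorem eq_rankSide_of_onSide {e : Fin 3} {r : Fin 10} (h3 : r.val % 3 ≠ 0)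
    (h : onSide e r = true) : e = rankSide r := by
  revert e r; decide

theorem ne_of_between {e : Fin 3} {i r j : Fin 10} (h : between e i r j = true) :
    r ≠ i ∧ r ≠ j := by
  simp only [between, Bool.and_eq_true, Bool.or_eq_true, Nat.blt_eq] at h
  constructor <;> rintro rfl <;> omega

/-- The pair of ranks `i j` describes how the segment `s` crosses the triangle; it is `0 0` if
at most one node is on `s`. -/
structure IsChord (S : Set Seg) (T : Triangle) (pos : Fin 10 → Plane) (p : Option (Fin 10))
    (s : Seg) (i j : Fin 10) : Prop where
  mem_list : (i, j) ∈ chordList (markCount S T) p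
  mem_carrier : i ≠ j → pos i ∈ carrier s ∧ pos j ∈ carrier s
  plain : ∀ r, plain (markCount S T) p r = true → pos r ∈ carrier s → i ≠ j ∧ (r = i ∨ r = j)
  pair : ∀ r r', used (markCount S T) p r = true → used (markCount S T) p r' = true → r ≠ r' →
    pos r ∈ carrier s → pos r' ∈ carrier s →
    i ≠ j ∧ (r = i ∨ r = j) ∧ (r' = i ∨ r' = j)

theorem used_of_plain {n : Fin 3 → ℕ} {p : Option (Fin 10)} {r : Fin 10}
    (h : plain n p r = true) : used n p r = true := by
  simp only [plain, Bool.and_eq_true] at h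
  exact h.1.2

theorem mod_three_ne_zero_of_plain {n : Fin 3 → ℕ} {p : Option (Fin 10)} {r : Fin 10}
    (h : plain n p r = true) : r.val % 3 ≠ 0 := by
  simp only [plain, Bool.and_eq_true, bne_iff_ne] at h
  exact h.1.1.2

theorem mem_chordList_zero (n : Fin 3 → ℕ) (p : Option (Fin 10)) : (0, 0) ∈ chordList n p :=
  List.mem_cons_self

theorem mem_chordList_of_validChord {n : Fin 3 → ℕ} {p : Option (Fin 10)} {i j : Fin 10}
    (hij : i < j) (h : validChord n p i j = true) : (i, j) ∈ chordList n p := by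
  refine List.mem_cons_of_mem _ (List.mem_filter.2 ⟨?_, ?_⟩)
  · exact List.mem_product.2 ⟨mem_ranks i, mem_ranks j⟩
  · simp only [h, Bool.and_true, Nat.blt_eq]
    exact hij

namespace Describes

variable {S : Set Seg} {T : Triangle} {pos : Fin 10 → Plane} {p : Option (Fin 10)}

theorem validChord_of_trace (hd : Describes S T pos p) (h : LocalAdmissible S T) {s : Seg}
    (hs : s ∈ S) {a b : Fin 10} (ha : used (markCount S T) p a = true)
    (hb : used (markCount S T) p b = true) (hab : a ≠ b)
    (htr : carrier s ∩ hull T = segment ℝ (pos a) (pos b))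
    (hon : ∀ r, used (markCount S T) p r = true → pos r ∈ carrier s → r = a ∨ r = b) :
    validChord (markCount S T) p a b = true := by
  have hac := (htr.symm.subset (left_mem_segment ℝ _ _)).1
  have hbc := (htr.symm.subset (right_mem_segment ℝ _ _)).1
  have hm : Meets s T := ⟨pos a, hac, hd.frame.mem_hull a⟩
  -- A plain mark is a single crossing by some segment. That segment is not `s`, which has a second
  -- point on this side; any other one meets `s` only in a boundary vertex.
  have hplain : ∀ {a b : Fin 10} {e : Fin 3}, a ≠ b → pos a ∈ carrier s → pos b ∈ carrier s →
      onSide e a = true → onSide e b = true → plain (markCount S T) p a = false := by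
    intro a b e hab hac hbc hea heb
    by_contra hpl
    rw [Bool.not_eq_false] at hpl
    obtain ⟨hmk, hnb⟩ := hd.mem_marks_of_plain hpl
    obtain rfl := eq_rankSide_of_onSide (mod_three_ne_zero_of_plain hpl) hea
    obtain ⟨s', hs', he'⟩ := LocalAdmissible.exists_segment_of_mark hmk hnb
    by_cases hss : s' = s
    · subst hss
      have : pos b = pos a := he'.subset ⟨hbc, hd.frame.mem_edge heb⟩
      exact hab (hd.frame.injective this).symm
    · have ha' : pos a ∈ carrier s' ∩ edge T (rankSide a) := by rw [he']; rfl
      exact hnb ⟨s, hs, (h.planar s' hs' s hs hss _ ⟨ha'.1, hac⟩).2⟩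
  have hside : ∀ e, (onSide e a && onSide e b && (plain (markCount S T) p a ||
      plain (markCount S T) p b ||
      ranks.any fun r => used (markCount S T) p r && between e a r b)) = false := by
    intro e
    by_contra hne
    rw [Bool.not_eq_false] at hne
    simp only [Bool.and_eq_true, Bool.or_eq_true, List.any_eq_true] at hne
    obtain ⟨⟨hea, heb⟩, (hpl | hpl) | ⟨r, -, hr, hbt⟩⟩ := hne
    · rw [hplain hab hac hbc hea heb] at hpl; exact Bool.false_ne_true hpl
    · rw [hplain hab.symm hbc hac heb hea] at hpl; exact Bool.false_ne_true hpl
    · have := ne_of_between hbt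
      rcases hon r hr (htr.symm.subset (hd.frame.mem_segment hea heb hbt)).1 with h | h
      exacts [this.1 h, this.2 h]
  simp only [validChord, ha, hb, anySide, hside, bne_iff_ne.2 hab]
  cases p with
  | none => rfl
  | some q =>
    have hq := (hd.boundary_iff (pos q)).2 ⟨q, rfl, rfl⟩
    have := hon q hd.isConsistent (h.isEnd hq.1 hq.2 hs hm).mem_carrier
    simpa using this

theorem exists_chord (hd : Describes S T pos p) (h : LocalAdmissible S T) {s : Seg} (hs : s ∈ S)
    (hm : Meets s T) : ∃ i j, IsChord S T pos p s i j := by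
  obtain ⟨x, hx, y, hy, htr, hon, hopen⟩ := h.exists_trace hs hm
  rw [hd.nodes_eq] at hx hy
  obtain ⟨a, ha, rfl⟩ := hx
  obtain ⟨b, hb, rfl⟩ := hy
  have hon' : ∀ r, used (markCount S T) p r = true → pos r ∈ carrier s → r = a ∨ r = b := by
    intro r hr hrs
    exact (hon (pos r) (by rw [hd.nodes_eq]; exact ⟨r, hr, rfl⟩) hrs).imp
      (fun h => hd.frame.injective h) fun h => hd.frame.injective h
  have hac := (htr.symm.subset (left_mem_segment ℝ _ _)).1
  have hbc := (htr.symm.subset (right_mem_segment ℝ _ _)).1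
  rcases lt_trichotomy a b with hab | rfl | hab
  · exact ⟨a, b, mem_chordList_of_validChord hab
        (hd.validChord_of_trace h hs ha hb hab.ne htr hon'), fun _ => ⟨hac, hbc⟩,
      fun r hr hrs => ⟨hab.ne, hon' r (used_of_plain hr) hrs⟩,
      fun r r' hr hr' _ hrs hrs' => ⟨hab.ne, hon' r hr hrs, hon' r' hr' hrs'⟩⟩
  -- A trace consisting of one node is coded by `(0, 0)`; by the last clause of `exists_trace` that
  -- node is not a plain mark.
  · refine ⟨0, 0, mem_chordList_zero _ _, fun h => absurd rfl h, fun r hr hrs => ?_,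
      fun r r' hr hr' hne hrs hrs' => ?_⟩
    · obtain ⟨hmk, hnb⟩ := hd.mem_marks_of_plain hr
      have : r = a := (or_self_iff).1 (hon' r (used_of_plain hr) hrs)
      subst this
      exact absurd (hopen rfl _ hmk.1) hnb
    · have h1 := (or_self_iff).1 (hon' r hr hrs)
      have h2 := (or_self_iff).1 (hon' r' hr' hrs')
      exact absurd (h1.trans h2.symm) hne
  · rw [segment_symm] at htr
    have hon'' := fun r hr hrs => (hon' r hr hrs).symm
    exact ⟨b, a, mem_chordList_of_validChord hab
        (hd.validChord_of_trace h hs hb ha hab.ne htr hon''), fun _ => ⟨hbc, hac⟩,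
      fun r hr hrs => ⟨hab.ne, hon'' r (used_of_plain hr) hrs⟩,
      fun r r' hr hr' _ hrs hrs' => ⟨hab.ne, hon'' r hr hrs, hon'' r' hr' hrs'⟩⟩

/-- Everything follows from the fact that a common point of two segments in `T` is the boundary
vertex, which has only one rank. -/
theorem compatible_chords (hd : Describes S T pos p) (h : LocalAdmissible S T) {s s' : Seg}
    (hs : s ∈ S) (hs' : s' ∈ S) (hne : s ≠ s') {i j k l : Fin 10}
    (hc : IsChord S T pos p s i j) (hc' : IsChord S T pos p s' k l) :
    compatible p i j k l = true := by
  by_cases hij : i = j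
  · simp [compatible, hij]
  by_cases hkl : k = l
  · simp [compatible, hkl]
  obtain ⟨hi, hj⟩ := hc.mem_carrier hij
  obtain ⟨hk, hl⟩ := hc'.mem_carrier hkl
  have hcommon : ∀ x, x ∈ carrier s → x ∈ carrier s' → x ∈ hull T →
      ∃ q, p = some q ∧ x = pos q := by
    intro x hx hx' hxT
    exact (hd.boundary_iff x).1 ⟨⟨s, hs, (h.planar s hs s' hs' hne x ⟨hx, hx'⟩).1⟩, hxT⟩
  have hcommon' : ∀ r, pos r ∈ carrier s → pos r ∈ carrier s' → p = some r := by
    intro r hr hr'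
    obtain ⟨q, hq, hrq⟩ := hcommon _ hr hr' (hd.frame.mem_hull r)
    rw [hd.frame.injective hrq, hq]
  cases p with
  | none =>
    have hcross : ∀ {a b : Fin 10}, pos a ∈ carrier s' → pos b ∈ carrier s' →
        crossing i j a b = false := by
      intro a b ha hb
      by_contra hcr
      rw [Bool.not_eq_false] at hcr
      simp only [crossing, Bool.and_eq_true] at hcr
      obtain ⟨⟨⟨h1, h2⟩, h3⟩, h4⟩ := hcr
      obtain ⟨o, ho, ho'⟩ := exists_mem_segment_inter (hd.frame.orient_pos h1)
        (hd.frame.orient_pos h2) (hd.frame.orient_pos h3) (hd.frame.orient_pos h4)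
      obtain ⟨q, hq, -⟩ := hcommon o ((convex_segment _ _).segment_subset hi hj ho)
        ((convex_segment _ _).segment_subset ha hb ho')
        ((convex_hull T).segment_subset (hd.frame.mem_hull i) (hd.frame.mem_hull j) ho)
      cases hq
    have hne' : ∀ {a b : Fin 10}, pos a ∈ carrier s → pos b ∈ carrier s' → a ≠ b := by
      rintro a b ha hb rfl
      cases hcommon' a ha hb
    simp [compatible, hcross hk hl, hcross hl hk, hne' hi hk, hne' hi hl, hne' hj hk, hne' hj hl]
  | some q =>
    have hnot : ¬ (pos i ∈ carrier s' ∧ pos j ∈ carrier s') := by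
      rintro ⟨hi', hj'⟩
      exact hij (Option.some.inj ((hcommon' i hi hi').symm.trans (hcommon' j hj hj')))
    have h1 : ¬ (i = k ∧ j = l) := by
      rintro ⟨rfl, rfl⟩; exact hnot ⟨hk, hl⟩
    have h2 : ¬ (i = l ∧ j = k) := by
      rintro ⟨rfl, rfl⟩; exact hnot ⟨hl, hk⟩
    simp only [compatible, beq_eq_false_iff_ne.2 hij, beq_eq_false_iff_ne.2 hkl, Bool.false_or]
    simp only [Bool.and_eq_true, Bool.not_eq_true', Bool.and_eq_false_iff, beq_eq_false_iff_ne]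
    tauto

theorem chordGood_of_compatible (hd : Describes S T pos p) (h : LocalAdmissible S T)
    {i j k l : Fin 10} (hij : (i, j) ∈ chordList (markCount S T) p)
    (hkl : (k, l) ∈ chordList (markCount S T) p) (hc : compatible p i j k l = true)
    (hcov : ∀ r, plain (markCount S T) p r = true →
      i ≠ j ∧ (r = i ∨ r = j) ∨ k ≠ l ∧ (r = k ∨ r = l)) :
    chordGood (markCount S T) p i j = true := by
  have hcov' : covers (markCount S T) p i j k l = true := by
    refine List.all_eq_true.2 fun r _ => ?_
    by_cases hr : plain (markCount S T) p r = true
    · have := hcov r hr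
      simpa [hr] using this
    · simp [hr]
  have hall := allCheck_apply chordCheck_all h.ncard_marks_le hd.isConsistent
  have := List.all_eq_true.1 (List.all_eq_true.1 hall (i, j) hij) (k, l) hkl
  change (!(compatible p i j k l && covers (markCount S T) p i j k l) ||
    chordGood (markCount S T) p i j) = true at this
  simpa [hc, hcov'] using this

theorem exists_segment_of_plain (hd : Describes S T pos p) {r : Fin 10}
    (hr : plain (markCount S T) p r = true) : ∃ s ∈ S, Meets s T ∧ pos r ∈ carrier s := by
  obtain ⟨hmk, hnb⟩ := hd.mem_marks_of_plain hr
  obtain ⟨s, hs, he⟩ := LocalAdmissible.exists_segment_of_mark hmk hnb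
  have hm : pos r ∈ carrier s ∩ edge T (rankSide r) := by rw [he]; rfl
  exact ⟨s, hs, ⟨pos r, hm.1, hd.frame.mem_hull r⟩, hm.1⟩

/-- At most one further segment meets `T`, and the two traces account for all plain marks, so the
finite check applies. A missing second segment is represented by `(0, 0)`. -/
theorem exists_chordGood (hd : Describes S T pos p) (h : LocalAdmissible S T) {s : Seg}
    (hs : s ∈ S) (hm : Meets s T) :
    ∃ i j, IsChord S T pos p s i j ∧ chordGood (markCount S T) p i j = true := by
  obtain ⟨i, j, hc⟩ := hd.exists_chord h hs hm
  refine ⟨i, j, hc, ?_⟩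
  by_cases hex : ∃ s' ∈ S, Meets s' T ∧ s' ≠ s
  · obtain ⟨s', hs', hm', hne⟩ := hex
    obtain ⟨k, l, hc'⟩ := hd.exists_chord h hs' hm'
    refine hd.chordGood_of_compatible h hc.mem_list hc'.mem_list
      (hd.compatible_chords h hs hs' hne.symm hc hc') fun r hr => ?_
    obtain ⟨s₀, hs₀, hm₀, hr₀⟩ := hd.exists_segment_of_plain hr
    rcases eq_of_encard_le_two h.two_segments (a := s₀) (b := s) (c := s') ⟨hs₀, hm₀⟩ ⟨hs, hm⟩
      ⟨hs', hm'⟩ with rfl | rfl | heq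
    · exact .inl (hc.plain r hr hr₀)
    · exact .inr (hc'.plain r hr hr₀)
    · exact absurd heq.symm hne
  · push Not at hex
    refine hd.chordGood_of_compatible h hc.mem_list (mem_chordList_zero _ _) ?_ fun r hr => ?_
    · simp [compatible]
    · obtain ⟨s₀, hs₀, hm₀, hr₀⟩ := hd.exists_segment_of_plain hr
      rw [hex s₀ hs₀ hm₀] at hr₀
      exact .inl (hc.plain r hr hr₀)

theorem canonicalizable (hd : Describes S T pos p) (h : LocalAdmissible S T) :
    canonicalizable (markCount S T) p = true := by
  have key : ∀ i j, chordGood (markCount S T) p i j = true →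
      SBMT.canonicalizable (markCount S T) p = true := fun i j hg => by
    rw [chordGood, Bool.and_eq_true] at hg
    exact hg.1
  by_cases hex : ∃ s ∈ S, Meets s T
  · obtain ⟨s, hs, hm⟩ := hex
    obtain ⟨i, j, -, hg⟩ := hd.exists_chordGood h hs hm
    exact key i j hg
  · push Not at hex
    refine key 0 0 (hd.chordGood_of_compatible h (mem_chordList_zero _ _)
      (mem_chordList_zero _ _) (by simp [compatible]) fun r hr => ?_)
    obtain ⟨s₀, hs₀, hm₀, -⟩ := hd.exists_segment_of_plain hr
    exact absurd hm₀ (hex s₀ hs₀)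

theorem patch_eq (hd : Describes S T pos p) (h : LocalAdmissible S T) {T₀ : Triangle}
    {g : Equiv.Perm (Fin 3)} (hT : T₀ ∘ g = T) {F : List RankTriple}
    (hF : rankTemplate (markCount S T) p = some F) :
    patch S T₀ g = rankTriangle pos '' {t | t ∈ F} := by
  have hkey : key S T = ⟨locationOf p, markCount S T 0, markCount S T 1, markCount S T 2⟩ := by
    rw [key, hd.location_eq]; rfl
  obtain ⟨G, hG, rfl⟩ := Option.map_eq_some_iff.1 hF
  have hl := allCheck_apply labelsCheck_all h.ncard_marks_le hd.isConsistent
  change labelsCheck (markCount S T) p = true at hl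
  simp only [labelsCheck, hG, List.all_eq_true, Bool.and_eq_true] at hl
  have hpl : ∀ f ∈ G, ccwTriangle (place S T f.1) (place S T f.2.1) (place S T f.2.2) =
      rankTriangle pos (labelRank p f.1, labelRank p f.2.1, labelRank p f.2.2) := by
    intro f hf
    have hu := fun x y hx hxT hy hyT => h.boundaryVertex_unique (x := x) (y := y) hx hxT hy hyT
    rw [hd.place_eq (hl f hf).1.1 h.ncard_marks_le hu, hd.place_eq (hl f hf).1.2 h.ncard_marks_le hu,
      hd.place_eq (hl f hf).2 h.ncard_marks_le hu]
    rfl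
  ext R
  simp only [patch, hT, hkey, hG, Option.some.injEq]
  constructor
  · rintro ⟨_, rfl, f, hf, rfl⟩
    exact ⟨_, List.mem_map_of_mem hf, (hpl f hf).symm⟩
  · rintro ⟨t, ht, rfl⟩
    obtain ⟨f, hf, rfl⟩ := List.mem_map.1 ht
    exact ⟨G, rfl, f, hf, (hpl f hf).symm⟩

end Describes

/-! ### Relabelling the corners -/

/-- Side `e` is opposite to corner `e + 2`, and the side opposite to corner `k` is `k + 1`; this
explains the formula for `edgeImage`. Reflections reverse the direction of the sides. -/
theorem edgeImage_spec : ∀ (g : Equiv.Perm (Fin 3)) (i : Fin 3),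
    g i = edgeImage g i ∧ g (i + 1) = edgeImage g i + 1 ∨
      g i = edgeImage g i + 1 ∧ g (i + 1) = edgeImage g i := by
  decide +kernel

theorem edgeImage_inverse : ∀ (g : Equiv.Perm (Fin 3)) (i : Fin 3),
    edgeImage g (g⁻¹ (i + 2) + 1) = i := by
  decide +kernel

theorem edge_comp (T : Triangle) (g : Equiv.Perm (Fin 3)) (i : Fin 3) :
    edge (T ∘ g) i = edge T (edgeImage g i) := by
  simp only [edge, Function.comp]
  rcases edgeImage_spec g i with ⟨h1, h2⟩ | ⟨h1, h2⟩ <;> rw [h1, h2]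
  exact segment_symm ℝ _ _

theorem openEdge_comp (T : Triangle) (g : Equiv.Perm (Fin 3)) (i : Fin 3) :
    openEdge (T ∘ g) i = openEdge T (edgeImage g i) := by
  simp only [openEdge, Function.comp]
  rcases edgeImage_spec g i with ⟨h1, h2⟩ | ⟨h1, h2⟩ <;> rw [h1, h2]
  exact openSegment_symm ℝ _ _

theorem marks_comp (S : Set Seg) (T : Triangle) (g : Equiv.Perm (Fin 3)) (i : Fin 3) :
    marks S (T ∘ g) i = marks S T (edgeImage g i) := by
  rw [marks, marks, edge_comp, openEdge_comp]

theorem range_comp_perm (T : Triangle) (g : Equiv.Perm (Fin 3)) : range (T ∘ g) = range T :=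
  g.surjective.range_comp T

theorem hull_comp (T : Triangle) (g : Equiv.Perm (Fin 3)) : hull (T ∘ g) = hull T := by
  rw [hull, hull, range_comp_perm]

theorem area_comp_ne {T : Triangle} (hT : area T ≠ 0) (g : Equiv.Perm (Fin 3)) :
    area (T ∘ g) ≠ 0 := by
  have hg : ∀ g : Equiv.Perm (Fin 3), g 1 = g 0 + 1 ∧ g 2 = g 0 + 2 ∨
      g 1 = g 0 + 2 ∧ g 2 = g 0 + 1 := by decide +kernel
  rcases hg g with ⟨h1, h2⟩ | ⟨h1, h2⟩
  · rwa [area, Function.comp, Function.comp, Function.comp, h1, h2, area_ne_iff_rotate]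
  · rw [area, Function.comp, Function.comp, Function.comp, h1, h2, orient_swap,
      area_ne_iff_rotate]
    exact neg_ne_zero.2 hT

theorem nodes_comp (S : Set Seg) (T : Triangle) (g : Equiv.Perm (Fin 3)) :
    nodes S (T ∘ g) = nodes S T := by
  have hs : Function.Surjective (edgeImage g) := fun i => ⟨_, edgeImage_inverse g i⟩
  have : ⋃ i, marks S (T ∘ g) i = ⋃ i, marks S T i := by
    simp only [marks_comp]
    exact hs.iUnion_comp fun i => marks S T i
  rw [nodes, nodes, range_comp_perm, hull_comp, this]

theorem LocalAdmissible.comp {S : Set Seg} {T : Triangle} (h : LocalAdmissible S T)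
    (g : Equiv.Perm (Fin 3)) : LocalAdmissible S (T ∘ g) := by
  refine ⟨area_comp_ne h.area_ne g, h.nondegenerate, h.planar, ?_, ?_⟩
  · simpa only [Meets, hull_comp] using h.two_segments
  · simpa only [Meets, hull_comp] using h.free_end

theorem location_comp {S : Set Seg} {T : Triangle} (h : LocalAdmissible S T)
    (g : Equiv.Perm (Fin 3)) : location S (T ∘ g) = permLocation g (location S T) := by
  have hg := h.comp g
  by_cases hex : ∃ x ∈ hull T, x ∈ boundaryVertices S
  · obtain ⟨x, hx, hb⟩ := hex
    rcases hull_cases h.area_ne hx with ⟨i, rfl⟩ | ⟨i, hi⟩ | hpos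
    · rw [h.location_corner hb, hg.location_corner (i := g⁻¹ i) (by simpa using hb)]
      rfl
    · rw [h.location_onEdge hi hb, hg.location_onEdge (i := g⁻¹ (i + 2) + 1) (x := x) _ hb]
      · rfl
      · rwa [openEdge_comp, edgeImage_inverse]
    · rw [h.location_inside hpos hb]
      rcases hull_cases hg.area_ne (x := x) (by rwa [hull_comp]) with ⟨i, hi⟩ | ⟨i, hi⟩ | hpos'
      · have h0 := hpos (g i + 1)
        rw [hi, Function.comp, bary_ne T (ne_add_one _)] at h0
        exact absurd h0 (lt_irrefl 0)
      · rw [openEdge_comp, mem_openEdge_iff h.area_ne] at hi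
        exact absurd hi.1 (hpos _).ne'
      · rw [hg.location_inside hpos' hb]; rfl
  · push Not at hex
    rw [location_absent hex, location_absent (by rwa [hull_comp])]
    rfl

/-! ### Patches of single triangles -/

theorem exists_symmetry {S : Set Seg} {T : Triangle} (h : LocalAdmissible S T) :
    ∃ g : Equiv.Perm (Fin 3), (template (key S (T ∘ g))).isSome := by
  obtain ⟨pos, p, hd⟩ := exists_describes h
  obtain ⟨g, -, hg⟩ := List.any_eq_true.1 (hd.canonicalizable h)
  refine ⟨g, ?_⟩
  rw [key, location_comp h, hd.location_eq, marks_comp, marks_comp, marks_comp]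
  exact hg

/-- The rank description is applied to `T ∘ g`, which has the same hull and the same nodes. Two
different nodes on one segment must be the two ends of its trace, and traces were verified to be
edges. -/
theorem isPatch_patch {S : Set Seg} {T : Triangle} (h : LocalAdmissible S T)
    {g : Equiv.Perm (Fin 3)} (hg : (template (key S (T ∘ g))).isSome) :
    IsPatch T (nodes S T) (patch S T g) ∧
      ∀ s ∈ S, ∀ x ∈ nodes S T, ∀ y ∈ nodes S T, x ≠ y → x ∈ carrier s → y ∈ carrier s →
        ∃ R ∈ patch S T g, x ∈ range R ∧ y ∈ range R := by
  have h' := h.comp g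
  obtain ⟨pos, p, hd⟩ := exists_describes h'
  obtain ⟨G, hG⟩ := Option.isSome_iff_exists.1 hg
  rw [key, hd.location_eq] at hG
  have hF : rankTemplate (markCount S (T ∘ g)) p =
      some (G.map fun f => (labelRank p f.1, labelRank p f.2.1, labelRank p f.2.2)) := by
    rw [rankTemplate, Option.map_eq_some_iff]
    exact ⟨G, hG, rfl⟩
  have hpatch := hd.patch_eq h' rfl hF
  have hnodes := hd.nodes_eq
  rw [nodes_comp] at hnodes
  constructor
  · have := hd.frame.isPatch h'.ncard_marks_le hd.isConsistent hF
    rw [hpatch, hnodes]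
    exact ⟨this.area_pos, this.corners, this.conforms, this.cover.trans (hull_comp T g),
      this.vertices⟩
  · intro s hs x hx y hy hxy hxs hys
    rw [hnodes] at hx hy
    obtain ⟨a, ha, rfl⟩ := hx
    obtain ⟨b, hb, rfl⟩ := hy
    have hab : a ≠ b := fun h => hxy (congrArg pos h)
    obtain ⟨i, j, hc, hgood⟩ := hd.exists_chordGood h' hs ⟨pos a, hxs, hd.frame.mem_hull a⟩
    obtain ⟨hij, hai, hbi⟩ := hc.pair a b ha hb hab hxs hys
    rw [chordGood, hF] at hgood
    simp only [Bool.and_eq_true, Bool.or_eq_true, beq_iff_eq, hij, false_or,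
      List.any_eq_true] at hgood
    obtain ⟨-, t, ht, hti, htj⟩ := hgood
    refine ⟨rankTriangle pos t, hpatch ▸ mem_image_of_mem _ ht, ?_, ?_⟩
    · rcases hai with rfl | rfl
      exacts [t.mem_range pos hti, t.mem_range pos htj]
    · rcases hbi with rfl | rfl
      exacts [t.mem_range pos hti, t.mem_range pos htj]

/-! ### Faces of triangles -/

theorem mem_convexHull_bary_zero {T : Triangle} (i : Fin 3) {V : Set Plane} {z : Plane}
    (hV : ∀ v ∈ V, 0 ≤ bary T i v) (hz : z ∈ convexHull ℝ V) (h0 : bary T i z = 0) :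
    z ∈ convexHull ℝ {v ∈ V | bary T i v = 0} :=
  mem_convexHull_zero (fun x y s t h => bary_comb T i x y s t h) hV hz h0.le

/-- Among the corners, `1 - bary T i` vanishes only at `T i` and is positive at the others. -/
theorem corner_mem_of_mem_convexHull {T : Triangle} (hT : area T ≠ 0) {V : Set Plane}
    (hV : V ⊆ range T) {i : Fin 3} (h : T i ∈ convexHull ℝ V) : T i ∈ V := by
  have hz := mem_convexHull_zero (f := fun x => 1 - bary T i x) (V := V) (z := T i)
    (fun x y s t hst => by simp only [bary_comb _ _ _ _ _ _ hst]; linear_combination (-1) * hst)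
    (by
      intro v hv
      obtain ⟨j, rfl⟩ := hV hv
      rcases eq_or_ne j i with rfl | hj
      · simp [bary_self hT]
      · simp [bary_ne T hj])
    h (by simp [bary_self hT])
  obtain ⟨v, hv, hv1⟩ := convexHull_nonempty_iff.1 ⟨_, hz⟩
  obtain ⟨j, rfl⟩ := hV hv
  rcases eq_or_ne j i with rfl | hj
  · exact hv
  · rw [bary_ne T hj] at hv1
    norm_num at hv1

theorem mem_pair_of_bary_eq_zero {T : Triangle} (hT : area T ≠ 0) {i : Fin 3} {v : Plane}
    (hv : v ∈ range T) (h0 : bary T (i + 2) v = 0) : v = T i ∨ v = T (i + 1) := by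
  obtain ⟨j, rfl⟩ := hv
  rcases corner_cases i j with rfl | rfl | rfl
  · exact .inl rfl
  · exact .inr rfl
  · rw [bary_self hT] at h0
    exact absurd h0 one_ne_zero

theorem exists_edge_of_pair {T : Triangle} {x y : Plane} (hx : x ∈ range T) (hy : y ∈ range T)
    (hxy : x ≠ y) : ∃ i, x = T i ∧ y = T (i + 1) ∨ x = T (i + 1) ∧ y = T i := by
  obtain ⟨i, rfl⟩ := hx
  obtain ⟨j, rfl⟩ := hy
  rcases corner_cases i j with rfl | rfl | rfl
  · exact absurd rfl hxy
  · exact ⟨i, .inl ⟨rfl, rfl⟩⟩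
  · exact ⟨i + 2, .inr ⟨by rw [add_two_add_one], rfl⟩⟩

theorem area_eq_zero_of_range_subset_edge {R T : Triangle} (hT : area T ≠ 0) {i : Fin 3}
    (h : range R ⊆ edge T i) : area R = 0 := by
  have h0 : ∀ j, bary T (i + 2) (R j) = 0 := fun j =>
    ((mem_edge_iff hT).1 (h (mem_range_self j))).2
  rw [area, orient_eq_det hT]
  fin_cases i <;> simp at h0 <;> simp only [h0] <;> ring

/-- A triangle meets each of its edges, and meets a conforming triangle's edge, in a face. -/
theorem hull_inter_segment {N : Set Triangle} (hN : IsMesh N) {R R₀ : Triangle} (hR : R ∈ N)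
    (hR₀ : R₀ ∈ N) {x y : Plane} (hx : x ∈ range R₀) (hy : y ∈ range R₀) (hxy : x ≠ y) :
    hull R ∩ segment ℝ x y = convexHull ℝ (range R ∩ {x, y}) := by
  apply Subset.antisymm
  · rintro z ⟨hz, hzs⟩
    by_cases h : R = R₀
    · subst h
      rw [inter_eq_right.2 (by rintro w (rfl | rfl) <;> assumption), convexHull_pair]
      exact hzs
    have hA : area R₀ ≠ 0 := (hN.ccw R₀ hR₀).ne'
    obtain ⟨i, hi⟩ := exists_edge_of_pair hx hy hxy
    have hpair : ({x, y} : Set Plane) = {R₀ i, R₀ (i + 1)} := by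
      rcases hi with ⟨rfl, rfl⟩ | ⟨rfl, rfl⟩
      exacts [rfl, pair_comm _ _]
    have hze : z ∈ edge R₀ i := by
      rwa [edge, ← convexHull_pair, ← hpair, convexHull_pair]
    obtain ⟨hzR, hz0⟩ := (mem_edge_iff hA).1 hze
    have hzc : z ∈ convexHull ℝ (range R ∩ range R₀) := by
      rw [← hN.conforming R hR R₀ hR₀ h]
      exact ⟨hz, hzR⟩
    have := mem_convexHull_bary_zero (i + 2) (fun v hv => ?_) hzc hz0
    · refine convexHull_mono ?_ this
      rintro v ⟨⟨hv, hv₀⟩, h0⟩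
      rw [hpair]
      exact ⟨hv, mem_pair_of_bary_eq_zero hA hv₀ h0⟩
    · exact (mem_hull_iff hA).1 (subset_convexHull ℝ _ hv.2) _
  · refine subset_inter (convexHull_mono inter_subset_left) ?_
    rw [← convexHull_pair]
    exact convexHull_mono inter_subset_right

/-! ### Nodes seen from different triangles of a mesh -/

namespace IsMesh

variable {M : Set Triangle}

theorem area_ne (hM : IsMesh M) {T : Triangle} (hT : T ∈ M) : area T ≠ 0 := (hM.ccw T hT).ne'

theorem corner_mem_range (hM : IsMesh M) {T T' : Triangle} (hT : T ∈ M) (hT' : T' ∈ M)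
    {i : Fin 3} (h : T i ∈ hull T') : T i ∈ range T' := by
  by_cases hne : T = T'
  · rw [← hne]; exact mem_range_self i
  have : T i ∈ convexHull ℝ (range T ∩ range T') := by
    rw [← hM.conforming T hT T' hT' hne]
    exact ⟨corner_mem_hull T i, h⟩
  exact (corner_mem_of_mem_convexHull (hM.area_ne hT) inter_subset_left this).2

/-- Two triangles that share the ends of an edge share that edge. -/
theorem exists_common_edge {T T' : Triangle} (hT : area T ≠ 0) {i : Fin 3} (h1 : T i ∈ range T')
    (h2 : T (i + 1) ∈ range T') : ∃ j, edge T' j = edge T i ∧ openEdge T' j = openEdge T i := by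
  obtain ⟨j, ⟨ha, hb⟩ | ⟨ha, hb⟩⟩ :=
    exists_edge_of_pair h1 h2 ((corner_injective hT).ne (ne_add_one i))
  · exact ⟨j, by rw [edge, edge, ha, hb], by rw [openEdge, openEdge, ha, hb]⟩
  · exact ⟨j, by rw [edge, edge, ha, hb, segment_symm],
      by rw [openEdge, openEdge, ha, hb, openSegment_symm]⟩

/-- The mark lies in the face spanned by the common corners. Were an end of its edge not shared,
that face would meet the edge in at most a corner. So the edge is common, and `marks` depends on it
only as a set. -/
theorem mark_mem (hM : IsMesh M) {S : Set Seg} {T T' : Triangle} (hT : T ∈ M) (hT' : T' ∈ M)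
    {i : Fin 3} {x : Plane} (hx : x ∈ marks S T i) (hxT' : x ∈ hull T') :
    ∃ j, x ∈ marks S T' j := by
  by_cases hne : T = T'
  · exact ⟨i, hne ▸ hx⟩
  have hA := hM.area_ne hT
  have hxc : x ∈ convexHull ℝ (range T ∩ range T') := by
    rw [← hM.conforming T hT T' hT' hne]
    exact ⟨LocalAdmissible.mark_mem_hull hx, hxT'⟩
  have hx0 := (mem_openEdge_iff hA).1 hx.1
  have hx1 := mem_convexHull_bary_zero (i + 2)
    (fun v hv => (mem_hull_iff hA).1 (subset_convexHull ℝ _ hv.1) _) hxc hx0.1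
  have hends : ∀ y ∈ ({T i, T (i + 1)} : Set Plane), y ∈ range T' := by
    intro y hy
    by_contra hyT'
    have hsub : {v ∈ range T ∩ range T' | bary T (i + 2) v = 0} ⊆
        {v | v ∈ ({T i, T (i + 1)} : Set Plane) ∧ v ≠ y} := by
      rintro v ⟨⟨hv, hv'⟩, h0⟩
      exact ⟨mem_pair_of_bary_eq_zero hA hv h0, fun h => hyT' (h ▸ hv')⟩
    have hx2 := convexHull_mono hsub hx1
    have hsing : ∀ k, {v | v ∈ ({T i, T (i + 1)} : Set Plane) ∧ v ≠ y} ⊆ {T k} → False := by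
      intro k hk
      have := convexHull_mono hk hx2
      rw [convexHull_singleton, mem_singleton_iff] at this
      exact corner_notMem_openEdge hA k i (this ▸ hx.1)
    rcases hy with rfl | rfl
    · refine hsing (i + 1) ?_
      rintro v ⟨rfl | rfl, hv⟩
      exacts [absurd rfl hv, rfl]
    · refine hsing i ?_
      rintro v ⟨rfl | rfl, hv⟩
      exacts [rfl, absurd rfl hv]
  have h1 : T i ∈ range T' := hends _ (by simp)
  have h2 : T (i + 1) ∈ range T' := hends _ (by simp)
  obtain ⟨j, hj, hj'⟩ := exists_common_edge hA h1 h2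
  refine ⟨j, ?_⟩
  rw [marks, hj, hj']
  exact hx

/-- This excludes hanging vertices: neighbouring patches agree on which points of the common face
are vertices. -/
theorem node_mem (hM : IsMesh M) {S : Set Seg} {T T' : Triangle} (hT : T ∈ M) (hT' : T' ∈ M)
    {x : Plane} (hx : x ∈ nodes S T) (hxT' : x ∈ hull T') : x ∈ nodes S T' := by
  rcases hx with (⟨i, rfl⟩ | hx) | hx
  · exact .inl (.inl (hM.corner_mem_range hT hT' hxT'))
  · obtain ⟨i, hi⟩ := mem_iUnion.1 hx
    obtain ⟨j, hj⟩ := hM.mark_mem hT hT' hi hxT'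
    exact .inl (.inr (mem_iUnion.2 ⟨j, hj⟩))
  · exact .inr ⟨hx.1, hxT'⟩

/-- Different triangles of a mesh meet inside an edge. -/
theorem exists_edge_superset (hM : IsMesh M) {T T' : Triangle} (hT : T ∈ M) (hT' : T' ∈ M)
    (hne : T ≠ T') : ∃ i, range T ∩ range T' ⊆ {T i, T (i + 1)} := by
  have hns : ¬ range T ⊆ range T' := by
    intro hsub
    refine hM.distinct T hT T' hT' hne (eq_of_subset_of_ncard_le hsub ?_ (finite_range T'))
    rw [← image_univ, ← image_univ, ncard_image_of_injective _ (corner_injective (hM.area_ne hT)),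
      ncard_image_of_injective _ (corner_injective (hM.area_ne hT'))]
  obtain ⟨_, ⟨k, rfl⟩, hk⟩ := not_subset.1 hns
  refine ⟨k + 1, ?_⟩
  rintro _ ⟨⟨j, rfl⟩, hj⟩
  rcases corner_cases k j with rfl | rfl | rfl
  · exact absurd hj hk
  · exact .inl rfl
  · right
    rw [add_assoc]; rfl

end IsMesh

/-! ### Gluing patches along common edges -/

theorem IsPatch.corner_of_mem {T : Triangle} {V : Set Plane} {N : Set Triangle}
    (h : IsPatch T V N) {R : Triangle} (hR : R ∈ N) {v : Plane} (hv : v ∈ V)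
    (hvR : v ∈ hull R) : v ∈ range R := by
  obtain ⟨R', hR', hvR'⟩ := h.vertices v hv
  by_cases hne : R = R'
  · rwa [hne]
  obtain ⟨j, rfl⟩ := hvR'
  have : R' j ∈ convexHull ℝ (range R ∩ range R') := by
    rw [← (h.conforms R hR R' hR' hne).2]
    exact ⟨hvR, corner_mem_hull R' j⟩
  exact (corner_mem_of_mem_convexHull (h.area_pos R' hR').ne' inter_subset_right this).1

theorem IsPatch.hull_subset {T : Triangle} {V : Set Plane} {N : Set Triangle}
    (h : IsPatch T V N) {R : Triangle} (hR : R ∈ N) : hull R ⊆ hull T := by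
  rw [← h.cover]
  exact subset_biUnion_of_mem (u := fun R => hull R) hR

theorem exists_bary_le {T : Triangle} (i : Fin 3) {V : Set Plane} {z : Plane}
    (hz : z ∈ convexHull ℝ V) : ∃ v ∈ V, bary T i v ≤ bary T i z := by
  by_contra! hlt
  have hc : Convex ℝ {x | bary T i z < bary T i x} := by
    intro x hx y hy s t hs ht hst
    simp only [mem_ofPred_eq] at *
    rw [bary_comb _ _ _ _ _ _ hst]
    rcases hs.eq_or_lt with rfl | hs'
    · obtain rfl : t = 1 := by linarith
      linarith
    · have h1 := mul_lt_mul_of_pos_left hx hs'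
      have h2 := mul_le_mul_of_nonneg_left hy.le ht
      have : bary T i z = s * bary T i z + t * bary T i z := by rw [← add_mul, hst, one_mul]
      linarith
  have := convexHull_min (t := {x | bary T i z < bary T i x}) (fun v hv => hlt v hv) hc hz
  rw [mem_ofPred_eq] at this
  exact lt_irrefl _ this

theorem exists_le_bary {T : Triangle} (i : Fin 3) {V : Set Plane} {z : Plane}
    (hz : z ∈ convexHull ℝ V) : ∃ v ∈ V, bary T i z ≤ bary T i v := by
  by_contra! hlt
  have hc : Convex ℝ {x | bary T i x < bary T i z} := by
    intro x hx y hy s t hs ht hst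
    simp only [mem_ofPred_eq] at *
    rw [bary_comb _ _ _ _ _ _ hst]
    rcases hs.eq_or_lt with rfl | hs'
    · obtain rfl : t = 1 := by linarith
      linarith
    · have h1 := mul_lt_mul_of_pos_left hx hs'
      have h2 := mul_le_mul_of_nonneg_left hy.le ht
      have : bary T i z = s * bary T i z + t * bary T i z := by rw [← add_mul, hst, one_mul]
      linarith
  have := convexHull_min (t := {x | bary T i x < bary T i z}) (fun v hv => hlt v hv) hc hz
  rw [mem_ofPred_eq] at this
  exact lt_irrefl _ this

/-- On a common edge, the faces of two triangles meet in the span of their common corners. -/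
theorem mem_convexHull_inter_of_edge {T R R' : Triangle} (hT : area T ≠ 0) {e : Fin 3}
    {V V' : Set Plane} {z : Plane} (hz : z ∈ edge T e) (hV : V ⊆ range R) (hV' : V' ⊆ range R')
    (hVe : V ⊆ edge T e) (hVe' : V' ⊆ edge T e) (hVR : ∀ v ∈ V, v ∈ hull R' → v ∈ range R')
    (hVR' : ∀ v ∈ V', v ∈ hull R → v ∈ range R) (hzV : z ∈ convexHull ℝ V)
    (hzV' : z ∈ convexHull ℝ V') : z ∈ convexHull ℝ (range R ∩ range R') := by
  have hzR : z ∈ hull R := convexHull_mono hV hzV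
  have hzR' : z ∈ hull R' := convexHull_mono hV' hzV'
  -- The higher of the two lower bounds lies in both triangles, hence is a corner of both; `high` is
  -- symmetric.
  have low : ∃ l ∈ range R ∩ range R', l ∈ edge T e ∧ bary T (e + 1) l ≤ bary T (e + 1) z := by
    obtain ⟨v, hv, hvz⟩ := exists_bary_le (T := T) (e + 1) hzV
    obtain ⟨w, hw, hwz⟩ := exists_bary_le (T := T) (e + 1) hzV'
    rcases le_total (bary T (e + 1) v) (bary T (e + 1) w) with h | h
    · have hwR : w ∈ hull R := (convex_hull R).segment_subset (subset_convexHull ℝ _ (hV hv)) hzR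
        (mem_segment_of_bary_le hT (hVe hv) hz (hVe' hw) h hwz)
      exact ⟨w, ⟨hVR' w hw hwR, hV' hw⟩, hVe' hw, hwz⟩
    · have hvR : v ∈ hull R' := (convex_hull R').segment_subset
        (subset_convexHull ℝ _ (hV' hw)) hzR' (mem_segment_of_bary_le hT (hVe' hw) hz (hVe hv) h hvz)
      exact ⟨v, ⟨hV hv, hVR v hv hvR⟩, hVe hv, hvz⟩
  have high : ∃ u ∈ range R ∩ range R', u ∈ edge T e ∧ bary T (e + 1) z ≤ bary T (e + 1) u := by
    obtain ⟨v, hv, hvz⟩ := exists_le_bary (T := T) (e + 1) hzV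
    obtain ⟨w, hw, hwz⟩ := exists_le_bary (T := T) (e + 1) hzV'
    rcases le_total (bary T (e + 1) w) (bary T (e + 1) v) with h | h
    · have hwR : w ∈ hull R := (convex_hull R).segment_subset hzR
        (subset_convexHull ℝ _ (hV hv)) (mem_segment_of_bary_le hT hz (hVe hv) (hVe' hw) hwz h)
      exact ⟨w, ⟨hVR' w hw hwR, hV' hw⟩, hVe' hw, hwz⟩
    · have hvR : v ∈ hull R' := (convex_hull R').segment_subset hzR'
        (subset_convexHull ℝ _ (hV' hw)) (mem_segment_of_bary_le hT hz (hVe' hw) (hVe hv) hvz h)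
      exact ⟨v, ⟨hV hv, hVR v hv hvR⟩, hVe hv, hvz⟩
  obtain ⟨l, hl, hle, hlz⟩ := low
  obtain ⟨u, hu, hue, huz⟩ := high
  exact segment_subset_convexHull hl hu (mem_segment_of_bary_le hT hle hue hz hlz huz)

/-- Patches of different triangles conform. -/
theorem conforms_of_patches {M : Set Triangle} (hM : IsMesh M) {S : Set Seg} {T T' : Triangle}
    (hT : T ∈ M) (hT' : T' ∈ M) (hne : T ≠ T') {N N' : Set Triangle}
    (hN : IsPatch T (nodes S T) N) (hN' : IsPatch T' (nodes S T') N') {R R' : Triangle}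
    (hR : R ∈ N) (hR' : R' ∈ N') : Conforms R R' := by
  have hA := hM.area_ne hT
  have hA' := hM.area_ne hT'
  obtain ⟨i, hi⟩ := hM.exists_edge_superset hT hT' hne
  have hinter := hM.conforming T hT T' hT' hne
  have hedge : hull T ∩ hull T' ⊆ edge T i := by
    rw [hinter, edge, ← convexHull_pair]
    exact convexHull_mono hi
  -- With equal corner sets, `R` would lie in one edge of `T` and be degenerate.
  refine conforms_of_subset (fun heq => ?_) ?_
  · refine (hN.area_pos R hR).ne' (area_eq_zero_of_range_subset_edge hA (i := i) ?_)
    intro v hv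
    exact hedge ⟨hN.hull_subset hR (subset_convexHull ℝ _ hv),
      hN'.hull_subset hR' (subset_convexHull ℝ _ (heq ▸ hv))⟩
  rintro z ⟨hzR, hzR'⟩
  have hzT := hN.hull_subset hR hzR
  have hzT' := hN'.hull_subset hR' hzR'
  have hzn : z ∈ range T → z ∈ range T' → z ∈ convexHull ℝ (range R ∩ range R') := fun h h' =>
    subset_convexHull ℝ _ ⟨hN.corner_of_mem hR (.inl (.inl h)) hzR,
      hN'.corner_of_mem hR' (.inl (.inl h')) hzR'⟩
  have hzc : z ∈ convexHull ℝ (range T ∩ range T') := hinter ▸ ⟨hzT, hzT'⟩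
  -- If at most one corner is shared, `z` is that corner, a node of both triangles.
  have hsingle : ∀ c, range T ∩ range T' ⊆ {c} → z ∈ convexHull ℝ (range R ∩ range R') := by
    intro c hc
    obtain ⟨v, hv⟩ := convexHull_nonempty_iff.1 ⟨z, hzc⟩
    have hzeq := convexHull_mono hc hzc
    rw [convexHull_singleton, mem_singleton_iff, ← hc hv] at hzeq
    exact hzn (hzeq ▸ hv.1) (hzeq ▸ hv.2)
  by_cases h1 : T i ∈ range T'
  swap
  · refine hsingle (T (i + 1)) fun v hv => (hi hv).resolve_left ?_
    rintro rfl
    exact h1 hv.2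
  by_cases h2 : T (i + 1) ∈ range T'
  swap
  · refine hsingle (T i) fun v hv => (hi hv).resolve_right fun hv' => h2 ?_
    rw [← mem_singleton_iff.1 hv']
    exact hv.2
  obtain ⟨j, hj, -⟩ := IsMesh.exists_common_edge hA h1 h2
  have hz := hedge ⟨hzT, hzT'⟩
  have hz' : z ∈ edge T' j := hj ▸ hz
  have hRT : ∀ v ∈ range R, v ∈ hull T := fun v hv =>
    hN.hull_subset hR (subset_convexHull ℝ _ hv)
  have hRT' : ∀ v ∈ range R', v ∈ hull T' := fun v hv =>
    hN'.hull_subset hR' (subset_convexHull ℝ _ hv)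
  have hzV := mem_convexHull_bary_zero (i + 2) (fun v hv => (mem_hull_iff hA).1 (hRT v hv) _) hzR
    ((mem_edge_iff hA).1 hz).2
  have hzV' := mem_convexHull_bary_zero (j + 2) (fun v hv => (mem_hull_iff hA').1 (hRT' v hv) _)
    hzR' ((mem_edge_iff hA').1 hz').2
  have hVe : {v ∈ range R | bary T (i + 2) v = 0} ⊆ edge T i := fun v hv =>
    (mem_edge_iff hA).2 ⟨hRT v hv.1, hv.2⟩
  have hVe' : {v ∈ range R' | bary T' (j + 2) v = 0} ⊆ edge T i := fun v hv =>
    hj ▸ (mem_edge_iff hA').2 ⟨hRT' v hv.1, hv.2⟩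
  refine mem_convexHull_inter_of_edge hA hz (fun v hv => hv.1) (fun v hv => hv.1) hVe hVe'
    (fun v hv hvR' => ?_) (fun v hv hvR => ?_) hzV hzV'
  · exact hN'.corner_of_mem hR' (hM.node_mem hT hT' (hN.corners R hR hv.1)
      (hN'.hull_subset hR' hvR')) hvR'
  · exact hN.corner_of_mem hR (hM.node_mem hT' hT (hN'.corners R' hR' hv.1)
      (hN.hull_subset hR hvR)) hvR

/-! ### The retriangulated mesh -/

theorem Admissible.localAdmissible {M : Set Triangle} {S : Set Seg} (hS : Admissible M S)
    (hM : IsMesh M) {T : Triangle} (hT : T ∈ M) : LocalAdmissible S T :=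
  ⟨hM.area_ne hT, hS.nondegenerate, hS.planar, hS.two_segments T hT, hS.free_end T hT⟩

theorem isMesh_retriangulate {M : Set Triangle} (hM : IsMesh M) {S : Set Seg}
    {g : Triangle → Equiv.Perm (Fin 3)}
    (hP : ∀ T ∈ M, IsPatch T (nodes S T) (patch S T (g T))) :
    IsMesh (retriangulate M S g) := by
  have hconf : ∀ R ∈ retriangulate M S g, ∀ R' ∈ retriangulate M S g, R ≠ R' →
      Conforms R R' := by
    intro R hR R' hR' hne
    simp only [retriangulate, mem_iUnion] at hR hR'
    obtain ⟨T, hT, hR⟩ := hR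
    obtain ⟨T', hT', hR'⟩ := hR'
    by_cases h : T = T'
    · subst h
      exact (hP T hT).conforms R hR R' hR' hne
    · exact conforms_of_patches hM hT hT' h (hP T hT) (hP T' hT') hR hR'
  refine ⟨fun R hR => ?_, fun R hR R' hR' hne => (hconf R hR R' hR' hne).1,
    fun R hR R' hR' hne => (hconf R hR R' hR' hne).2⟩
  simp only [retriangulate, mem_iUnion] at hR
  obtain ⟨T, hT, hR⟩ := hR
  exact (hP T hT).area_pos R hR

/-! ### Boundary segments as chains of edges -/

/-- The points of a segment listed in the theorem are the nodes on it. -/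
theorem mem_chain_iff {M : Set Triangle} {S : Set Seg} (hS : Admissible M S) {s : Seg}
    (hs : s ∈ S) {x : Plane} :
    x ∈ {s.1, s.2} ∪ intersectionPoints M s ↔ x ∈ carrier s ∧ ∃ T ∈ M, x ∈ nodes S T := by
  have hend : IsEnd s x → x ∈ {s.1, s.2} ∪ intersectionPoints M s := by
    rintro (rfl | rfl)
    exacts [.inl (.inl rfl), .inl (.inr rfl)]
  have hbv : x ∈ boundaryVertices S → x ∈ carrier s → IsEnd s x := by
    rintro ⟨s', hs', he⟩ hx
    by_cases h : s' = s
    · exact h ▸ he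
    · exact (hS.planar s' hs' s hs h x ⟨he.mem_carrier, hx⟩).2
  constructor
  · rintro (hx | ⟨T, hT, i, hi⟩ | ⟨hx, T, hT, i, rfl⟩)
    · have he : IsEnd s x := hx
      obtain ⟨T, hT, hxT⟩ := mem_iUnion₂.1 (hS.covered s hs he.mem_carrier)
      exact ⟨he.mem_carrier, T, hT, .inr ⟨⟨s, hs, he⟩, hxT⟩⟩
    · have hx : x ∈ carrier s ∩ edge T i := by rw [hi]; rfl
      refine ⟨hx.1, T, hT, .inl ?_⟩
      rcases edge_cases hx.2 with rfl | rfl | ho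
      · exact .inl (mem_range_self _)
      · exact .inl (mem_range_self _)
      · exact .inr (mem_iUnion.2 ⟨i, ho, .inr ⟨s, hs, hi⟩⟩)
    · exact ⟨hx, T, hT, .inl (.inl (mem_range_self i))⟩
  · rintro ⟨hx, T, hT, (⟨i, rfl⟩ | hm) | hb⟩
    · exact .inr (.inr ⟨hx, T, hT, i, rfl⟩)
    · obtain ⟨i, -, hb | ⟨s', hs', he⟩⟩ := mem_iUnion.1 hm
      · exact hend (hbv hb hx)
      · by_cases h : s' = s
        · exact .inr (.inl ⟨T, hT, i, h ▸ he⟩)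
        · have hxs' : x ∈ carrier s' ∩ edge T i := by rw [he]; rfl
          exact hend (hS.planar s' hs' s hs h x ⟨hxs'.1, hx⟩).2
    · exact hend (hbv hb.1 hx)

theorem LocalAdmissible.finite_nodes {S : Set Seg} {T : Triangle} (h : LocalAdmissible S T) :
    (nodes S T).Finite := by
  refine ((finite_range T).union (finite_iUnion h.finite_marks)).union ?_
  exact Set.Subsingleton.finite fun x hx y hy => h.boundaryVertex_unique hx.1 hx.2 hy.1 hy.2

theorem nodes_subset_hull (S : Set Seg) (T : Triangle) : nodes S T ⊆ hull T := by
  rintro x ((⟨i, rfl⟩ | hx) | hx)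
  · exact corner_mem_hull T i
  · obtain ⟨i, hi⟩ := mem_iUnion.1 hx
    exact LocalAdmissible.mark_mem_hull hi
  · exact hx.2

theorem finite_chain {M : Set Triangle} (hM : IsMesh M) {S : Set Seg} (hS : Admissible M S)
    {s : Seg} (hs : s ∈ S) (hfin : {T ∈ M | Meets s T}.Finite) :
    ({s.1, s.2} ∪ intersectionPoints M s).Finite := by
  refine (hfin.biUnion (t := fun T => nodes S T) fun T hT =>
    (hS.localAdmissible hM hT.1).finite_nodes).subset fun x hx => ?_
  obtain ⟨hxs, T, hT, hxT⟩ := (mem_chain_iff hS hs).1 hx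
  exact mem_biUnion (show T ∈ {T ∈ M | Meets s T} from
    ⟨hT, x, hxs, nodes_subset_hull S T hxT⟩) hxT

/-- Finitely many points of a segment, including its ends, in monotone order. -/
theorem exists_monotone_enumeration {a b : Plane} (hab : a ≠ b) {V : Set Plane} (hV : V.Finite)
    (ha : a ∈ V) (hb : b ∈ V) (hVs : V ⊆ segment ℝ a b) :
    ∃ (n : ℕ) (t : Fin (n + 1) → ℝ), StrictMono t ∧ t 0 = 0 ∧ t (Fin.last n) = 1 ∧
      (range fun k => (AffineMap.lineMap a b (t k) : Plane)) = V := by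
  have hinj := AffineMap.lineMap_injective ℝ hab
  have hfin : ((AffineMap.lineMap a b : ℝ →ᵃ[ℝ] Plane) ⁻¹' V).Finite := hV.preimage hinj.injOn
  set A := hfin.toFinset with hA
  have hmem : ∀ w, w ∈ A ↔ AffineMap.lineMap a b w ∈ V := fun w => by simp [hA]
  have h0 : (0 : ℝ) ∈ A := by rw [hmem]; simpa using ha
  have h1 : (1 : ℝ) ∈ A := by rw [hmem]; simpa using hb
  have hIcc : ∀ w ∈ A, w ∈ Icc (0 : ℝ) 1 := by
    intro w hw
    have := hVs ((hmem w).1 hw)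
    rw [segment_eq_image_lineMap] at this
    exact hinj.mem_set_image.1 this
  obtain ⟨n, hn⟩ : ∃ n, A.card = n + 1 :=
    Nat.exists_eq_succ_of_ne_zero (Finset.card_ne_zero_of_mem h0)
  have hrange : range (A.orderEmbOfFin hn) = A := Finset.range_orderEmbOfFin A hn
  have hmono : StrictMono (A.orderEmbOfFin hn) := (A.orderEmbOfFin hn).strictMono
  refine ⟨n, A.orderEmbOfFin hn, hmono, ?_, ?_, ?_⟩
  · obtain ⟨k, hk⟩ : (0 : ℝ) ∈ range (A.orderEmbOfFin hn) := by rw [hrange]; exact h0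
    refine le_antisymm ?_ (hIcc _ (A.orderEmbOfFin_mem hn 0)).1
    rw [← hk]
    exact hmono.monotone (Fin.zero_le k)
  · obtain ⟨k, hk⟩ : (1 : ℝ) ∈ range (A.orderEmbOfFin hn) := by rw [hrange]; exact h1
    refine le_antisymm (hIcc _ (A.orderEmbOfFin_mem hn _)).2 ?_
    rw [← hk]
    exact hmono.monotone (Fin.le_last k)
  · ext x
    constructor
    · rintro ⟨k, rfl⟩
      exact (hmem _).1 (A.orderEmbOfFin_mem hn k)
    · intro hx
      have hxs := hVs hx
      rw [segment_eq_image_lineMap] at hxs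
      obtain ⟨w, -, rfl⟩ := hxs
      obtain ⟨k, hk⟩ : w ∈ range (A.orderEmbOfFin hn) := by rw [hrange]; exact (hmem w).2 hx
      exact ⟨k, by simp only [hk]⟩

theorem isEmbeddedChain {M : Set Triangle} (hM : IsMesh M) {S : Set Seg} (hS : Admissible M S)
    {g : Triangle → Equiv.Perm (Fin 3)} (hg : IsConvention M S g) {s : Seg} (hs : s ∈ S)
    (hfin : {T ∈ M | Meets s T}.Finite) :
    IsEmbeddedChain (retriangulate M S g) s ({s.1, s.2} ∪ intersectionPoints M s) := by
  have hP := fun T (hT : T ∈ M) => isPatch_patch (hS.localAdmissible hM hT) (hg T hT)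
  have hN : IsMesh (retriangulate M S g) := isMesh_retriangulate hM fun T hT => (hP T hT).1
  have hne := hS.nondegenerate s hs
  have hinj := AffineMap.lineMap_injective ℝ hne
  obtain ⟨n, t, hmono, ht0, ht1, hrange⟩ := exists_monotone_enumeration hne
    (finite_chain hM hS hs hfin) (.inl (.inl rfl)) (.inl (.inr rfl))
    fun x hx => ((mem_chain_iff hS hs).1 hx).1
  have hmemV : ∀ k, (AffineMap.lineMap s.1 s.2 (t k) : Plane) ∈
      {s.1, s.2} ∪ intersectionPoints M s := fun k => by rw [← hrange]; exact mem_range_self k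
  have hgap : ∀ (k : Fin n) (w : ℝ), (AffineMap.lineMap s.1 s.2 w : Plane) ∈
      {s.1, s.2} ∪ intersectionPoints M s → w ≤ t k.castSucc ∨ t k.succ ≤ w := by
    intro k w hw
    rw [← hrange] at hw
    obtain ⟨m, hm⟩ := hw
    obtain rfl : t m = w := hinj hm
    rcases le_or_gt m k.castSucc with h | h
    · exact .inl (hmono.monotone h)
    · exact .inr (hmono.monotone (Fin.castSucc_lt_iff_succ_le.1 h))
  have hedge : ∀ k : Fin n, ∃ R ∈ retriangulate M S g,
      AffineMap.lineMap s.1 s.2 (t k.castSucc) ∈ range R ∧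
        AffineMap.lineMap s.1 s.2 (t k.succ) ∈ range R := by
    intro k
    have hlt : t k.castSucc < t k.succ := hmono Fin.castSucc_lt_succ
    have hx := (mem_chain_iff hS hs).1 (hmemV k.castSucc)
    have hy := (mem_chain_iff hS hs).1 (hmemV k.succ)
    -- The midpoint of the gap selects a triangle `T` containing it. The ends of the trace of `s` in
    -- `T` are nodes and cannot be strictly inside the gap, so the trace contains the whole gap.
    set w := (t k.castSucc + t k.succ) / 2 with hw
    have hws : (AffineMap.lineMap s.1 s.2 w : Plane) ∈ carrier s := by
      refine (convex_segment _ _).segment_subset hx.1 hy.1 ?_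
      rw [← image_segment, segment_eq_Icc hlt.le]
      exact mem_image_of_mem _ ⟨by linarith, by linarith⟩
    obtain ⟨T, hT, hwT⟩ := mem_iUnion₂.1 (hS.covered s hs hws)
    obtain ⟨p, hp, q, hq, htr, -, -⟩ :=
      (hS.localAdmissible hM hT).exists_trace hs ⟨_, hws, hwT⟩
    have hpV := (mem_chain_iff hS hs).2
      ⟨(htr.symm.subset (left_mem_segment ℝ p q)).1, T, hT, hp⟩
    have hqV := (mem_chain_iff hS hs).2
      ⟨(htr.symm.subset (right_mem_segment ℝ p q)).1, T, hT, hq⟩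
    obtain ⟨i, rfl⟩ := hrange.symm.subset hpV
    obtain ⟨j, rfl⟩ := hrange.symm.subset hqV
    have hwtr := htr.subset ⟨hws, hwT⟩
    simp only [← image_segment, segment_eq_uIcc] at hwtr
    rw [hinj.mem_set_image, mem_uIcc] at hwtr
    have hsub : Icc (t k.castSucc) (t k.succ) ⊆ uIcc (t i) (t j) := by
      intro v hv
      rw [mem_uIcc]
      have h1 := hgap k (t i) hpV
      have h2 := hgap k (t j) hqV
      rcases hwtr with h | h
      · left
        constructor
        · rcases h1 with h1 | h1 <;> linarith [hv.1, hv.2, h.1, h.2]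
        · rcases h2 with h2 | h2 <;> linarith [hv.1, hv.2, h.1, h.2]
      · right
        constructor
        · rcases h2 with h2 | h2 <;> linarith [hv.1, hv.2, h.1, h.2]
        · rcases h1 with h1 | h1 <;> linarith [hv.1, hv.2, h.1, h.2]
    have hhull : ∀ v ∈ Icc (t k.castSucc) (t k.succ),
        (AffineMap.lineMap s.1 s.2 v : Plane) ∈ hull T := by
      intro v hv
      refine (htr.symm.subset ?_).2
      rw [← image_segment, segment_eq_uIcc]
      exact mem_image_of_mem _ (hsub hv)
    obtain ⟨hxs, T₁, hT₁, hx₁⟩ := hx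
    -- The two points may be known as nodes of other triangles; `IsMesh.node_mem` makes them nodes
    -- of `T`.
    obtain ⟨hys, T₂, hT₂, hy₂⟩ := hy
    obtain ⟨R, hR, hxR, hyR⟩ := (hP T hT).2 s hs _
      (hM.node_mem hT₁ hT hx₁ (hhull _ ⟨le_rfl, hlt.le⟩)) _
      (hM.node_mem hT₂ hT hy₂ (hhull _ ⟨hlt.le, le_rfl⟩)) (hinj.ne hlt.ne) hxs hys
    exact ⟨R, mem_biUnion hT hR, hxR, hyR⟩
  have hcne : ∀ k : Fin n, (AffineMap.lineMap s.1 s.2 (t k.castSucc) : Plane) ≠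
      AffineMap.lineMap s.1 s.2 (t k.succ) := fun k => hinj.ne (hmono Fin.castSucc_lt_succ).ne
  refine ⟨n, fun k => AffineMap.lineMap s.1 s.2 (t k), t, hmono, fun _ => rfl, ?_, ?_, hrange, ?_,
    ?_⟩
  · simp [ht0]
  · simp [ht1]
  · intro k
    obtain ⟨R, hR, ⟨i, hi⟩, ⟨j, hj⟩⟩ := hedge k
    refine ⟨R, hR, i, j, ?_, hi, hj⟩
    rintro rfl
    exact hcne k (hi.symm.trans hj)
  · intro k R hR
    obtain ⟨R₀, hR₀, hx, hy⟩ := hedge k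
    exact hull_inter_segment hN hR hR₀ hx hy (hcne k)

end SBMT

/-! ### The theorem -/

theorem theorem3p5 (M : Set SBMT.Triangle) (hM : SBMT.IsMesh M)
    (S : Set SBMT.Seg) (hS : SBMT.Admissible M S)
    (hfin : ∀ s ∈ S, {T ∈ M | SBMT.Meets s T}.Finite) :
    (∃ g, SBMT.IsConvention M S g) ∧
    ∀ g, SBMT.IsConvention M S g →
      SBMT.IsMesh (SBMT.retriangulate M S g) ∧
      (∀ T ∈ M, ⋃ R ∈ SBMT.patch S T (g T), SBMT.hull R = SBMT.hull T) ∧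
      ∀ s ∈ S, SBMT.IsEmbeddedChain (SBMT.retriangulate M S g) s
        ({s.1, s.2} ∪ SBMT.intersectionPoints M s) := by
  constructor
  · have h : ∀ T, ∃ g : Equiv.Perm (Fin 3), T ∈ M →
        (SBMT.template (SBMT.key S (T ∘ g))).isSome := by
      intro T
      by_cases hT : T ∈ M
      · obtain ⟨g, hg⟩ := SBMT.exists_symmetry (hS.localAdmissible hM hT)
        exact ⟨g, fun _ => hg⟩
      · exact ⟨1, fun h => absurd h hT⟩
    choose g hg using h
    exact ⟨g, hg⟩
  · intro g hg
    have hP := fun T (hT : T ∈ M) => SBMT.isPatch_patch (hS.localAdmissible hM hT) (hg T hT)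
    exact ⟨SBMT.isMesh_retriangulate hM fun T hT => (hP T hT).1, fun T hT => (hP T hT).1.cover,
      fun s hs => SBMT.isEmbeddedChain hM hS hg hs (hfin s hs)⟩
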